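/- Let $S$ be a spherical surface of revolution with unit-speed simple profile curve $r\mapsto(f(r),0,g(r))$, $r\in[r_N,r_S]$, $r_N<r_S$, where $f,g$ are smooth, $f\ge 0$, and $f(r)=0$ exactly for $r=r_N$ (the north pole) and $r=r_S$ (the south pole). Assume that the metric $dr^2+f(r)^2d\theta^2$ has constant Gaussian curvature $K=-f''/f>0$, and let $\beta\in\mathbb R$ satisfy $-ff''+(f')^2=\beta^2$ on $(r_N,r_S)$. Let $\Theta=-f'/(\beta^2 f)$, which is an antiderivative of $1/f^2$ on $(r_N,r_S)$, let $\gamma>0$ and $h\in\mathbb R$, and consider the motion of a particle of unit mass on $S$ with potential $\gamma\Theta(r)$. In the coordinates $v=p_r/\sqrt{|\Theta|}$, $u=p_\theta/(f\sqrt{|\Theta|})$ the equations of motion are $$\frac{dr}{dt}=v\sqrt{|\Theta|},\qquad \frac{d\theta}{dt}=u\frac{\sqrt{|\Theta|}}{f},\qquad \frac{du}{dt}=-uv\Big(f'+\frac1{2f\Theta}\Big)\frac{\sqrt{|\Theta|}}{f},\qquad \frac{dv}{dt}=\Big(u^2f'-\frac{v^2}{2f\Theta}-\frac{\gamma}{f|\Theta|}\Big)\frac{\sqrt{|\Theta|}}{f}.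 \qquad (1)$$ Let $\mathbf M(h)$ be the energy manifold of all $(r,\theta,u,v)$ with $r\in[r_N,r_S]$, $\theta\in\mathbb R/2\pi\mathbb Z$, that satisfy $\operatorname{sgn}(\Theta(r))\frac{u^2+v^2}{2}+\gamma=\frac{h}{\Theta(r)}$; at the poles, where $\Theta=\mp\infty$, this relation is read as its limit, and states with $\Theta(r)=0$, at which these coordinates are not defined, are excluded. Let $\mathbf N=\{(r,\theta,u,v)\in\mathbf M(h): r=r_N\}=\{r=r_N,\ u^2+v^2=2\gamma\}$ be the set of collision singularities at the north pole. Block regularizability is meant in the following sense. Let $\phi$ be the local flow of (1) on $\mathbf M(h)\setminus\mathbf N$. For a compact set $\mathbf B\subset\mathbf M(h)$ with non-empty interior whose boundary $\mathbf b=\partial\mathbf B$ (interior and boundary are relative to $\mathbf M(h)$) is a smooth hypersurface disjoint from $\mathbf N$, let $\mathbf b^+$ (resp. $\mathbf b^-$) be the set of $x\in\mathbf b$ such that for some $\epsilon>0$ one has $\phi(x,t)\notin\mathbf B$ for all $t\in(-\epsilon,0)$ (resp. $t\in(0,\epsilon)$), and let $\mathbf t$ be the set of points of $\mathbf b$ at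 which the vector field is tangent to $\mathbf b$. $\mathbf B$ is an isolating block if $\mathbf t=\mathbf b^+\cap\mathbf b^-$ and $\mathbf t$ is a smooth submanifold of $\mathbf b$ of codimension $1$; it isolates $\mathbf N$ if $\mathbf N\subset\operatorname{int}\mathbf B$ and no orbit of a point of $\mathbf B\setminus\mathbf N$ is contained in $\mathbf B$. Let $\mathbf a^+$ be the set of $x\in\mathbf b^+$ with $\phi(x,t)\in\mathbf B$ for all $t\ge 0$ for which $\phi(x,t)$ is defined, and for $x\in\mathbf b^+\setminus\mathbf a^+$ let $T(x)=\inf\{t>0:\phi(x,t)\notin\mathbf B\}$. $\mathbf B$ is trivializable if the map across the block $x\mapsto\phi(x,T(x))$, $\mathbf b^+\setminus\mathbf a^+\to\mathbf b^-$, extends uniquely to a diffeomorphism from $\mathbf b^+$ to $\mathbf b^-$. $\mathbf N$ is block regularizable if there is a trivializable isolating block that isolates $\mathbf N$. Theorem. For every $h\in\mathbb R$, the singularity set $\mathbf N$ of (1) on $\mathbf M(h)$ is block regularizable if and only if $|\beta|=2/m$ for some positive integer $m$. -/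

import Mathlib

open Set
open scoped ContDiff Topology

noncomputable section

/-! ### Subsets of a normed space viewed as smooth manifolds -/

section BlockTheory

variable {E : Type*} [NormedAddCommGroup E] [NormedSpace ℝ E]

/-- `S` is a smooth embedded submanifold of `E` of codimension `k` (without boundary): near each of
its points it is a regular level set of a smooth map to `ℝ^k`. -/
def IsSmoothSubmanifold (k : ℕ) (S : Set E) : Prop :=
  ∀ x ∈ S, ∃ U : Set E, IsOpen U ∧ x ∈ U ∧ ∃ g : E → (Fin k → ℝ),
    ContDiffOn ℝ ∞ g U ∧ (∀ y ∈ U, Function.Surjective (fderiv ℝ g y)) ∧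
      S ∩ U = {y ∈ U | g y = 0}

/-- A map between two subsets of `E` is smooth if, near each point of its domain, it is the
restriction of a smooth map defined on an open subset of `E`. -/
def IsSmoothMap {S S' : Set E} (Ψ : S → S') : Prop :=
  ∀ x : S, ∃ U : Set E, IsOpen U ∧ (x : E) ∈ U ∧ ∃ g : E → E,
    ContDiffOn ℝ ∞ g U ∧ ∀ y : S, (y : E) ∈ U → (Ψ y : E) = g y

/-- A bijection that is smooth together with its inverse. -/
def IsDiffeo {S S' : Set E} (Ψ : S ≃ S') : Prop :=
  IsSmoothMap Ψ ∧ IsSmoothMap Ψ.symm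

/-- The interior of `B` relative to `M`. -/
def relInterior (M B : Set E) : Set E := {x ∈ M | B ∈ 𝓝[M] x}

/-- The topological boundary `∂B` of `B` relative to `M`. -/
def relBoundary (M B : Set E) : Set E := {x ∈ M | x ∈ closure B ∧ x ∈ closure (M \ B)}

/-! ### The local flow of a vector field with singularity set `N`

Throughout, `M` is the state manifold, `N ⊆ M` the singularity set and `F` the vector field, which
only matters on `M \ N`. -/

/-- `φ(x, t)` is defined and equals `y`, where `φ` is the local flow of `F` on `M \ N`. -/
def FlowsTo (M N : Set E) (F : E → E) (x : E) (t : ℝ) (y : E) : Prop :=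
  ∃ c : ℝ → E, c 0 = x ∧ c t = y ∧
    ∀ s ∈ uIcc 0 t, c s ∈ M \ N ∧ HasDerivWithinAt c (F (c s)) (uIcc 0 t) s

/-- The set `b⁺` of ingress points. -/
def ingress (M N : Set E) (F : E → E) (B : Set E) : Set E :=
  {x ∈ relBoundary M B | ∃ ε > 0, ∀ t ∈ Ioo (-ε) 0, ∀ y, FlowsTo M N F x t y → y ∉ B}

/-- The set `b⁻` of egress points. -/
def egress (M N : Set E) (F : E → E) (B : Set E) : Set E :=
  {x ∈ relBoundary M B | ∃ ε > 0, ∀ t ∈ Ioo 0 ε, ∀ y, FlowsTo M N F x t y → y ∉ B}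

/-- The set `t` of boundary points at which the vector field is tangent to the boundary. -/
def tangency (M : Set E) (F : E → E) (B : Set E) : Set E :=
  {x ∈ relBoundary M B | F x ∈ tangentConeAt ℝ (relBoundary M B) x}

/-- `B` is an isolating block; `k` is the codimension of `M` in `E`, so the boundary is a
hypersurface of `M`, and the tangency set is a hypersurface of the boundary. -/
structure IsIsolatingBlock (k : ℕ) (M N : Set E) (F : E → E) (B : Set E) : Prop where
  subset : B ⊆ M
  isCompact : IsCompact B
  interior_nonempty : (relInterior M B).Nonempty
  boundary_disjoint : Disjoint (relBoundary M B) N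
  boundary_smooth : IsSmoothSubmanifold (k + 1) (relBoundary M B)
  tangency_eq : tangency M F B = ingress M N F B ∩ egress M N F B
  tangency_smooth : IsSmoothSubmanifold (k + 2) (tangency M F B)

/-- `B` isolates the singularity set `N`: `N` lies in the interior of `B`, and no orbit that meets
`B \ N` is contained in `B`. -/
def Isolates (M N : Set E) (F : E → E) (B : Set E) : Prop :=
  N ⊆ relInterior M B ∧ ∀ x ∈ B \ N, ∃ t y, FlowsTo M N F x t y ∧ y ∉ B

/-- The set `a⁺` of ingress points whose forward orbit stays in `B` as long as it is defined. -/
def asymptoticIn (M N : Set E) (F : E → E) (B : Set E) : Set E :=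
  {x ∈ ingress M N F B | ∀ t, 0 ≤ t → ∀ y, FlowsTo M N F x t y → y ∈ B}

/-- The time `T(x)` spent in the block by the orbit that starts at `x ∈ b⁺ \ a⁺`. -/
def exitTime (M N : Set E) (F : E → E) (B : Set E) (x : E) : ℝ :=
  sInf {t : ℝ | 0 < t ∧ ∃ y, FlowsTo M N F x t y ∧ y ∉ B}

/-- `B` is trivializable: the map across the block `x ↦ φ(x, T(x))`, defined on `b⁺ \ a⁺`, extends
uniquely to a diffeomorphism from `b⁺` to `b⁻`. -/
def IsTrivializable (M N : Set E) (F : E → E) (B : Set E) : Prop :=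
  ∃! Ψ : ingress M N F B ≃ egress M N F B, IsDiffeo Ψ ∧
    ∀ x : ingress M N F B, (x : E) ∉ asymptoticIn M N F B →
      FlowsTo M N F x (exitTime M N F B x) (Ψ x)

/-- The singularity set `N` of the vector field `F` on `M \ N` is block regularizable: there is a
trivializable isolating block that isolates `N`. Here `k` is the codimension of `M` in `E`. -/
def IsBlockRegularizable (k : ℕ) (M N : Set E) (F : E → E) : Prop :=
  ∃ B : Set E, IsIsolatingBlock k M N F B ∧ Isolates M N F B ∧ IsTrivializable M N F B

end BlockTheory

/-! ### Spherical surfaces of revolution -/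

/-- A spherical surface of revolution, given by its unit speed simple profile curve
`r ↦ (f r, 0, g r)`, `r ∈ [rN, rS]`, which meets the axis exactly at its two end points. -/
structure SphericalSurface where
  /-- distance to the axis of rotation -/
  f : ℝ → ℝ
  /-- height -/
  g : ℝ → ℝ
  /-- parameter of the north pole -/
  rN : ℝ
  /-- parameter of the south pole -/
  rS : ℝ
  rN_lt_rS : rN < rS
  smooth_f : ContDiffOn ℝ ∞ f (Icc rN rS)
  smooth_g : ContDiffOn ℝ ∞ g (Icc rN rS)
  f_nonneg : ∀ r ∈ Icc rN rS, 0 ≤ f r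
  f_eq_zero_iff : ∀ r ∈ Icc rN rS, f r = 0 ↔ r = rN ∨ r = rS
  simple : InjOn (fun r => (f r, g r)) (Icc rN rS)
  unit_speed : ∀ r ∈ Ioo rN rS, deriv f r ^ 2 + deriv g r ^ 2 = 1

namespace SphericalSurface

variable (S : SphericalSurface)

/-- The Gaussian curvature of the metric `dr² + f(r)² dθ²`. -/
def gaussCurvature (r : ℝ) : ℝ := -deriv (deriv S.f) r / S.f r

/-- The antiderivative `Θ` of `1 / f²` on `(rN, rS)` that satisfies `f' / f = -β² Θ`. -/
def theta (β r : ℝ) : ℝ := -deriv S.f r / (β ^ 2 * S.f r)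

/-- `Θ` is an antiderivative of `1 / f²` on surfaces with `-f f'' + (f')² = β²`. -/
theorem hasDerivAt_theta (β : ℝ) (hβ0 : β ≠ 0)
    (hβ : ∀ r ∈ Ioo S.rN S.rS, -S.f r * deriv (deriv S.f) r + deriv S.f r ^ 2 = β ^ 2)
    (r : ℝ) (hr : r ∈ Ioo S.rN S.rS) : HasDerivAt (S.theta β) (1 / S.f r ^ 2) r := by
  have hf0 : S.f r ≠ 0 := fun h =>
    ((S.f_eq_zero_iff r (Ioo_subset_Icc_self hr)).1 h).elim hr.1.ne' hr.2.ne
  have hf : ContDiffAt ℝ ∞ S.f r := S.smooth_f.contDiffAt (Icc_mem_nhds hr.1 hr.2)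
  have h1 : HasDerivAt S.f (deriv S.f r) r := (hf.differentiableAt (by simp)).hasDerivAt
  have h2 : HasDerivAt (deriv S.f) (deriv (deriv S.f) r) r := by
    have h3 : ContDiffAt ℝ 1 (deriv S.f) r := by
      have h4 : ContDiffAt ℝ 1 (fderiv ℝ S.f) r := hf.fderiv_right (by norm_cast)
      have h5 : deriv S.f = fun x => fderiv ℝ S.f x 1 := by
        funext x
        simp
      rw [h5]
      exact h4.clm_apply contDiffAt_const
    exact (h3.differentiableAt (by simp)).hasDerivAt
  have h6 := (h2.neg).div (h1.const_mul (β ^ 2)) (mul_ne_zero (pow_ne_zero 2 hβ0) hf0)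
  refine h6.congr_deriv ?_
  have := hβ r hr
  rw [Pi.neg_apply]
  field_simp
  linear_combination this

/-! ### The Kepler problem in the coordinates `(r, θ, u, v)`

The angle `θ` is taken modulo `2π`: it is recorded by the point `z = e^{iθ}` of the unit circle of
`ℂ`. A state is a tuple `(r, z, u, v)` in `ℝ × ℂ × ℝ × ℝ`. -/

/-- The energy manifold `M(h)`: all `(r, z, u, v)` with `|z| = 1`, `r ∈ [rN, rS]` and
`sgn(Θ) (u² + v²) / 2 + γ = h / Θ`. At the poles, where `Θ` is `-∞` and `+∞`, the relation is read
as its limit; where `Θ = 0`, the coordinates `u, v` and the relation are not defined. -/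
def energyManifold (β γ h : ℝ) : Set (ℝ × ℂ × ℝ × ℝ) :=
  {p | ‖p.2.1‖ = 1 ∧
    ((p.1 = S.rN ∧ -((p.2.2.1 ^ 2 + p.2.2.2 ^ 2) / 2) + γ = 0) ∨
      (p.1 = S.rS ∧ (p.2.2.1 ^ 2 + p.2.2.2 ^ 2) / 2 + γ = 0) ∨
      (p.1 ∈ Ioo S.rN S.rS ∧ S.theta β p.1 ≠ 0 ∧
        Real.sign (S.theta β p.1) * ((p.2.2.1 ^ 2 + p.2.2.2 ^ 2) / 2) + γ
          = h / S.theta β p.1))}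

/-- The collision set `N`: the states in `M(h)` at the north pole. -/
def collisionSet (β γ h : ℝ) : Set (ℝ × ℂ × ℝ × ℝ) :=
  {p ∈ S.energyManifold β γ h | p.1 = S.rN}

/-- The vector field of the Kepler problem with potential `γ Θ(r)` and unit mass in the coordinates
`(r, z, u, v)`, with `v = p_r / √|Θ|` and `u = p_θ / (f √|Θ|)`; the second component says that
`dθ/dt = u √|Θ| / f`. -/
def keplerField (β γ : ℝ) (p : ℝ × ℂ × ℝ × ℝ) : ℝ × ℂ × ℝ × ℝ :=
  let r := p.1
  let z := p.2.1
  let u := p.2.2.1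
  let v := p.2.2.2
  let Θ := S.theta β r
  let s := √|Θ| / S.f r
  (v * √|Θ|,
   ((u * s : ℝ) : ℂ) * Complex.I * z,
   -(u * v) * (deriv S.f r + 1 / (2 * S.f r * Θ)) * s,
   (u ^ 2 * deriv S.f r - v ^ 2 / (2 * S.f r * Θ) - γ / (S.f r * |Θ|)) * s)

end SphericalSurface

end

/-!
Constant positive curvature forces `f'' = -K f`, so that `S` is a spindle: `f` is a multiple of
`sin (b² (r - rN) / c)`, where `b = |β|` and the cone angle at the poles is `2πb`
(`isSpindle_of_curvature`). The gnomonic radius `ρ = -1 / Θ = c tan (b² (r - rN) / c)` turns the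
potential `γ Θ` into the planar Kepler potential `-γ / ρ`, and the orbits on the northern hemisphere
into Kepler orbits on a cone. Therefore Levi-Civita's regularization applies: with `ρ = |q|²` and a
suitable time, the radial motion is that of the linear system `q'' = k q` in `ℂ`, and the angle on
the surface is `θ = (2 / b) arg q`, up to sign and a constant (`IsSpindle.isOrbit`). The solutions
are rational functions of a parameter `n`, which makes all of the following explicit.

*Necessity.* Consider the radial solution, which falls into the pole, and the solutions close to it
that fly by the pole on the left or on the right, the flybys. In the plane of `q` a flyby turns by
an angle that tends to `π`, so on the surface the outgoing meridians tend to `exp (± 2πi / b)` times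
the incoming one, with the sign given by the side. Given a trivializable isolating block, the radial
solution has a last entry point `x` into it before the collision (`exists_last_entry`). There it
crosses the boundary transversally, because tangency is possible only where an orbit is outside of
the block both before and after. So the nearby flybys also enter close to `x`, and they stay in the
block until they have passed the pole (`exists_crossing_flyby`). As the extension of the map across
the block is continuous at `x`, both limit meridians are that of the image of `x`. Hence
`exp (4πi / b) = 1`, and `b = 2 / m` (`exists_eq_two_div`).

*Sufficiency.* If `b = 2 / m`, the map `q ↦ (ρ, z) = (|q|², (q / |q|)^m)` is single valued, and the
plane without the origin covers the punctured hemisphere. Take for the block a small cap `ρ ≤ ρ₀`.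
Its boundary is a torus in phase space, tangency is the condition `v = 0`, and `ρ` has a strict
minimum at tangency because `ρ'' > 0` near the pole; so the cap is an isolating block that isolates
the collisions (`isIsolatingBlock`, `isolates`). Across the cap, `q` is multiplied by
`-ζ / |ζ|` with `ζ = γ - κ² u² + i κ u v`, where `κ` depends on `ρ₀` only (`flowsTo_crossMap`). This
number `ζ` has no zeros on the boundary, so the formula defines a smooth involution, `crossMap`, also
on the set `u = 0` of the collision orbits. It exchanges ingress and egress points, and is the only
continuous extension since the points with `u ≠ 0` are dense (`isTrivializable`).
-/

open Filter

noncomputable section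

/-! ### The local flow of a vector field -/

section Flow

variable {E : Type*} [NormedAddCommGroup E] [NormedSpace ℝ E] {M N B : Set E} {F : E → E}

/-- Reversing time replaces the vector field by its negative. -/
theorem FlowsTo.neg {x y : E} {t : ℝ} (h : FlowsTo M N F x t y) : FlowsTo M N (-F) x (-t) y := by
  obtain ⟨c, h0, ht, hc⟩ := h
  have hmem : ∀ s ∈ uIcc 0 (-t), -s ∈ uIcc 0 t := fun s hs => by
    rw [mem_uIcc] at hs ⊢; rcases hs with h | h
    · right; constructor <;> linarith
    · left; constructor <;> linarith
  refine ⟨fun s => c (-s), by simpa using h0, by simpa using ht, fun s hs => ?_⟩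
  obtain ⟨h1, h2⟩ := hc (-s) (hmem s hs)
  refine ⟨h1, ?_⟩
  have := h2.scomp s (hasDerivAt_neg s).hasDerivWithinAt hmem
  simpa [Function.comp_def] using this

/-- Integral curves of a locally `C¹` vector field are determined by their initial value. -/
theorem eqOn_Icc_of_hasDerivWithinAt {A : Set E} (hF : ∀ p ∈ A, ContDiffAt ℝ 1 F p)
    {c₁ c₂ : ℝ → E} {T : ℝ} (h0 : c₁ 0 = c₂ 0)
    (h₁ : ∀ s ∈ Icc 0 T, c₁ s ∈ A ∧ HasDerivWithinAt c₁ (F (c₁ s)) (Icc 0 T) s)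
    (h₂ : ∀ s ∈ Icc 0 T, c₂ s ∈ A ∧ HasDerivWithinAt c₂ (F (c₂ s)) (Icc 0 T) s) :
    EqOn c₁ c₂ (Icc 0 T) := by
  have k₁ : ContinuousOn c₁ (Icc 0 T) := fun s hs => (h₁ s hs).2.continuousWithinAt
  have k₂ : ContinuousOn c₂ (Icc 0 T) := fun s hs => (h₂ s hs).2.continuousWithinAt
  have hcl : IsClosed ({s | c₁ s = c₂ s} ∩ Icc 0 T) := by
    have := (k₁.prodMk k₂).preimage_isClosed_of_isClosed isClosed_Icc (isClosed_diagonal (X := E))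
    rw [inter_comm]
    exact this
  refine hcl.Icc_subset_of_forall_exists_gt h0 ?_
  rintro s ⟨hs : c₁ s = c₂ s, hsT⟩ y hy
  have hsI : s ∈ Icc 0 T := Ico_subset_Icc_self hsT
  obtain ⟨K, V, hV, hL⟩ := (hF _ (h₁ s hsI).1).exists_lipschitzOnWith
  have e₁ : ∀ᶠ r in 𝓝[Icc 0 T] s, c₁ r ∈ V := k₁ s hsI hV
  have e₂ : ∀ᶠ r in 𝓝[Icc 0 T] s, c₂ r ∈ V := k₂ s hsI (hs ▸ hV)
  obtain ⟨ε, hε, hball⟩ := Metric.mem_nhdsWithin_iff.1 (e₁.and e₂)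
  set s' := min (s + ε / 2) (min y T) with hs'
  have hss' : s < s' := lt_min (by linarith) (lt_min hy hsT.2)
  have hs'T : s' ≤ T := (min_le_right _ _).trans (min_le_right _ _)
  have hs'ε : s' ≤ s + ε / 2 := min_le_left _ _
  have hsub : Icc s s' ⊆ Icc 0 T := Icc_subset_Icc hsT.1 hs'T
  have hin : ∀ r ∈ Icc s s', c₁ r ∈ V ∧ c₂ r ∈ V := fun r hr => by
    refine hball ⟨?_, hsub hr⟩
    rw [Metric.mem_ball, Real.dist_eq, abs_lt]
    constructor <;> linarith [hr.1, hr.2]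
  have hder : ∀ {c : ℝ → E}, (∀ s ∈ Icc 0 T, c s ∈ A ∧
      HasDerivWithinAt c (F (c s)) (Icc 0 T) s) → ∀ r ∈ Ico s s',
      HasDerivWithinAt c (F (c r)) (Ici r) r := fun h r hr => by
    have h3 := (h r (hsub (Ico_subset_Icc_self hr))).2
    refine (h3.mono_of_mem_nhdsWithin ?_)
    exact mem_of_superset (Icc_mem_nhdsGE (hr.2.trans_le hs'T))
      (Icc_subset_Icc_left (hsT.1.trans hr.1))
  have := ODE_solution_unique_of_mem_Icc_right (v := fun _ => F) (s := fun _ => V) (K := K)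
    (fun _ _ => hL) (k₁.mono hsub) (hder h₁) (fun r hr => (hin r (Ico_subset_Icc_self hr)).1)
    (k₂.mono hsub) (hder h₂) (fun r hr => (hin r (Ico_subset_Icc_self hr)).2) hs
  exact ⟨s', this (right_mem_Icc.2 hss'.le), hss', (min_le_right _ _).trans (min_le_left _ _)⟩

/-- The local flow of a vector field that is `C¹` on the regular part of the state manifold is
single valued. -/
theorem FlowsTo.unique (hF : ∀ p ∈ M \ N, ContDiffAt ℝ 1 F p) {x y y' : E} {t : ℝ}
    (h : FlowsTo M N F x t y) (h' : FlowsTo M N F x t y') : y = y' := by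
  have key : ∀ {G : E → E}, (∀ p ∈ M \ N, ContDiffAt ℝ 1 G p) → ∀ {t : ℝ}, 0 ≤ t →
      FlowsTo M N G x t y → FlowsTo M N G x t y' → y = y' := by
    rintro G hG t ht ⟨c, h0, rfl, hc⟩ ⟨c', h0', rfl, hc'⟩
    rw [uIcc_of_le ht] at hc hc'
    exact eqOn_Icc_of_hasDerivWithinAt hG (h0.trans h0'.symm) hc hc' (right_mem_Icc.2 ht)
  rcases le_total 0 t with ht | ht
  · exact key hF ht h h'
  · exact key (G := -F) (fun p hp => (hF p hp).neg) (neg_nonneg.2 ht) h.neg h'.neg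

/-- Change of time: a curve whose velocity is a positive multiple of the vector field runs through
the local flow, and the physical time is an increasing function of its parameter. -/
theorem exists_time {X : ℝ → E} {g : ℝ → ℝ} {a b n₀ : ℝ} (hn₀ : n₀ ∈ Icc a b)
    (hX : ∀ n ∈ Icc a b, X n ∈ M \ N)
    (hd : ∀ n ∈ Icc a b, HasDerivWithinAt X (g n • F (X n)) (Icc a b) n)
    (hg : ContinuousOn g (Icc a b)) (hpos : ∀ n ∈ Icc a b, 0 < g n) :
    ∃ G : ℝ ≃o ℝ, G n₀ = 0 ∧ ∀ n ∈ Icc a b, FlowsTo M N F (X n₀) (G n) (X n) := by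
  have hab : a ≤ b := hn₀.1.trans hn₀.2
  -- Extend `g` to the line by its boundary values: this extension has a positive minimum.
  obtain ⟨m, hm, hmin⟩ := isCompact_Icc.exists_isMinOn (nonempty_Icc.2 hab) hg
  set e : ℝ → ℝ := IccExtend hab ((Icc a b).domRestrict g) with he
  have hec : Continuous e := hg.domRestrict.Icc_extend'
  have heg : ∀ n ∈ Icc a b, e n = g n := fun n hn => IccExtend_of_mem hab _ hn
  have hemin : ∀ n, g m ≤ e n := fun n => hmin (projIcc a b hab n).2
  have hm0 : 0 < g m := hpos m hm
  let G₀ : ℝ → ℝ := fun n => ∫ s in n₀..n, e s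
  have hG : ∀ n, HasDerivAt G₀ (e n) n := fun n =>
    intervalIntegral.integral_hasDerivAt_right (hec.intervalIntegrable _ _)
      (hec.stronglyMeasurableAtFilter _ _) hec.continuousAt
  have hmono : StrictMono G₀ := strictMono_of_deriv_pos fun n => by
    rw [(hG n).deriv]; exact hm0.trans_le (hemin n)
  have hcont : Continuous G₀ := continuous_iff_continuousAt.2 fun n => (hG n).continuousAt
  have hlow : Monotone fun n => G₀ n - g m * n := by
    have hd' : ∀ n, HasDerivAt (fun n => G₀ n - g m * n) (e n - g m * 1) n := fun n =>
      (hG n).sub ((hasDerivAt_id n).const_mul (g m))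
    refine monotone_of_deriv_nonneg (fun n => (hd' n).differentiableAt) fun n => ?_
    rw [(hd' n).deriv]; linarith [hemin n]
  have hG0 : G₀ n₀ = 0 := intervalIntegral.integral_same
  have hsurj : Function.Surjective G₀ := by
    refine hcont.surjective ?_ ?_
    · have h1 : Tendsto (fun n => g m * n + (G₀ 0 - g m * 0)) atTop atTop :=
        tendsto_atTop_add_const_right _ _ (tendsto_id.const_mul_atTop hm0)
      refine tendsto_atTop_mono' _ ?_ h1
      filter_upwards [eventually_ge_atTop 0] with n hn
      have := hlow hn
      dsimp only at this
      linarith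
    · have h1 : Tendsto (fun n => g m * n + (G₀ 0 - g m * 0)) atBot atBot :=
        tendsto_atBot_add_const_right _ _ (tendsto_id.const_mul_atBot hm0)
      refine tendsto_atBot_mono' _ ?_ h1
      filter_upwards [eventually_le_atBot 0] with n hn
      have := hlow hn
      dsimp only at this
      linarith
  let G : ℝ ≃o ℝ := hmono.orderIsoOfSurjective G₀ hsurj
  have hGG : ∀ n, G n = G₀ n := fun _ => rfl
  have hsymm : ∀ t, HasDerivAt G.symm (e (G.symm t))⁻¹ t := fun t =>
    HasDerivAt.of_local_left_inverse G.symm.toHomeomorph.continuous.continuousAt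
      (hG _) (hm0.trans_le (hemin _)).ne' (Eventually.of_forall fun y => G.apply_symm_apply y)
  refine ⟨G, hG0, fun n hn => ⟨fun t => X (G.symm t), ?_, ?_, fun t ht => ?_⟩⟩
  · change X (G.symm 0) = X n₀
    rw [← hG0, ← hGG, G.symm_apply_apply]
  · simp
  · have hmaps : ∀ t ∈ uIcc 0 (G n), G.symm t ∈ Icc a b := fun t ht => by
      have h1 : G.symm t ∈ uIcc n₀ n := by
        have h2 : G n₀ = 0 := hG0
        rw [← h2] at ht
        rw [mem_uIcc] at ht ⊢
        simpa only [OrderIso.le_symm_apply, OrderIso.symm_apply_le] using ht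
      exact ordConnected_Icc.uIcc_subset hn₀ hn h1
    refine ⟨hX _ (hmaps t ht), ?_⟩
    have h1 := (hd _ (hmaps t ht)).scomp t (hsymm t).hasDerivWithinAt hmaps
    rw [heg _ (hmaps t ht), smul_smul, inv_mul_cancel₀ (hpos _ (hmaps t ht)).ne', one_smul] at h1
    exact h1

/-- `X` runs, on the open interval `(a, b)`, along the orbits of `F` in `M \ N`, with a parameter
with respect to which the physical time has the continuous positive derivative `g`. -/
structure IsOrbit (M N : Set E) (F : E → E) (X : ℝ → E) (g : ℝ → ℝ) (a b : ℝ) : Prop where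
  mem : ∀ n ∈ Ioo a b, X n ∈ M \ N
  deriv : ∀ n ∈ Ioo a b, HasDerivAt X (g n • F (X n)) n
  cont : ContinuousOn g (Ioo a b)
  pos : ∀ n ∈ Ioo a b, 0 < g n

namespace IsOrbit

variable {X : ℝ → E} {g : ℝ → ℝ} {a b : ℝ}

/-- The orbit run backwards. -/
theorem neg (h : IsOrbit M N F X g a b) :
    IsOrbit M N (-F) (fun n => X (-n)) (fun n => g (-n)) (-b) (-a) := by
  have hm : ∀ n ∈ Ioo (-b) (-a), -n ∈ Ioo a b := fun n hn =>
    ⟨by linarith [hn.2], by linarith [hn.1]⟩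
  refine ⟨fun n hn => h.mem _ (hm n hn), fun n hn => ?_, h.cont.comp continuous_neg.continuousOn hm,
    fun n hn => h.pos _ (hm n hn)⟩
  have := (h.deriv _ (hm n hn)).scomp n (hasDerivAt_neg n)
  simpa [Function.comp_def] using this

theorem exists_time (h : IsOrbit M N F X g a b) {a' b' n₀ : ℝ} (ha : a < a') (hb : b' < b)
    (hn₀ : n₀ ∈ Icc a' b') :
    ∃ G : ℝ ≃o ℝ, G n₀ = 0 ∧ ∀ n ∈ Icc a' b', FlowsTo M N F (X n₀) (G n) (X n) := by
  have hs : Icc a' b' ⊆ Ioo a b := fun n hn => ⟨ha.trans_le hn.1, hn.2.trans_lt hb⟩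
  exact _root_.exists_time hn₀ (fun n hn => h.mem n (hs hn))
    (fun n hn => (h.deriv n (hs hn)).hasDerivWithinAt) (h.cont.mono hs) fun n hn => h.pos n (hs hn)

/-- A boundary point is an egress point iff a curve through it is outside of the block right after
it. -/
theorem mem_egress_iff (hF : ∀ p ∈ M \ N, ContDiffAt ℝ 1 F p) (h : IsOrbit M N F X g a b) {n₀ : ℝ}
    (hn₀ : n₀ ∈ Ioo a b) (hx : X n₀ ∈ relBoundary M B) :
    X n₀ ∈ egress M N F B ↔ ∀ᶠ n in 𝓝[>] n₀, X n ∉ B := by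
  obtain ⟨b', hb', hb'b⟩ := exists_between hn₀.2
  obtain ⟨G, hG0, hG⟩ := h.exists_time hn₀.1 hb'b (left_mem_Icc.2 hb'.le)
  constructor
  · rintro ⟨-, ε, hε, hout⟩
    have h1 : ∀ᶠ n in 𝓝[>] n₀, G n < ε :=
      (G.toHomeomorph.continuous.continuousAt.eventually_lt continuousAt_const
        (by simpa [hG0] using hε)).filter_mono nhdsWithin_le_nhds
    filter_upwards [h1, Ioo_mem_nhdsGT hb'] with n hn hn'
    refine hout (G n) ⟨?_, hn⟩ _ (hG n (Ioo_subset_Icc_self hn'))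
    rw [← hG0]; exact G.strictMono hn'.1
  · intro hev
    obtain ⟨b'', hb''0, hb''⟩ := mem_nhdsGT_iff_exists_Ioo_subset.1 hev
    set d := min b'' b'
    have hd : n₀ < d := lt_min hb''0 hb'
    refine ⟨hx, G d, by rw [← hG0]; exact G.strictMono hd, fun t ht y hy hyB => ?_⟩
    have h1 : G.symm t ∈ Ioo n₀ d := ⟨by rw [G.lt_symm_apply, hG0]; exact ht.1,
      by rw [G.symm_apply_lt]; exact ht.2⟩
    have h2 := hG (G.symm t) ⟨h1.1.le, h1.2.le.trans (min_le_right _ _)⟩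
    rw [G.apply_symm_apply] at h2
    rw [hy.unique hF h2] at hyB
    exact hb'' ⟨h1.1, h1.2.trans_le (min_le_left _ _)⟩ hyB

end IsOrbit

/-- Ingress points are the egress points of the reversed flow. -/
theorem ingress_eq_egress_neg : ingress M N F B = egress M N (-F) B := by
  ext x
  constructor
  · rintro ⟨hx, ε, hε, h⟩
    refine ⟨hx, ε, hε, fun t ht y hy => h (-t) ⟨by linarith [ht.2], by linarith [ht.1]⟩ y ?_⟩
    simpa using hy.neg
  · rintro ⟨hx, ε, hε, h⟩
    exact ⟨hx, ε, hε, fun t ht y hy => h (-t) ⟨by linarith [ht.2], by linarith [ht.1]⟩ y hy.neg⟩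

namespace IsOrbit

variable {X : ℝ → E} {g : ℝ → ℝ} {a b : ℝ}

/-- A boundary point is an ingress point iff a curve through it is outside of the block right before
it. -/
theorem mem_ingress_iff (hF : ∀ p ∈ M \ N, ContDiffAt ℝ 1 F p) (h : IsOrbit M N F X g a b) {n₀ : ℝ}
    (hn₀ : n₀ ∈ Ioo a b) (hx : X n₀ ∈ relBoundary M B) :
    X n₀ ∈ ingress M N F B ↔ ∀ᶠ n in 𝓝[<] n₀, X n ∉ B := by
  have := h.neg.mem_egress_iff (B := B) (F := -F) (fun p hp => (hF p hp).neg) (n₀ := -n₀)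
    ⟨by linarith [hn₀.2], by linarith [hn₀.1]⟩ (by simpa using hx)
  rw [ingress_eq_egress_neg]
  simp only [neg_neg] at this
  rw [this]
  constructor
  · intro h1
    have h2 := (tendsto_neg_nhdsLT (a := n₀)).eventually h1
    simpa using h2
  · intro h1
    have h3 : Tendsto (Neg.neg : ℝ → ℝ) (𝓝[>] (-n₀)) (𝓝[<] n₀) := by
      simpa using tendsto_neg_nhdsGT (a := -n₀)
    exact h3.eventually h1

/-- A curve that stays in the block up to the parameter `n₁`, and has points outside of it right
afterwards, leaves the block at `n₁`. -/
theorem flowsTo_exitTime (hF : ∀ p ∈ M \ N, ContDiffAt ℝ 1 F p) (h : IsOrbit M N F X g a b)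
    {n₀ n₁ : ℝ} (hn₀ : a < n₀) (h01 : n₀ ≤ n₁) (hn₁ : n₁ < b) (hin : ∀ n ∈ Icc n₀ n₁, X n ∈ B)
    (hout : ∃ᶠ n in 𝓝[>] n₁, X n ∉ B) :
    X n₀ ∉ asymptoticIn M N F B ∧ FlowsTo M N F (X n₀) (exitTime M N F B (X n₀)) (X n₁) := by
  obtain ⟨b', hb', hb'b⟩ := exists_between hn₁
  obtain ⟨G, hG0, hG⟩ := h.exists_time hn₀ hb'b ⟨le_rfl, h01.trans hb'.le⟩
  have hlt : ∀ n, n₁ < n → 0 < G n := fun n hn => by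
    rw [← hG0]; exact G.strictMono (h01.trans_lt hn)
  have hglb : IsGLB {t : ℝ | 0 < t ∧ ∃ y, FlowsTo M N F (X n₀) t y ∧ y ∉ B} (G n₁) := by
    constructor
    · rintro t ⟨ht, y, hy, hyB⟩
      by_contra! hlt
      have h1 : G.symm t ∈ Icc n₀ n₁ := ⟨by rw [G.le_symm_apply, hG0]; exact ht.le,
        by rw [G.symm_apply_le]; exact hlt.le⟩
      have h2 := hG (G.symm t) ⟨h1.1, h1.2.trans hb'.le⟩
      rw [G.apply_symm_apply] at h2
      rw [hy.unique hF h2] at hyB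
      exact hyB (hin _ h1)
    · intro s hs
      by_contra! hlt'
      have h1 : ∀ᶠ n in 𝓝[>] n₁, G n < s :=
        (G.toHomeomorph.continuous.continuousAt.eventually_lt continuousAt_const
          (by simpa using hlt')).filter_mono nhdsWithin_le_nhds
      obtain ⟨n, hnB, hns, hn⟩ := (hout.and_eventually (h1.and (Ioo_mem_nhdsGT hb'))).exists
      exact (hs ⟨hlt n hn.1, X n, hG n ⟨h01.trans hn.1.le, hn.2.le⟩, hnB⟩).not_gt hns
  have hne : {t : ℝ | 0 < t ∧ ∃ y, FlowsTo M N F (X n₀) t y ∧ y ∉ B}.Nonempty := by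
    obtain ⟨n, hnB, hn⟩ := (hout.and_eventually (Ioo_mem_nhdsGT hb')).exists
    exact ⟨G n, hlt n hn.1, X n, hG n ⟨h01.trans hn.1.le, hn.2.le⟩, hnB⟩
  constructor
  · rintro ⟨-, hstay⟩
    obtain ⟨t, ht, y, hy, hyB⟩ := hne
    exact hyB (hstay t ht.le y hy)
  · rw [exitTime, hglb.csInf_eq hne]
    exact hG n₁ ⟨h01, hb'.le⟩

/-- A curve that stays in the block and has no limit point in the regular part of the state manifold
exhausts the forward orbit. -/
theorem mem_of_flowsTo_of_nonneg (hF : ∀ p ∈ M \ N, ContDiffAt ℝ 1 F p) {n₀ : ℝ}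
    {l : Filter ℝ} [l.NeBot]
    (h : ∀ᶠ n in l, n₀ ≤ n ∧ (∃ a < n₀, ∃ b > n, IsOrbit M N F X g a b) ∧ ∀ n' ∈ Icc n₀ n, X n' ∈ B)
    (hlim : ∀ p ∈ M \ N, ¬ MapClusterPt p l X) {t : ℝ} (ht : 0 ≤ t) {y : E}
    (hy : FlowsTo M N F (X n₀) t y) : y ∈ B := by
  by_contra hyB
  obtain ⟨c, hc0, rfl, hc⟩ := hy
  rw [uIcc_of_le ht] at hc
  have hflow : ∀ s ∈ Icc 0 t, FlowsTo M N F (X n₀) s (c s) := fun s hs =>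
    ⟨c, hc0, rfl, fun r hr => by
      rw [uIcc_of_le hs.1] at hr ⊢
      obtain ⟨h1, h2⟩ := hc r ⟨hr.1, hr.2.trans hs.2⟩
      exact ⟨h1, h2.mono (Icc_subset_Icc_right hs.2)⟩⟩
  have key : ∀ᶠ n in l, ∃ s ∈ Icc 0 t, X n = c s := by
    filter_upwards [h] with n ⟨hn, ⟨a, ha, b, hb, horb⟩, hin⟩
    obtain ⟨G, hG0, hG⟩ := horb.exists_time ha hb (left_mem_Icc.2 hn)
    have hGn : 0 ≤ G n := by rw [← hG0]; exact G.monotone hn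
    by_cases hle : G n ≤ t
    · exact ⟨G n, ⟨hGn, hle⟩, (hG n ⟨hn, le_rfl⟩).unique hF (hflow _ ⟨hGn, hle⟩)⟩
    · exfalso
      have h1 : G.symm t ∈ Icc n₀ n := ⟨by rw [G.le_symm_apply, hG0]; exact ht,
        by rw [G.symm_apply_le]; exact (not_le.1 hle).le⟩
      have h2 := hG _ h1
      rw [G.apply_symm_apply] at h2
      rw [(hflow t ⟨ht, le_rfl⟩).unique hF h2] at hyB
      exact hyB (hin _ h1)
  have : ∀ n, ∃ s, (∃ s ∈ Icc 0 t, X n = c s) → s ∈ Icc 0 t ∧ X n = c s := fun n => by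
    by_cases hn : ∃ s ∈ Icc 0 t, X n = c s
    · obtain ⟨s, hs⟩ := hn
      exact ⟨s, fun _ => hs⟩
    · exact ⟨0, fun h => (hn h).elim⟩
  choose τ hτ using this
  have hle : map τ l ≤ 𝓟 (Icc 0 t) :=
    le_principal_iff.2 (mem_map.2 (by filter_upwards [key] with n hn using (hτ n hn).1))
  obtain ⟨s, hs, hcl⟩ := isCompact_Icc hle
  refine hlim (c s) (hc s hs).1 ?_
  have hcont : Tendsto c (𝓝 s ⊓ 𝓟 (Icc 0 t)) (𝓝 (c s)) := (hc s hs).2.continuousWithinAt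
  have hmap : map X l = map c (map τ l) := by
    rw [map_map]
    exact map_congr (by filter_upwards [key] with n hn using (hτ n hn).2)
  rw [MapClusterPt, hmap]
  have hcl' : NeBot (𝓝 s ⊓ 𝓟 (Icc 0 t) ⊓ map τ l) := by
    rw [inf_assoc, inf_eq_right.2 hle]; exact hcl
  refine (hcl'.map c).mono ?_
  exact map_inf_le.trans (inf_le_inf hcont le_rfl)

/-- The backward version of `IsOrbit.mem_of_flowsTo_of_nonneg`. -/
theorem mem_of_flowsTo_of_nonpos (hF : ∀ p ∈ M \ N, ContDiffAt ℝ 1 F p) {n₀ : ℝ}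
    {l : Filter ℝ} [l.NeBot]
    (h : ∀ᶠ n in l, n ≤ n₀ ∧ (∃ a < n, ∃ b > n₀, IsOrbit M N F X g a b) ∧ ∀ n' ∈ Icc n n₀, X n' ∈ B)
    (hlim : ∀ p ∈ M \ N, ¬ MapClusterPt p l X) {t : ℝ} (ht : t ≤ 0) {y : E}
    (hy : FlowsTo M N F (X n₀) t y) : y ∈ B := by
  refine mem_of_flowsTo_of_nonneg (M := M) (N := N) (F := -F) (B := B) (X := fun n => X (-n))
    (g := fun n => g (-n)) (l := map Neg.neg l)
    (fun p hp => (hF p hp).neg) (n₀ := -n₀) ?_ (fun p hp hcl => hlim p hp ?_) (neg_nonneg.2 ht)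
    (by simpa using hy.neg)
  · rw [eventually_map]
    filter_upwards [h] with n ⟨h1, ⟨a, ha, b, hb, ho⟩, h3⟩
    exact ⟨neg_le_neg h1, ⟨-b, neg_lt_neg hb, -a, neg_lt_neg ha, ho.neg⟩,
      fun n' hn' => h3 _ ⟨by linarith [hn'.2], by linarith [hn'.1]⟩⟩
  · rw [MapClusterPt, map_map] at hcl
    simpa only [Function.comp_def, neg_neg, MapClusterPt] using hcl

end IsOrbit

end Flow

/-! ### Hypersurfaces and their two sides -/

/-- A preconnected subset of the state manifold that avoids the boundary of `B` lies on one side of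
it. -/
theorem IsPreconnected.subset_or_disjoint_of_disjoint_relBoundary {E : Type*}
    [NormedAddCommGroup E] {M B C : Set E}
    (hC : IsPreconnected C) (hCM : C ⊆ M) (hd : Disjoint C (relBoundary M B)) :
    C ⊆ B ∨ Disjoint C B := by
  by_cases h1 : (C ∩ B).Nonempty
  · left
    intro p hp
    by_contra hpB
    have hcov : C ⊆ (closure B)ᶜ ∪ (closure (M \ B))ᶜ := fun q hq => by
      by_contra hcon
      simp only [mem_union, mem_compl_iff, not_or, not_not] at hcon
      exact disjoint_left.1 hd hq ⟨hCM hq, hcon.1, hcon.2⟩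
    obtain ⟨q, hqC, hqB⟩ := h1
    obtain ⟨z, hzC, hz1, hz2⟩ := hC _ _ isClosed_closure.isOpen_compl isClosed_closure.isOpen_compl
      hcov ⟨p, hp, (hcov hp).resolve_right fun h => h (subset_closure ⟨hCM hp, hpB⟩)⟩
      ⟨q, hqC, (hcov hqC).resolve_left fun h => h (subset_closure hqB)⟩
    by_cases hzB : z ∈ B
    · exact hz1 (subset_closure hzB)
    · exact hz2 (subset_closure ⟨hCM hzC, hzB⟩)
  · right
    rw [disjoint_iff_inter_eq_empty]
    exact not_nonempty_iff_eq_empty.1 h1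

section Hypersurfaces

variable {E : Type*} [NormedAddCommGroup E] [NormedSpace ℝ E]

/-- The derivative of a function vanishes on the tangent directions of its level sets. -/
theorem hasFDerivAt_apply_eq_zero_of_mem_tangentConeAt {G : Type*} [NormedAddCommGroup G]
    [NormedSpace ℝ G] {f : E → G} {f' : E →L[ℝ] G} {S : Set E} {x y : E}
    (hf : HasFDerivAt f f' x) (hS : ∀ᶠ p in 𝓝 x, p ∈ S → f p = f x)
    (hy : y ∈ tangentConeAt ℝ S x) : f' y = 0 := by
  obtain ⟨ι, l, hl, c, d, hd₀, hds, hcd⟩ := exists_fun_of_mem_tangentConeAt hy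
  have h1 := hf.hasFDerivWithinAt.lim (s := S) hd₀ hds hcd
  have h2 : Tendsto (fun n => x + d n) l (𝓝 x) := by simpa using tendsto_const_nhds.add hd₀
  refine tendsto_nhds_unique h1 (tendsto_const_nhds.congr' ?_)
  filter_upwards [hds, h2.eventually hS] with n hn hn'
  simp [hn' hn]

theorem mem_tangentConeAt_of_hasDerivAt {c : ℝ → E} {S : Set E} {s : ℝ} {y : E}
    (hc : HasDerivAt c y s) (hS : ∀ᶠ r in 𝓝 s, c r ∈ S) : y ∈ tangentConeAt ℝ S (c s) := by
  have h1 := (hc.hasFDerivAt.hasFDerivWithinAt (s := c ⁻¹' S)).mapsTo_tangent_cone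
  rw [tangentConeAt_of_mem_nhds (show c ⁻¹' S ∈ 𝓝 s from hS)] at h1
  have h2 := tangentConeAt_mono (image_preimage_subset c S) (h1 (mem_univ 1))
  simpa using h2

/-- The tangent directions of a regular level set include the kernel of the derivative. -/
theorem mem_tangentConeAt_of_fderiv_eq_zero [CompleteSpace E] {G : Type*}
    [NormedAddCommGroup G] [NormedSpace ℝ G] [FiniteDimensional ℝ G] {f : E → G} {f' : E →L[ℝ] G}
    {S : Set E} {x y : E} (hf : HasStrictFDerivAt f f' x) (hf' : f'.range = ⊤)
    (hS : ∀ᶠ p in 𝓝 x, f p = f x → p ∈ S) (hy : f' y = 0) : y ∈ tangentConeAt ℝ S x := by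
  let Y : f'.ker := ⟨y, hy⟩
  let ψ := hf.implicitFunction f f' hf'
  have h0 : ψ (f x) 0 = x := hf.implicitFunction_apply_image hf'
  have hc : HasDerivAt (fun s : ℝ => ψ (f x) (s • Y)) y 0 := by
    have h1 : HasDerivAt (fun s : ℝ => s • Y) Y 0 := by
      simpa using (hasDerivAt_id (0 : ℝ)).smul_const Y
    have h2 : HasFDerivAt (ψ (f x)) f'.ker.subtypeL ((0 : ℝ) • Y) := by
      rw [zero_smul]; exact (hf.to_implicitFunction hf').hasFDerivAt
    exact h2.comp_hasDerivAt (0 : ℝ) h1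
  have h3 : Tendsto (fun s : ℝ => s • Y) (𝓝 0) (𝓝 0) := by
    have : Continuous fun s : ℝ => s • Y := by fun_prop
    simpa using this.tendsto 0
  have h4 : ∀ᶠ s : ℝ in 𝓝 0, f (ψ (f x) (s • Y)) = f x :=
    (tendsto_const_nhds.prodMk_nhds h3).eventually (hf.map_implicitFunction_eq hf')
  have h5 : (fun s : ℝ => ψ (f x) (s • Y)) 0 = x := by simpa using h0
  have h6 : Tendsto (fun s : ℝ => ψ (f x) (s • Y)) (𝓝 0) (𝓝 x) := by
    simpa [h0] using hc.continuousAt.tendsto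
  rw [← h5]
  refine mem_tangentConeAt_of_hasDerivAt hc ?_
  filter_upwards [h4, h6.eventually hS] with s h7 h8 using h8 h7

/-- The two sides of the boundary of `B` near a boundary point `x` at which the vector field `F` is
transversal to it. The state manifold is given near `x` as a regular level set `{e = 0}`. There is
a function `κ`, increasing along `F`, whose zeros in the state manifold near `x` are the points of
the boundary; each of its two sides is contained in `B` or disjoint from `B`. -/
theorem exists_sides [FiniteDimensional ℝ E] {H : Type*} [NormedAddCommGroup H] [NormedSpace ℝ H]
    [FiniteDimensional ℝ H] {M B : Set E} {F : E → E} {x : E}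
    (hB : IsSmoothSubmanifold (Module.finrank ℝ H + 1) (relBoundary M B)) (hx : x ∈ relBoundary M B)
    {e : E → H} {e' : E →L[ℝ] H} (he : ∀ᶠ p in 𝓝 x, p ∈ M ↔ e p = 0)
    (hee : HasStrictFDerivAt e e' x) (he' : e'.range = ⊤) (hw : e' (F x) = 0)
    (hwt : F x ∉ tangentConeAt ℝ (relBoundary M B) x) (hFc : ContinuousAt F x) :
    ∃ κ : E → ℝ, ∃ V, IsOpen V ∧ x ∈ V ∧ κ x = 0 ∧
      (∀ p ∈ V, DifferentiableAt ℝ κ p ∧ 0 < fderiv ℝ κ p (F p)) ∧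
      (∀ p ∈ M ∩ V, κ p = 0 → p ∈ relBoundary M B) ∧
      (M ∩ V ∩ {p | 0 < κ p} ⊆ B ∨ Disjoint (M ∩ V ∩ {p | 0 < κ p}) B) ∧
      (M ∩ V ∩ {p | κ p < 0} ⊆ B ∨ Disjoint (M ∩ V ∩ {p | κ p < 0}) B) := by
  have : CompleteSpace E := FiniteDimensional.complete ℝ E
  obtain ⟨U, hUo, hxU, g, hg, hgs, hgU⟩ := hB x hx
  have hUn : U ∈ 𝓝 x := hUo.mem_nhds hxU
  have hgx : g x = 0 := (hgU.subset ⟨hx, hxU⟩).2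
  set T := fderiv ℝ g x with hT
  have hTr : T.range = ⊤ := LinearMap.range_eq_top.2 (hgs x hxU)
  have hgT : HasStrictFDerivAt g T x := (hg.contDiffAt hUn).hasStrictFDerivAt (by simp)
  have hTcone : ∀ y, T y = 0 → y ∈ tangentConeAt ℝ (relBoundary M B) x := fun y hy =>
    mem_tangentConeAt_of_fderiv_eq_zero hgT hTr (by
      filter_upwards [hUn] with p hp hgp
      exact (hgU.superset ⟨hp, hgp.trans hgx⟩).1) hy
  have hTw : T (F x) ≠ 0 := fun h => hwt (hTcone _ h)
  have hbM : relBoundary M B ⊆ M := fun p hp => hp.1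
  have hex : e x = 0 := he.self_of_nhds.1 (hbM hx)
  have hTe : ∀ y, T y = 0 → e' y = 0 := fun y hy =>
    hasFDerivAt_apply_eq_zero_of_mem_tangentConeAt hee.hasFDerivAt (S := relBoundary M B) (by
      filter_upwards [he] with p hp hpb
      rw [hp.1 (hbM hpb), hex]) (hTcone y hy)
  obtain ⟨i, hi⟩ := Function.ne_iff.1 hTw
  let pr : (Fin (Module.finrank ℝ H + 1) → ℝ) →L[ℝ] ℝ :=
    T (F x) i • ContinuousLinearMap.proj (R := ℝ) (φ := fun _ => ℝ) i
  let κ : E → ℝ := fun p => pr (g p)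
  have hκT : HasStrictFDerivAt κ (pr.comp T) x := pr.hasStrictFDerivAt.comp x hgT
  have hκC : ContDiffOn ℝ ∞ κ U := pr.contDiff.comp_contDiffOn hg
  have hκw : 0 < pr (T (F x)) := by
    have : pr (T (F x)) = T (F x) i * T (F x) i := rfl
    rw [this]; exact mul_self_pos.2 hi
  -- The kernels of `T` and of `(e', κ')` agree: one contains the other and the dimensions agree.
  let Q : E →L[ℝ] H × ℝ := e'.prod (pr.comp T)
  have hQr : Q.range = ⊤ := by
    rw [LinearMap.range_eq_top]
    rintro ⟨a, r⟩
    obtain ⟨y, hy⟩ := LinearMap.range_eq_top.1 he' a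
    refine ⟨y + ((r - pr (T y)) / pr (T (F x))) • F x, ?_⟩
    have hy' : e' y = a := hy
    refine Prod.ext ?_ ?_
    · change e' (y + _) = a
      rw [map_add, map_smul, hw, smul_zero, add_zero, hy']
    · change pr (T (y + _)) = r
      rw [map_add, map_smul, map_add, map_smul, smul_eq_mul, div_mul_cancel₀ _ hκw.ne']
      ring
  have hker : T.ker = Q.ker := by
    refine Submodule.eq_of_le_of_finrank_eq (fun y hy => ?_) ?_
    · have hy' : T y = 0 := hy
      exact Prod.ext (hTe y hy') (show pr (T y) = 0 by rw [hy', map_zero])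
    · have h1 := LinearMap.finrank_range_add_finrank_ker T.toLinearMap
      have h2 := LinearMap.finrank_range_add_finrank_ker Q.toLinearMap
      rw [hTr, finrank_top, Module.finrank_fin_fun] at h1
      rw [hQr, finrank_top, Module.finrank_prod, Module.finrank_self] at h2
      omega
  let d₂ := HasStrictFDerivAt.implicitFunctionDataOfComplemented g T hgT hTr
    T.ker_closedComplemented_of_finiteDimensional_range
  let d₁ : ImplicitFunctionData ℝ E (H × ℝ) T.ker :=
    { leftFun := fun p => (e p, κ p)
      leftDeriv := Q
      rightFun := d₂.rightFun
      rightDeriv := d₂.rightDeriv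
      pt := x
      hasStrictFDerivAt_leftFun := hee.prodMk hκT
      hasStrictFDerivAt_rightFun := d₂.hasStrictFDerivAt_rightFun
      range_leftDeriv := hQr
      range_rightDeriv := d₂.range_rightDeriv
      isCompl_ker := hker ▸ d₂.isCompl_ker }
  let Φ := d₁.toOpenPartialHomeomorph
  have hΦ : ∀ p, Φ p = ((e p, κ p), d₂.rightFun p) := fun _ => rfl
  have hκx : κ x = 0 := by simp only [κ, hgx, map_zero]
  have hxs : x ∈ Φ.source := d₁.pt_mem_toOpenPartialHomeomorph_source
  have hxt : Φ x ∈ Φ.target := Φ.map_source hxs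
  -- Near `x`, the zeros of `κ` in the state manifold are boundary points.
  have hzero : ∀ᶠ p in 𝓝 x, p ∈ M → κ p = 0 → p ∈ relBoundary M B := by
    have hc2 : ContinuousAt d₂.rightFun x := d₂.hasStrictFDerivAt_rightFun.continuousAt
    let ψ : E → E := fun p => d₂.implicitFunction 0 (d₂.rightFun p)
    have hp2 : d₂.prodFun d₂.pt = (0, d₂.rightFun x) := by
      change (g x, _) = _
      rw [hgx]; rfl
    have hψ : Tendsto ψ (𝓝 x) (𝓝 x) := by
      have h1 : ContinuousAt d₂.toOpenPartialHomeomorph.symm (0, d₂.rightFun x) := by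
        rw [← hp2]
        exact d₂.toOpenPartialHomeomorph.continuousAt_symm
          d₂.map_pt_mem_toOpenPartialHomeomorph_target
      have h2 : d₂.toOpenPartialHomeomorph.symm (0, d₂.rightFun x) = x := by
        rw [← hp2]
        exact d₂.toOpenPartialHomeomorph.left_inv d₂.pt_mem_toOpenPartialHomeomorph_source
      have h3 : Tendsto (fun p => ((0 : Fin (Module.finrank ℝ H + 1) → ℝ), d₂.rightFun p)) (𝓝 x)
          (𝓝 (0, d₂.rightFun x)) := tendsto_const_nhds.prodMk_nhds hc2
      have h4 := h1.tendsto.comp h3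
      rw [h2] at h4
      exact h4
    have hev : ∀ᶠ p in 𝓝 x, g (ψ p) = 0 ∧ d₂.rightFun (ψ p) = d₂.rightFun p := by
      have h3 : Tendsto (fun p => ((0 : Fin (Module.finrank ℝ H + 1) → ℝ), d₂.rightFun p)) (𝓝 x)
          (𝓝 (d₂.prodFun d₂.pt)) := by
        rw [hp2]; exact tendsto_const_nhds.prodMk_nhds hc2
      filter_upwards [h3.eventually d₂.prodFun_implicitFunction] with p hp
      exact ⟨congr_arg Prod.fst hp, congr_arg Prod.snd hp⟩
    filter_upwards [hev, hψ.eventually hUn, hψ.eventually he, he,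
      hψ.eventually (Φ.open_source.mem_nhds hxs), Φ.open_source.mem_nhds hxs]
      with p h1 h2 h3 h4 h5 h6 hpM hpκ
    have hb : ψ p ∈ relBoundary M B := (hgU.superset ⟨h2, h1.1⟩).1
    have : Φ (ψ p) = Φ p := by
      rw [hΦ, hΦ, h3.1 (hbM hb), h4.1 hpM, h1.2, hpκ]
      simp only [κ, h1.1, map_zero]
    rwa [Φ.injOn h5 h6 this] at hb
  have hpos : ∀ᶠ p in 𝓝 x, DifferentiableAt ℝ κ p ∧ 0 < fderiv ℝ κ p (F p) := by
    have h1 : ContinuousAt (fun p => fderiv ℝ κ p (F p)) x :=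
      ((hκC.continuousOn_fderiv_of_isOpen hUo (by simp)).continuousAt hUn).clm_apply hFc
    have h2 : 0 < fderiv ℝ κ x (F x) := by rw [hκT.hasFDerivAt.fderiv]; exact hκw
    filter_upwards [hUn, h1.eventually (lt_mem_nhds h2)] with p hp hp'
    exact ⟨(hκC.contDiffAt (hUo.mem_nhds hp)).differentiableAt (by simp), hp'⟩
  have hsymm : Tendsto Φ.symm (𝓝 (Φ x)) (𝓝 x) := Φ.tendsto_symm hxs
  have hev := (hsymm.eventually (he.and (hzero.and (hpos.and hUn)))).and (Φ.open_target.mem_nhds hxt)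
  obtain ⟨ε, hε, hball⟩ := Metric.eventually_nhds_iff_ball.1 hev
  set V := Φ.source ∩ Φ ⁻¹' Metric.ball (Φ x) ε with hV
  have hVΦ : ∀ p ∈ V, (p ∈ M ↔ e p = 0) ∧ (p ∈ M → κ p = 0 → p ∈ relBoundary M B) ∧
      (DifferentiableAt ℝ κ p ∧ 0 < fderiv ℝ κ p (F p)) ∧ p ∈ U := fun p hp => by
    have := (hball _ hp.2).1
    rwa [Φ.left_inv hp.1] at this
  have hside : ∀ I : Set ℝ, Convex ℝ I → 0 ∉ I →
      (M ∩ V ∩ {p | κ p ∈ I} ⊆ B ∨ Disjoint (M ∩ V ∩ {p | κ p ∈ I}) B) := fun I hI h0 => by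
    have heq : M ∩ V ∩ {p | κ p ∈ I} =
        Φ.symm '' (Metric.ball (Φ x) ε ∩ {y | y.1.1 = 0} ∩ {y | y.1.2 ∈ I}) := by
      ext p
      constructor
      · rintro ⟨⟨hpM, hpV⟩, hpI⟩
        exact ⟨Φ p, ⟨⟨hpV.2, (hVΦ p hpV).1.1 hpM⟩, hpI⟩, Φ.left_inv hpV.1⟩
      · rintro ⟨y, ⟨⟨hyb, hy0⟩, hyI⟩, rfl⟩
        have hyt := (hball y hyb).2
        have h1 : Φ (Φ.symm y) = y := Φ.right_inv hyt
        have h2 : Φ.symm y ∈ V := ⟨Φ.map_target hyt, by rw [mem_preimage, h1]; exact hyb⟩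
        have h3 : e (Φ.symm y) = y.1.1 := congr_arg (fun q => q.1.1) h1
        have h4 : κ (Φ.symm y) = y.1.2 := congr_arg (fun q => q.1.2) h1
        refine ⟨⟨(hVΦ _ h2).1.2 (h3.trans hy0), h2⟩, ?_⟩
        change κ _ ∈ I
        rw [h4]; exact hyI
    have hconv : Convex ℝ (Metric.ball (Φ x) ε ∩ {y | y.1.1 = 0} ∩ {y | y.1.2 ∈ I}) := by
      refine ((convex_ball _ _).inter ?_).inter ?_
      · intro a ha b hb s t _ _ _
        simp only [mem_ofPred_eq] at ha hb ⊢
        simp [ha, hb]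
      · intro a ha b hb s t hs ht hst
        exact hI ha hb hs ht hst
    refine IsPreconnected.subset_or_disjoint_of_disjoint_relBoundary ?_
      (fun p hp => hp.1.1) ?_
    · rw [heq]
      refine hconv.isPreconnected.image _ (Φ.continuousOn_symm.mono fun y hy => ?_)
      exact (hball y hy.1.1).2
    · rw [disjoint_left]
      rintro p ⟨⟨hpM, hpV⟩, hpI⟩ hpb
      have h1 : g p = 0 := (hgU.subset ⟨hpb, (hVΦ p hpV).2.2.2⟩).2
      have h2 : κ p = 0 := by simp only [κ, h1, map_zero]
      exact h0 (h2 ▸ hpI)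
  exact ⟨κ, V, Φ.isOpen_inter_preimage Metric.isOpen_ball, ⟨hxs, Metric.mem_ball_self hε⟩, hκx,
    fun p hp => (hVΦ p hp).2.2.1, fun p hp => (hVΦ p hp.2).2.1 hp.1,
    hside (Ioi 0) (convex_Ioi 0) (by simp), hside (Iio 0) (convex_Iio 0) (by simp)⟩

end Hypersurfaces

/-! ### Surfaces of constant curvature are spindles -/

namespace SphericalSurface

variable {S : SphericalSurface}

/-- `S` is the spindle `f(r) = (c / b) sin (b² (r - rN) / c)`: it has cone angles `2πb` at the poles
and curvature `(b² / c)²`. The length `c` is the scale of the gnomonic radius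
`ρ = c tan (b² (r - rN) / c) = -1 / Θ` on the northern hemisphere. -/
structure IsSpindle (S : SphericalSurface) (b c : ℝ) : Prop where
  b_pos : 0 < b
  c_pos : 0 < c
  rS_eq : S.rS = S.rN + c / b ^ 2 * Real.pi
  f_eq : ∀ r ∈ Icc S.rN S.rS, S.f r = c / b * Real.sin (b ^ 2 / c * (r - S.rN))

theorem hasDerivAt_f (S : SphericalSurface) {r : ℝ} (hr : r ∈ Ioo S.rN S.rS) :
    HasDerivAt S.f (deriv S.f r) r ∧ HasDerivAt (deriv S.f) (deriv (deriv S.f) r) r := by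
  have hf : ContDiffAt ℝ ∞ S.f r := S.smooth_f.contDiffAt (Icc_mem_nhds hr.1 hr.2)
  refine ⟨(hf.differentiableAt (by simp)).hasDerivAt, ?_⟩
  have h3 : ContDiffAt ℝ 1 (deriv S.f) r := by
    have h4 : ContDiffAt ℝ 1 (fderiv ℝ S.f) r := hf.fderiv_right (by norm_cast)
    have h5 : deriv S.f = fun x => fderiv ℝ S.f x 1 := by
      funext x
      simp
    rw [h5]
    exact h4.clm_apply contDiffAt_const
  exact (h3.differentiableAt (by simp)).hasDerivAt

theorem f_pos (S : SphericalSurface) {r : ℝ} (hr : r ∈ Ioo S.rN S.rS) : 0 < S.f r :=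
  (S.f_nonneg r (Ioo_subset_Icc_self hr)).lt_of_ne fun h =>
    ((S.f_eq_zero_iff r (Ioo_subset_Icc_self hr)).1 h.symm).elim hr.1.ne' hr.2.ne

/-- A spherical surface of revolution of constant curvature `K > 0` is a spindle: `f'' = -K f`
together with `f(rN) = 0` makes `f` a sine, whose first zero after `rN` is `rS`. -/
theorem isSpindle_of_curvature (S : SphericalSurface) {K β : ℝ} (hK : 0 < K)
    (hcurv : ∀ r ∈ Ioo S.rN S.rS, S.gaussCurvature r = K)
    (hβ : ∀ r ∈ Ioo S.rN S.rS, -S.f r * deriv (deriv S.f) r + deriv S.f r ^ 2 = β ^ 2) :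
    S.IsSpindle |β| (β ^ 2 / √K) := by
  set w := √K with hw
  have hw0 : 0 < w := Real.sqrt_pos.2 hK
  have hww : w * w = K := Real.mul_self_sqrt hK.le
  have hlt := S.rN_lt_rS
  have hf'' : ∀ r ∈ Ioo S.rN S.rS, deriv (deriv S.f) r = -(w * w) * S.f r := fun r hr => by
    have h1 := hcurv r hr
    have h2 := (S.f_pos hr).ne'
    rw [gaussCurvature] at h1
    field_simp at h1
    rw [hww]; linarith
  -- Two first integrals of `f'' = -w² f`.
  let a : ℝ → ℝ := fun r => deriv S.f r * Real.cos (w * (r - S.rN)) +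
    w * S.f r * Real.sin (w * (r - S.rN))
  let d : ℝ → ℝ := fun r => w * S.f r * Real.cos (w * (r - S.rN)) -
    deriv S.f r * Real.sin (w * (r - S.rN))
  have harg : ∀ r, HasDerivAt (fun r => w * (r - S.rN)) (w * 1) r := fun r =>
    ((hasDerivAt_id r).sub_const _).const_mul w
  have ha : ∀ r ∈ Ioo S.rN S.rS, HasDerivAt a 0 r := fun r hr => by
    obtain ⟨h1, h2⟩ := S.hasDerivAt_f hr
    refine ((h2.mul (harg r).cos).add ((h1.const_mul w).mul (harg r).sin)).congr_deriv ?_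
    rw [hf'' r hr]; ring
  have hd : ∀ r ∈ Ioo S.rN S.rS, HasDerivAt d 0 r := fun r hr => by
    obtain ⟨h1, h2⟩ := S.hasDerivAt_f hr
    refine (((h1.const_mul w).mul (harg r).cos).sub (h2.mul (harg r).sin)).congr_deriv ?_
    rw [hf'' r hr]; ring
  have hconst : ∀ {φ : ℝ → ℝ}, (∀ r ∈ Ioo S.rN S.rS, HasDerivAt φ 0 r) →
      ∃ C, ∀ r ∈ Ioo S.rN S.rS, φ r = C := fun {φ} h => by
    have hm : (S.rN + S.rS) / 2 ∈ Ioo S.rN S.rS := ⟨by linarith, by linarith⟩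
    refine ⟨φ ((S.rN + S.rS) / 2), fun r hr => ?_⟩
    exact isOpen_Ioo.is_const_of_deriv_eq_zero isPreconnected_Ioo
      (fun r hr => (h r hr).differentiableAt.differentiableWithinAt)
      (fun r hr => (h r hr).deriv) hr hm
  obtain ⟨C, hC⟩ := hconst ha
  obtain ⟨D, hD⟩ := hconst hd
  have hfo : ∀ r ∈ Ioo S.rN S.rS,
      w * S.f r = C * Real.sin (w * (r - S.rN)) + D * Real.cos (w * (r - S.rN)) := fun r hr => by
    rw [← hC r hr, ← hD r hr]
    linear_combination (-w * S.f r) * Real.sin_sq_add_cos_sq (w * (r - S.rN))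
  have hfc : ∀ r ∈ Icc S.rN S.rS,
      w * S.f r = C * Real.sin (w * (r - S.rN)) + D * Real.cos (w * (r - S.rN)) := by
    refine EqOn.of_subset_closure (s := Ioo S.rN S.rS) hfo
      (continuousOn_const.mul S.smooth_f.continuousOn) (Continuous.continuousOn (by fun_prop))
      Ioo_subset_Icc_self ?_
    rw [closure_Ioo hlt.ne]
  have hD0 : D = 0 := by
    have h1 := hfc S.rN (left_mem_Icc.2 hlt.le)
    rw [(S.f_eq_zero_iff _ (left_mem_Icc.2 hlt.le)).2 (Or.inl rfl)] at h1
    simpa using h1.symm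
  rw [hD0] at hfc hD
  have hCβ : C ^ 2 = β ^ 2 := by
    have hm : (S.rN + S.rS) / 2 ∈ Ioo S.rN S.rS := ⟨by linarith, by linarith⟩
    set r := (S.rN + S.rS) / 2
    have h1 := hβ r hm
    rw [hf'' r hm] at h1
    have h2 := hC r hm
    have h3 := hD r hm
    simp only [a, d] at h2 h3
    rw [← h1, ← h2]
    have h4 := Real.sin_sq_add_cos_sq (w * (r - S.rN))
    linear_combination (deriv S.f r ^ 2 + w ^ 2 * S.f r ^ 2) * h4 -
      (w * S.f r * Real.cos (w * (r - S.rN)) - deriv S.f r * Real.sin (w * (r - S.rN))) * h3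
  have hC0 : C ≠ 0 := fun h => by
    have hm : (S.rN + S.rS) / 2 ∈ Ioo S.rN S.rS := ⟨by linarith, by linarith⟩
    have h1 := hfc _ (Ioo_subset_Icc_self hm)
    rw [h] at h1
    have := S.f_pos hm
    have : 0 < w * S.f ((S.rN + S.rS) / 2) := by positivity
    linarith
  have hsin : ∀ r ∈ Ioo S.rN S.rS, 0 < C * Real.sin (w * (r - S.rN)) := fun r hr => by
    have h1 := hfc r (Ioo_subset_Icc_self hr)
    have h2 := mul_pos hw0 (S.f_pos hr)
    linarith
  have hend : Real.sin (w * (S.rS - S.rN)) = 0 := by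
    have h1 := hfc S.rS (right_mem_Icc.2 hlt.le)
    rw [(S.f_eq_zero_iff _ (right_mem_Icc.2 hlt.le)).2 (Or.inr rfl)] at h1
    have : C * Real.sin (w * (S.rS - S.rN)) = 0 := by linarith
    exact (mul_eq_zero.1 this).resolve_left hC0
  have hπ : w * (S.rS - S.rN) = Real.pi := by
    rcases lt_trichotomy (w * (S.rS - S.rN)) Real.pi with h | h | h
    · exact absurd hend (Real.sin_pos_of_pos_of_lt_pi (mul_pos hw0 (sub_pos.2 hlt)) h).ne'
    · exact h
    · exfalso
      have h1 := hsin (S.rN + Real.pi / w) ⟨by have := Real.pi_pos; simp; positivity, by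
        have : Real.pi / w < S.rS - S.rN := by rw [div_lt_iff₀ hw0]; linarith
        linarith⟩
      rw [add_sub_cancel_left, mul_div_cancel₀ _ hw0.ne', Real.sin_pi, mul_zero] at h1
      exact h1.false
  have hCpos : 0 < C := by
    have hm : (S.rN + S.rS) / 2 ∈ Ioo S.rN S.rS := ⟨by linarith, by linarith⟩
    have h1 := hsin _ hm
    have h2 : 0 < Real.sin (w * ((S.rN + S.rS) / 2 - S.rN)) := by
      have h3 := Real.pi_pos
      apply Real.sin_pos_of_pos_of_lt_pi
      · have : 0 < (S.rN + S.rS) / 2 - S.rN := by linarith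
        positivity
      · nlinarith
    exact (pos_iff_pos_of_mul_pos h1).2 h2
  have hCb : C = |β| := by
    rw [← abs_of_pos hCpos]; exact sq_eq_sq_iff_abs_eq_abs _ _ |>.1 hCβ
  have hb : 0 < |β| := hCb ▸ hCpos
  have hβ2 : |β| ^ 2 = β ^ 2 := sq_abs β
  have hβ0 : 0 < β ^ 2 := by rw [← hβ2]; positivity
  have hβne : β ≠ 0 := abs_pos.1 hb
  refine ⟨hb, by positivity, ?_, fun r hr => ?_⟩
  · rw [hβ2, ← hπ]; field_simp; ring
  · have h1 := hfc r hr
    have h2 : |β| ^ 2 / (β ^ 2 / w) = w := by rw [hβ2]; field_simp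
    have h3 : β ^ 2 / w / |β| = C / w := by rw [← hβ2, hCb]; field_simp
    rw [h2, h3]
    field_simp
    linarith

end SphericalSurface

/-! ### The gnomonic radius and the northern hemisphere -/

namespace SphericalSurface

variable {S : SphericalSurface} {b c β γ h : ℝ}

namespace IsSpindle

theorem hasDerivAt_f (H : S.IsSpindle b c) {r : ℝ} (hr : r ∈ Ioo S.rN S.rS) :
    HasDerivAt S.f (b * Real.cos (b ^ 2 / c * (r - S.rN))) r := by
  have hb := H.b_pos
  have hc := H.c_pos
  have h1 : HasDerivAt (fun r => c / b * Real.sin (b ^ 2 / c * (r - S.rN)))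
      (b * Real.cos (b ^ 2 / c * (r - S.rN))) r := by
    refine (((((hasDerivAt_id r).sub_const S.rN).const_mul (b ^ 2 / c)).sin).const_mul
      (c / b)).congr_deriv ?_
    field_simp
    simp
  refine h1.congr_of_eventuallyEq ?_
  filter_upwards [Icc_mem_nhds hr.1 hr.2] with x hx using H.f_eq x hx

theorem deriv_f (H : S.IsSpindle b c) {r : ℝ} (hr : r ∈ Ioo S.rN S.rS) :
    deriv S.f r = b * Real.cos (b ^ 2 / c * (r - S.rN)) := (H.hasDerivAt_f hr).deriv

theorem theta_eq (H : S.IsSpindle b c) (hβ : β ^ 2 = b ^ 2) {r : ℝ} (hr : r ∈ Ioo S.rN S.rS) :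
    S.theta β r =
      -Real.cos (b ^ 2 / c * (r - S.rN)) / (c * Real.sin (b ^ 2 / c * (r - S.rN))) := by
  have hb := H.b_pos
  have hc := H.c_pos
  have h1 := (S.f_pos hr).ne'
  rw [H.f_eq r (Ioo_subset_Icc_self hr)] at h1
  have h2 : Real.sin (b ^ 2 / c * (r - S.rN)) ≠ 0 := right_ne_zero_of_mul h1
  rw [theta, H.deriv_f hr, H.f_eq r (Ioo_subset_Icc_self hr), hβ]
  generalize Real.sin (b ^ 2 / c * (r - S.rN)) = x at *
  field_simp

theorem contDiffAt_keplerField (H : S.IsSpindle b c) (hβ : β ^ 2 = b ^ 2) {p : ℝ × ℂ × ℝ × ℝ}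
    (hp : p.1 ∈ Ioo S.rN S.rS) (hΘ : S.theta β p.1 ≠ 0) :
    ContDiffAt ℝ 1 (S.keplerField β γ) p := by
  have hb := H.b_pos
  have hc := H.c_pos
  have hev : ∀ᶠ q : ℝ × ℂ × ℝ × ℝ in 𝓝 p, q.1 ∈ Ioo S.rN S.rS :=
    continuous_fst.continuousAt.eventually (isOpen_Ioo.mem_nhds hp)
  have hf0 := (S.f_pos hp).ne'
  have hf : ContDiffAt ℝ 1 (fun q : ℝ × ℂ × ℝ × ℝ => S.f q.1) p := by
    have h1 : ContDiffAt ℝ ∞ S.f p.1 := S.smooth_f.contDiffAt (Icc_mem_nhds hp.1 hp.2)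
    exact (h1.of_le (by norm_cast)).comp p contDiffAt_fst
  have hf' : ContDiffAt ℝ 1 (fun q : ℝ × ℂ × ℝ × ℝ => deriv S.f q.1) p := by
    have h1 : ContDiffAt ℝ 1
        (fun q : ℝ × ℂ × ℝ × ℝ => b * Real.cos (b ^ 2 / c * (q.1 - S.rN))) p :=
      ContDiff.contDiffAt (by fun_prop)
    refine h1.congr_of_eventuallyEq ?_
    filter_upwards [hev] with q hq using H.deriv_f hq
  have hβ0 : β ^ 2 ≠ 0 := by rw [hβ]; positivity
  have hΘd : ContDiffAt ℝ 1 (fun q : ℝ × ℂ × ℝ × ℝ => S.theta β q.1) p := by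
    unfold theta
    exact hf'.neg.div (contDiffAt_const.mul hf) (mul_ne_zero hβ0 hf0)
  have habs : ContDiffAt ℝ 1 (fun q : ℝ × ℂ × ℝ × ℝ => |S.theta β q.1|) p :=
    hΘd.abs hΘ
  have hsq : ContDiffAt ℝ 1 (fun q : ℝ × ℂ × ℝ × ℝ => √|S.theta β q.1|) p :=
    habs.sqrt (abs_ne_zero.2 hΘ)
  have hs := hsq.div hf hf0
  have hz : ContDiffAt ℝ 1 (fun q : ℝ × ℂ × ℝ × ℝ => q.2.1) p := by fun_prop
  have hu : ContDiffAt ℝ 1 (fun q : ℝ × ℂ × ℝ × ℝ => q.2.2.1) p := by fun_prop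
  have hv : ContDiffAt ℝ 1 (fun q : ℝ × ℂ × ℝ × ℝ => q.2.2.2) p := by fun_prop
  have hden : ContDiffAt ℝ 1 (fun q : ℝ × ℂ × ℝ × ℝ => 2 * S.f q.1 * S.theta β q.1) p :=
    (contDiffAt_const.mul hf).mul hΘd
  have hden0 : 2 * S.f p.1 * S.theta β p.1 ≠ 0 := mul_ne_zero (mul_ne_zero two_ne_zero hf0) hΘ
  refine (hv.mul hsq).prodMk (ContDiffAt.prodMk ?_ (ContDiffAt.prodMk ?_ ?_))
  · exact ((Complex.ofRealCLM.contDiff.contDiffAt.comp p (hu.mul hs)).mul contDiffAt_const).mul hz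
  · exact ((hu.mul hv).neg.mul (hf'.add (contDiffAt_const.div hden hden0))).mul hs
  · exact ((((hu.pow 2).mul hf').sub ((hv.pow 2).div hden hden0)).sub
      (contDiffAt_const.div (hf.mul habs) (mul_ne_zero hf0 (abs_ne_zero.2 hΘ)))).mul hs

end IsSpindle

/-- A state that is not a collision is not at a pole, and has `Θ ≠ 0`. In particular the energy
relation has no solutions at the south pole, as `γ > 0`. -/
theorem mem_Ioo_of_mem_diff (hγ : 0 < γ) {p : ℝ × ℂ × ℝ × ℝ}
    (hp : p ∈ S.energyManifold β γ h \ S.collisionSet β γ h) :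
    p.1 ∈ Ioo S.rN S.rS ∧ S.theta β p.1 ≠ 0 := by
  obtain ⟨hM, hN⟩ := hp
  rcases hM.2 with h1 | h1 | h1
  · exact (hN ⟨hM, h1.1⟩).elim
  · nlinarith [h1.2, sq_nonneg p.2.2.1, sq_nonneg p.2.2.2]
  · exact ⟨h1.1, h1.2.1⟩

theorem IsSpindle.contDiffAt (H : S.IsSpindle b c) (hβ : β ^ 2 = b ^ 2) (hγ : 0 < γ) :
    ∀ p ∈ S.energyManifold β γ h \ S.collisionSet β γ h, ContDiffAt ℝ 1 (S.keplerField β γ) p :=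
  fun _ hp => H.contDiffAt_keplerField hβ (mem_Ioo_of_mem_diff hγ hp).1 (mem_Ioo_of_mem_diff hγ hp).2

/-- The parameter of the equator. -/
def equator (S : SphericalSurface) (b c : ℝ) : ℝ := S.rN + c / b ^ 2 * (Real.pi / 2)

/-- The parameter `r` as a function of the gnomonic radius `ρ`. -/
def param (S : SphericalSurface) (b c ρ : ℝ) : ℝ := S.rN + c / b ^ 2 * Real.arctan (ρ / c)

/-- The gnomonic radius `ρ = -1 / Θ` as a function of `r`. -/
def gnomonic (S : SphericalSurface) (b c r : ℝ) : ℝ := c * Real.tan (b ^ 2 / c * (r - S.rN))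

theorem param_zero : S.param b c 0 = S.rN := by simp [param]

theorem continuous_param : Continuous (S.param b c) := by
  unfold param
  fun_prop

namespace IsSpindle

variable (H : S.IsSpindle b c)
include H

theorem gnomonic_param (ρ : ℝ) : S.gnomonic b c (S.param b c ρ) = ρ := by
  have hb := H.b_pos.ne'
  have hc := H.c_pos.ne'
  have h1 : b ^ 2 / c * (S.param b c ρ - S.rN) = Real.arctan (ρ / c) := by
    rw [param]; field_simp; ring
  rw [gnomonic, h1, Real.tan_arctan]
  field_simp

theorem angle_mem {r : ℝ} (hr : r ∈ Ico S.rN (S.equator b c)) :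
    b ^ 2 / c * (r - S.rN) ∈ Ico 0 (Real.pi / 2) := by
  have hb := H.b_pos
  have hc := H.c_pos
  obtain ⟨h1, h2⟩ := hr
  have h3 : 0 < b ^ 2 / c := by positivity
  refine ⟨mul_nonneg h3.le (sub_nonneg.2 h1), ?_⟩
  have h4 : r - S.rN < c / b ^ 2 * (Real.pi / 2) := by rw [equator] at h2; linarith
  calc b ^ 2 / c * (r - S.rN) < b ^ 2 / c * (c / b ^ 2 * (Real.pi / 2)) := by gcongr
    _ = Real.pi / 2 := by field_simp

theorem param_gnomonic {r : ℝ} (hr : r ∈ Ico S.rN (S.equator b c)) :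
    S.param b c (S.gnomonic b c r) = r := by
  have hb := H.b_pos.ne'
  have hc := H.c_pos.ne'
  have h1 := H.angle_mem hr
  have := Real.pi_pos
  rw [param, gnomonic, mul_div_cancel_left₀ _ hc, Real.arctan_tan (by linarith [h1.1]) h1.2]
  field_simp
  ring

theorem param_strictMono : StrictMono (S.param b c) := fun x y hxy => by
  have hb := H.b_pos
  have hc := H.c_pos
  have h1 : x / c < y / c := by gcongr
  have h2 := Real.arctan_strictMono h1
  have h3 : 0 < c / b ^ 2 := by positivity
  have := mul_lt_mul_of_pos_left h2 h3
  simp only [param]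
  linarith

theorem param_lt_equator (ρ : ℝ) : S.param b c ρ < S.equator b c := by
  have hb := H.b_pos
  have hc := H.c_pos
  have h3 : 0 < c / b ^ 2 := by positivity
  have := mul_lt_mul_of_pos_left (Real.arctan_lt_pi_div_two (ρ / c)) h3
  simp only [param, equator]
  linarith

theorem equator_lt : S.equator b c < S.rS := by
  have hb := H.b_pos
  have hc := H.c_pos
  have h3 : 0 < c / b ^ 2 := by positivity
  rw [H.rS_eq, equator]
  have := Real.pi_pos
  gcongr
  linarith

theorem rN_lt_equator : S.rN < S.equator b c := by
  rw [← param_zero]; exact H.param_lt_equator 0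

theorem gnomonic_nonneg {r : ℝ} (hr : r ∈ Ico S.rN (S.equator b c)) : 0 ≤ S.gnomonic b c r := by
  have h1 : S.param b c 0 ≤ S.param b c (S.gnomonic b c r) := by
    rw [H.param_gnomonic hr, param_zero]; exact hr.1
  exact H.param_strictMono.le_iff_le.1 h1

theorem gnomonic_pos {r : ℝ} (hr : r ∈ Ioo S.rN (S.equator b c)) : 0 < S.gnomonic b c r := by
  have h1 : S.param b c 0 < S.param b c (S.gnomonic b c r) := by
    rw [H.param_gnomonic ⟨hr.1.le, hr.2⟩, param_zero]; exact hr.1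
  exact H.param_strictMono.lt_iff_lt.1 h1

theorem param_mem {ρ : ℝ} (hρ : 0 < ρ) : S.param b c ρ ∈ Ioo S.rN S.rS :=
  ⟨by rw [← param_zero]; exact H.param_strictMono hρ,
    (H.param_lt_equator ρ).trans H.equator_lt⟩

theorem sin_cos_param (ρ : ℝ) :
    Real.sin (b ^ 2 / c * (S.param b c ρ - S.rN)) = ρ / c / √(1 + (ρ / c) ^ 2) ∧
      Real.cos (b ^ 2 / c * (S.param b c ρ - S.rN)) = 1 / √(1 + (ρ / c) ^ 2) := by
  have hb := H.b_pos.ne'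
  have hc := H.c_pos.ne'
  have h1 : b ^ 2 / c * (S.param b c ρ - S.rN) = Real.arctan (ρ / c) := by
    rw [param]; field_simp; ring
  rw [h1, Real.sin_arctan, Real.cos_arctan]
  exact ⟨rfl, rfl⟩

theorem f_param {ρ : ℝ} (hρ : 0 < ρ) : S.f (S.param b c ρ) = ρ / (b * √(1 + (ρ / c) ^ 2)) := by
  have hb := H.b_pos
  have hc := H.c_pos
  rw [H.f_eq _ (Ioo_subset_Icc_self (H.param_mem hρ)), (H.sin_cos_param ρ).1]
  field_simp

theorem deriv_f_param {ρ : ℝ} (hρ : 0 < ρ) :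
    deriv S.f (S.param b c ρ) = b / √(1 + (ρ / c) ^ 2) := by
  rw [H.deriv_f (H.param_mem hρ), (H.sin_cos_param ρ).2, mul_one_div]

theorem theta_param (hβ : β ^ 2 = b ^ 2) {ρ : ℝ} (hρ : 0 < ρ) :
    S.theta β (S.param b c ρ) = -(1 / ρ) := by
  have hb := H.b_pos
  have hc := H.c_pos
  have he : 0 < √(1 + (ρ / c) ^ 2) := by positivity
  rw [H.theta_eq hβ (H.param_mem hρ), (H.sin_cos_param ρ).1, (H.sin_cos_param ρ).2]
  field_simp

theorem theta_equator (hβ : β ^ 2 = b ^ 2) : S.theta β (S.equator b c) = 0 := by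
  have hb := H.b_pos.ne'
  have hc := H.c_pos.ne'
  rw [H.theta_eq hβ ⟨H.rN_lt_equator, H.equator_lt⟩]
  have : b ^ 2 / c * (S.equator b c - S.rN) = Real.pi / 2 := by
    rw [equator]; field_simp; ring
  rw [this, Real.cos_pi_div_two]
  simp

/-- The energy manifold in the northern hemisphere. -/
theorem mem_energyManifold_iff (hβ : β ^ 2 = b ^ 2) {p : ℝ × ℂ × ℝ × ℝ}
    (hp : p.1 < S.equator b c) :
    p ∈ S.energyManifold β γ h ↔ ‖p.2.1‖ = 1 ∧ S.rN ≤ p.1 ∧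
      (p.2.2.1 ^ 2 + p.2.2.2 ^ 2) / 2 = γ + h * S.gnomonic b c p.1 := by
  have hS := hp.trans H.equator_lt
  have hN := H.rN_lt_equator
  simp only [energyManifold, mem_ofPred_eq]
  refine and_congr_right fun _ => ?_
  rcases lt_trichotomy p.1 S.rN with h1 | h1 | h1
  · simp only [h1.ne, false_and, hS.ne, mem_Ioo, h1.not_gt, h1.not_ge]
    simp
  · have hg : S.gnomonic b c p.1 = 0 := by simp [gnomonic, h1]
    simp only [h1, true_and, S.rN_lt_rS.ne, false_and, mem_Ioo, lt_irrefl, or_false, le_refl]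
    rw [← h1, hg]
    constructor <;> intro h2 <;> linarith
  · have hr : p.1 ∈ Ico S.rN (S.equator b c) := ⟨h1.le, hp⟩
    have hρ := H.gnomonic_pos ⟨h1, hp⟩
    have hΘ := H.theta_param hβ hρ
    rw [H.param_gnomonic hr] at hΘ
    have hneg : -(1 / S.gnomonic b c p.1) < 0 := neg_neg_of_pos (by positivity)
    simp only [h1.ne', false_and, hS.ne, false_or, mem_Ioo, h1, hS, h1.le, true_and, hΘ,
      Real.sign_of_neg hneg, hneg.ne, ne_eq, not_false_eq_true]
    have : h / -(1 / S.gnomonic b c p.1) = -(h * S.gnomonic b c p.1) := by field_simp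
    rw [this]
    constructor <;> intro h2 <;> linarith

theorem fst_ne_equator (hβ : β ^ 2 = b ^ 2) {p : ℝ × ℂ × ℝ × ℝ}
    (hp : p ∈ S.energyManifold β γ h) : p.1 ≠ S.equator b c := fun he => by
  rcases hp.2 with h1 | h1 | h1
  · exact H.rN_lt_equator.ne (h1.1.symm.trans he)
  · exact H.equator_lt.ne (he.symm.trans h1.1)
  · exact h1.2.1 (he ▸ H.theta_equator hβ)

end IsSpindle

end SphericalSurface

/-! ### The equations of motion in the gnomonic radius -/

namespace SphericalSurface

variable {S : SphericalSurface} {b c β γ h : ℝ}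

/-- The state at gnomonic radius `ρ` on the northern hemisphere, on the meridian `z`, with scaled
angular momentum `L = b p_θ` and `y = ρ p_r / 2`; so `y` is half of the derivative of `ρ` in
the regularized time of Levi-Civita. -/
def state (S : SphericalSurface) (b c ρ y L : ℝ) (z : ℂ) : ℝ × ℂ × ℝ × ℝ :=
  (S.param b c ρ, z, L * √(1 + (ρ / c) ^ 2) / √ρ, 2 * y / √ρ)

namespace IsSpindle

variable (H : S.IsSpindle b c)
include H

theorem keplerField_state (hβ : β ^ 2 = b ^ 2) {ρ : ℝ} (hρ : 0 < ρ) (y L : ℝ) (z : ℂ) :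
    ∀ e a : ℝ, e = √(1 + (ρ / c) ^ 2) → a = √ρ →
    S.keplerField β γ (S.state b c ρ y L z) =
      (2 * y / a / a,
        ((L * e / a * (1 / a / (ρ / (b * e))) : ℝ) : ℂ) * Complex.I * z,
        -(L * e / a * (2 * y / a)) * (b / e - b * e / 2) * (1 / a / (ρ / (b * e))),
        ((L * e / a) ^ 2 * (b / e) + (2 * y / a) ^ 2 * (b * e / 2) - γ * (b * e)) *
          (1 / a / (ρ / (b * e)))) := by
  rintro e a rfl rfl
  have hb := H.b_pos
  have he : 0 < √(1 + (ρ / c) ^ 2) := by positivity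
  have habs : |-(1 / ρ)| = 1 / ρ := by rw [abs_neg, abs_of_pos (by positivity)]
  have hsq : √(1 / ρ) = 1 / √ρ := by rw [Real.sqrt_div zero_le_one, Real.sqrt_one]
  simp only [keplerField, state, H.theta_param hβ hρ, habs, H.f_param hρ, H.deriv_f_param hρ, hsq]
  refine Prod.ext (by ring) (Prod.ext rfl (Prod.ext ?_ ?_))
  · dsimp only
    congr 2
    field_simp
    ring
  · dsimp only
    congr 1
    field_simp
    ring

theorem state_mem (hβ : β ^ 2 = b ^ 2) {k ρ y L : ℝ} {z : ℂ} (hρ : 0 < ρ) (hz : ‖z‖ = 1)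
    (hk : 2 * k = h - L ^ 2 / (2 * c ^ 2)) (hE : y ^ 2 + L ^ 2 / 4 = ρ * (k * ρ + γ / 2)) :
    S.state b c ρ y L z ∈ S.energyManifold β γ h \ S.collisionSet β γ h := by
  have hc := H.c_pos
  refine ⟨(H.mem_energyManifold_iff hβ (H.param_lt_equator ρ)).2
    ⟨hz, (H.param_mem hρ).1.le, ?_⟩, fun hN => (H.param_mem hρ).1.ne' hN.2⟩
  have h1 : S.gnomonic b c (S.state b c ρ y L z).1 = ρ := H.gnomonic_param ρ
  rw [h1]
  simp only [state]
  have he0 : 0 < √(1 + (ρ / c) ^ 2) := by positivity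
  have ha0 : 0 < √ρ := by positivity
  have he2 : √(1 + (ρ / c) ^ 2) ^ 2 = 1 + (ρ / c) ^ 2 := Real.sq_sqrt (by positivity)
  have ha2 : √ρ ^ 2 = ρ := Real.sq_sqrt hρ.le
  have h2 : ((L * √(1 + (ρ / c) ^ 2) / √ρ) ^ 2 + (2 * y / √ρ) ^ 2) / 2 =
      (L ^ 2 * √(1 + (ρ / c) ^ 2) ^ 2 + 4 * y ^ 2) / (2 * √ρ ^ 2) := by
    field_simp
    ring
  rw [h2, he2, ha2]
  have hk' : k = (h - L ^ 2 / (2 * c ^ 2)) / 2 := by linarith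
  subst hk'
  have hy : y ^ 2 = ρ * ((h - L ^ 2 / (2 * c ^ 2)) / 2 * ρ + γ / 2) - L ^ 2 / 4 := by linarith
  rw [hy]
  field_simp
  ring

/-- Every state on the northern hemisphere other than a collision has the form `state`. -/
theorem exists_eq_state (hβ : β ^ 2 = b ^ 2) {p : ℝ × ℂ × ℝ × ℝ} (hp : p ∈ S.energyManifold β γ h)
    (h1 : S.rN < p.1) (h2 : p.1 < S.equator b c) :
    ∃ ρ y L k, 0 < ρ ∧ ρ = S.gnomonic b c p.1 ∧ y = p.2.2.2 * √ρ / 2 ∧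
      L = p.2.2.1 * √ρ / √(1 + (ρ / c) ^ 2) ∧ ‖p.2.1‖ = 1 ∧ 2 * k = h - L ^ 2 / (2 * c ^ 2) ∧
      y ^ 2 + L ^ 2 / 4 = ρ * (k * ρ + γ / 2) ∧ p = S.state b c ρ y L p.2.1 := by
  have hc := H.c_pos
  obtain ⟨hz, -, hE⟩ := (H.mem_energyManifold_iff hβ h2).1 hp
  have hρ := H.gnomonic_pos ⟨h1, h2⟩
  set ρ := S.gnomonic b c p.1 with hρd
  refine ⟨ρ, p.2.2.2 * √ρ / 2, p.2.2.1 * √ρ / √(1 + (ρ / c) ^ 2),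
    (h - (p.2.2.1 * √ρ / √(1 + (ρ / c) ^ 2)) ^ 2 / (2 * c ^ 2)) / 2, hρ, rfl, rfl, rfl, hz,
    by ring, ?_, ?_⟩
  · have he2 : √(1 + (ρ / c) ^ 2) ^ 2 = 1 + (ρ / c) ^ 2 := Real.sq_sqrt (by positivity)
    have ha2 : √ρ ^ 2 = ρ := Real.sq_sqrt hρ.le
    have h3 : (p.2.2.1 * √ρ / √(1 + (ρ / c) ^ 2)) ^ 2 = p.2.2.1 ^ 2 * ρ / (1 + (ρ / c) ^ 2) := by
      rw [div_pow, mul_pow, he2, ha2]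
    have h4 : (p.2.2.2 * √ρ / 2) ^ 2 = p.2.2.2 ^ 2 * ρ / 4 := by
      rw [div_pow, mul_pow, ha2]; norm_num
    have h5 : p.2.2.2 ^ 2 = 2 * (γ + h * ρ) - p.2.2.1 ^ 2 := by linarith
    rw [h3, h4, h5]
    field_simp
    ring
  · have he : 0 < √(1 + (ρ / c) ^ 2) := by positivity
    have ha : 0 < √ρ := by positivity
    refine Prod.ext (H.param_gnomonic ⟨h1.le, h2⟩).symm (Prod.ext rfl (Prod.ext ?_ ?_))
    · simp only [state]
      field_simp
    · simp only [state]
      field_simp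

/-- In a time with respect to which `ρ`, `y` and `z` satisfy the equations of motion of the
regularized Kepler problem, up to the factor `s`, the state runs along the orbits of the Kepler
field. -/
theorem hasDerivAt_state (hβ : β ^ 2 = b ^ 2) {k L s n : ℝ} {ρ y : ℝ → ℝ} {z : ℝ → ℂ}
    (hρ0 : 0 < ρ n) (hρ : HasDerivAt ρ (s * (2 * y n)) n)
    (hy : HasDerivAt y (s * (2 * k * ρ n + γ / 2)) n)
    (hz : HasDerivAt z (((s * (L / (b * ρ n)) : ℝ) : ℂ) * Complex.I * z n) n)
    (hE : y n ^ 2 + L ^ 2 / 4 = ρ n * (k * ρ n + γ / 2)) :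
    HasDerivAt (fun n => S.state b c (ρ n) (y n) L (z n))
      ((s * (ρ n / (b ^ 2 * (1 + (ρ n / c) ^ 2)))) •
        S.keplerField β γ (S.state b c (ρ n) (y n) L (z n))) n := by
  have hb := H.b_pos
  have hc := H.c_pos
  set e := √(1 + (ρ n / c) ^ 2) with he
  set a := √(ρ n) with ha
  have he2 : e ^ 2 = 1 + (ρ n / c) ^ 2 := Real.sq_sqrt (by positivity)
  have ha2 : a ^ 2 = ρ n := Real.sq_sqrt hρ0.le
  have he0 : 0 < e := by positivity
  have ha0 : 0 < a := by positivity
  have hda : HasDerivAt (fun n => √(ρ n)) (s * y n / a) n := by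
    refine (hρ.sqrt hρ0.ne').congr_deriv ?_
    rw [← ha]; field_simp
  have hde : HasDerivAt (fun n => √(1 + (ρ n / c) ^ 2)) (ρ n * (s * (2 * y n)) / (c ^ 2 * e)) n := by
    have h1 : HasDerivAt (fun n => 1 + (ρ n / c) ^ 2) (2 * (ρ n / c) * (s * (2 * y n) / c)) n := by
      refine (((hρ.div_const c).pow 2).const_add 1).congr_deriv ?_
      simp
    refine (h1.sqrt (by positivity)).congr_deriv ?_
    rw [← he]; field_simp
  have hr : HasDerivAt (fun n => S.param b c (ρ n))
      (c / b ^ 2 * (1 / (1 + (ρ n / c) ^ 2) * (s * (2 * y n) / c))) n :=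
    (((hρ.div_const c).arctan).const_mul (c / b ^ 2)).const_add S.rN
  have hu := (hde.const_mul L).div hda ha0.ne'
  have hv := (hy.const_mul 2).div hda ha0.ne'
  have := hr.prodMk (hz.prodMk (hu.prodMk hv))
  refine this.congr_deriv ?_
  rw [H.keplerField_state hβ hρ0 _ _ _ e a rfl rfl]
  have hρe : ρ n ^ 2 = c ^ 2 * (e ^ 2 - 1) := by
    rw [he2]; field_simp; ring
  have ha' : √(ρ n) = a := rfl
  have he' : √(1 + (ρ n / c) ^ 2) = e := rfl
  refine Prod.ext ?_ (Prod.ext ?_ (Prod.ext ?_ ?_))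
  · simp only [Prod.smul_fst, smul_eq_mul, ← ha2]
    field_simp
  · simp only [Prod.smul_fst, Prod.smul_snd, Complex.real_smul]
    rw [← mul_assoc, ← mul_assoc, ← Complex.ofReal_mul, ← he2]
    refine congrArg (fun x : ℝ => (x : ℂ) * Complex.I * z n) ?_
    rw [← ha2]
    field_simp
  · simp only [Prod.smul_fst, Prod.smul_snd, smul_eq_mul, ha', he']
    rw [← he2]
    have h1 : (2 : ℝ) * ρ n ^ 2 - c ^ 2 * e ^ 2 = c ^ 2 * (e ^ 2 - 2) := by rw [hρe]; ring
    calc _ = L * s * y n / (c ^ 2 * e * a ^ 3) * (2 * ρ n * a ^ 2 - c ^ 2 * e ^ 2) := by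
          field_simp
      _ = L * s * y n / (c ^ 2 * e * a ^ 3) * (c ^ 2 * (e ^ 2 - 2)) := by
          rw [ha2, ← h1]; ring
      _ = _ := by
          field_simp
          ring
  · simp only [Prod.smul_snd, smul_eq_mul, ha', ← he2]
    have h1 : (2 * k * ρ n + γ / 2) * ρ n = 2 * y n ^ 2 + L ^ 2 / 2 - γ / 2 * ρ n := by linarith
    calc _ = s / (a ^ 3 * ρ n) *
          (2 * ((2 * k * ρ n + γ / 2) * ρ n) * a ^ 2 - 2 * y n ^ 2 * ρ n) := by
          field_simp
      _ = s / (a ^ 3 * ρ n) * ((2 * y n ^ 2 + L ^ 2 - γ * ρ n) * ρ n) := by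
          rw [ha2, h1]; ring
      _ = s / a ^ 3 * (2 * y n ^ 2 + L ^ 2 - γ * a ^ 2) := by
          rw [ha2]; field_simp
      _ = _ := by
          field_simp
          ring

end IsSpindle

end SphericalSurface

/-! ### Levi-Civita solutions with a rational parameter -/

section LeviCivita

open Complex

/-- The position `q` at the parameter `n` of the solution of the linear system `q' = p`, `p' = k q`
with initial values `q₀`, `p₀`. The parameter is rational: the time `τ` of the system satisfies
`dτ/dn = 2 / (1 - k n²)`, and `n` runs through the set `k n² < 1`. -/
def lcPos (k : ℝ) (q₀ p₀ : ℂ) (n : ℝ) : ℂ :=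
  (1 - k * n ^ 2)⁻¹ • ((1 + k * n ^ 2) • q₀ + (2 * n) • p₀)

/-- The momentum `p` that belongs to `lcPos`. -/
def lcMom (k : ℝ) (q₀ p₀ : ℂ) (n : ℝ) : ℂ :=
  (1 - k * n ^ 2)⁻¹ • ((1 + k * n ^ 2) • p₀ + (2 * k * n) • q₀)

variable {k : ℝ} {q₀ p₀ : ℂ} {n : ℝ}

@[simp] theorem lcPos_zero : lcPos k q₀ p₀ 0 = q₀ := by simp [lcPos]

@[simp] theorem lcMom_zero : lcMom k q₀ p₀ 0 = p₀ := by simp [lcMom]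

theorem hasDerivAt_lcPos (hn : 0 < 1 - k * n ^ 2) :
    HasDerivAt (lcPos k q₀ p₀) ((2 / (1 - k * n ^ 2)) • lcMom k q₀ p₀ n) n := by
  have h1 : HasDerivAt (fun n : ℝ => k * n ^ 2) (k * (2 * n)) n := by
    simpa using (hasDerivAt_pow 2 n).const_mul k
  have h2 : HasDerivAt (fun n : ℝ => 2 * n) (2 * 1) n := (hasDerivAt_id n).const_mul 2
  refine ((h1.const_sub 1).inv hn.ne').smul
    (((h1.const_add 1).smul_const q₀).add (h2.smul_const p₀)) |>.congr_deriv ?_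
  simp only [lcMom, Pi.inv_apply, Pi.add_apply]
  match_scalars <;> field_simp <;> ring

theorem hasDerivAt_lcMom (hn : 0 < 1 - k * n ^ 2) :
    HasDerivAt (lcMom k q₀ p₀) ((2 / (1 - k * n ^ 2)) • (k • lcPos k q₀ p₀ n)) n := by
  have h1 : HasDerivAt (fun n : ℝ => k * n ^ 2) (k * (2 * n)) n := by
    simpa using (hasDerivAt_pow 2 n).const_mul k
  have h2 : HasDerivAt (fun n : ℝ => 2 * k * n) (2 * k * 1) n := (hasDerivAt_id n).const_mul (2 * k)
  refine ((h1.const_sub 1).inv hn.ne').smul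
    (((h1.const_add 1).smul_const p₀).add (h2.smul_const q₀)) |>.congr_deriv ?_
  simp only [lcPos, Pi.inv_apply, Pi.add_apply]
  match_scalars <;> field_simp <;> ring

/-- The quantity `y = Re (conj q * p)`, half of the derivative of `ρ = |q|²`. -/
def lcY (k : ℝ) (q₀ p₀ : ℂ) (n : ℝ) : ℝ := (starRingEnd ℂ (lcPos k q₀ p₀ n) * lcMom k q₀ p₀ n).re

theorem normSq_lcMom (hn : 0 < 1 - k * n ^ 2) :
    normSq (lcMom k q₀ p₀ n) = k * normSq (lcPos k q₀ p₀ n) + (normSq p₀ - k * normSq q₀) := by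
  simp only [lcMom, lcPos, normSq_apply, real_smul, mul_re, mul_im, add_re, add_im, ofReal_re,
    ofReal_im]
  field_simp
  ring

/-- Conservation of angular momentum. -/
theorem im_conj_lcPos_mul_lcMom (hn : 0 < 1 - k * n ^ 2) :
    (starRingEnd ℂ (lcPos k q₀ p₀ n) * lcMom k q₀ p₀ n).im = (starRingEnd ℂ q₀ * p₀).im := by
  simp only [lcMom, lcPos, real_smul, mul_re, mul_im, add_re, add_im, ofReal_re,
    ofReal_im, conj_re, conj_im]
  field_simp
  ring

theorem hasDerivAt_normSq_lcPos (hn : 0 < 1 - k * n ^ 2) :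
    HasDerivAt (fun n => normSq (lcPos k q₀ p₀ n))
      (2 / (1 - k * n ^ 2) * (2 * lcY k q₀ p₀ n)) n := by
  have h := hasDerivAt_lcPos (q₀ := q₀) (p₀ := p₀) hn
  have h1 := reCLM.hasFDerivAt.comp_hasDerivAt n h
  have h2 := imCLM.hasFDerivAt.comp_hasDerivAt n h
  have h3 := (h1.mul h1).add (h2.mul h2)
  refine h3.congr_deriv ?_
  simp only [lcY, reCLM_apply, imCLM_apply, Function.comp_apply, real_smul, ofReal_re, ofReal_im,
    mul_re, mul_im, conj_re, conj_im]
  ring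

theorem hasDerivAt_lcY (hn : 0 < 1 - k * n ^ 2) :
    HasDerivAt (lcY k q₀ p₀) (2 / (1 - k * n ^ 2) *
      (2 * k * normSq (lcPos k q₀ p₀ n) + (normSq p₀ - k * normSq q₀))) n := by
  have h := hasDerivAt_lcPos (q₀ := q₀) (p₀ := p₀) hn
  have h' := hasDerivAt_lcMom (q₀ := q₀) (p₀ := p₀) hn
  have h1 := reCLM.hasFDerivAt.comp_hasDerivAt n h
  have h2 := imCLM.hasFDerivAt.comp_hasDerivAt n h
  have h1' := reCLM.hasFDerivAt.comp_hasDerivAt n h'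
  have h2' := imCLM.hasFDerivAt.comp_hasDerivAt n h'
  have h3 := (h1.mul h1').add (h2.mul h2')
  have h4 : HasDerivAt (lcY k q₀ p₀) _ n := h3.congr_of_eventuallyEq (Eventually.of_forall fun n => by
    simp [lcY])
  refine h4.congr_deriv ?_
  have h5 := normSq_lcMom (q₀ := q₀) (p₀ := p₀) hn
  have h6 : 2 * k * normSq (lcPos k q₀ p₀ n) + (normSq p₀ - k * normSq q₀) =
      k * normSq (lcPos k q₀ p₀ n) + normSq (lcMom k q₀ p₀ n) := by linarith
  rw [h6]
  simp only [normSq_apply, reCLM_apply, imCLM_apply, Function.comp_apply, real_smul, re_ofReal_mul,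
    im_ofReal_mul]
  ring

theorem im_smul_div_eq (s : ℝ) (q p : ℂ) :
    (s • p / q).im = s * ((starRingEnd ℂ q * p).im / normSq q) := by
  rw [div_im]
  simp
  ring

/-- The derivative of the direction of a curve in `ℂ`. -/
theorem HasDerivAt.div_norm {w : ℝ → ℂ} {w' : ℂ} (hw : HasDerivAt w w' n) (h0 : w n ≠ 0) :
    HasDerivAt (fun n => w n / (‖w n‖ : ℂ)) (((w' / w n).im : ℂ) * I * (w n / (‖w n‖ : ℂ))) n := by
  have h1 := reCLM.hasFDerivAt.comp_hasDerivAt n hw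
  have h2 := imCLM.hasFDerivAt.comp_hasDerivAt n hw
  have h3 := (h1.mul h1).add (h2.mul h2)
  have hn0 : 0 < normSq (w n) := normSq_pos.2 h0
  have h4 : HasDerivAt (fun n => ‖w n‖) ((starRingEnd ℂ (w n) * w').re / ‖w n‖) n := by
    have h5 : HasDerivAt (fun n => normSq (w n)) _ n := h3
    have h6 := h5.sqrt hn0.ne'
    refine (h6.congr_deriv ?_)
    rw [← norm_def]
    have := (norm_pos_iff.2 h0).ne'
    simp
    field_simp
    ring
  have hnn : (‖w n‖ : ℂ) ≠ 0 := ofReal_ne_zero.2 (norm_pos_iff.2 h0).ne'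
  have h5 := hw.div (ofRealCLM.hasFDerivAt.comp_hasDerivAt n h4) hnn
  refine h5.congr_deriv ?_
  have h6 : ((w' / w n).im : ℂ) * I = w' / w n - ((w' / w n).re : ℂ) := by
    rw [eq_sub_iff_add_eq, add_comm, re_add_im]
  have h7 : (starRingEnd ℂ (w n) * w').re = (w' / w n).re * ‖w n‖ ^ 2 := by
    rw [← normSq_eq_norm_sq, div_re]
    field_simp
    simp
    ring
  rw [h6]
  simp only [ofRealCLM_apply, Function.comp_apply, h7, ofReal_div, ofReal_mul, ofReal_pow]
  field_simp

end LeviCivita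

namespace SphericalSurface

variable {S : SphericalSurface} {b c β γ h : ℝ}

/-- The curve of states that belongs to the Levi-Civita solution with initial values `q₀`, `p₀`,
with scaled angular momentum `L` and meridian `z`. -/
def lcState (S : SphericalSurface) (b c k : ℝ) (q₀ p₀ : ℂ) (L : ℝ) (z : ℝ → ℂ) (n : ℝ) :
    ℝ × ℂ × ℝ × ℝ :=
  S.state b c (Complex.normSq (lcPos k q₀ p₀ n)) (lcY k q₀ p₀ n) L (z n)

/-- The derivative of the physical time with respect to the rational parameter. -/
def lcSpeed (b c k : ℝ) (q₀ p₀ : ℂ) (n : ℝ) : ℝ :=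
  2 / (1 - k * n ^ 2) * (Complex.normSq (lcPos k q₀ p₀ n) /
    (b ^ 2 * (1 + (Complex.normSq (lcPos k q₀ p₀ n) / c) ^ 2)))

/-- A Levi-Civita solution with the correct constants of motion gives an orbit of the Kepler field, on
every interval without collision, if `z` is a meridian that turns with the angular velocity
determined by `L`. -/
theorem IsSpindle.isOrbit (H : S.IsSpindle b c) (hβ : β ^ 2 = b ^ 2) {k : ℝ} {q₀ p₀ : ℂ} {L : ℝ}
    {z : ℝ → ℂ} {n₁ n₂ : ℝ} (hp₀ : Complex.normSq p₀ = k * Complex.normSq q₀ + γ / 2)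
    (hL : L ^ 2 = 4 * (starRingEnd ℂ q₀ * p₀).im ^ 2) (hk : 2 * k = h - L ^ 2 / (2 * c ^ 2))
    (hn : ∀ n ∈ Ioo n₁ n₂, 0 < 1 - k * n ^ 2) (hq : ∀ n ∈ Ioo n₁ n₂, lcPos k q₀ p₀ n ≠ 0)
    (hz1 : ∀ n ∈ Ioo n₁ n₂, ‖z n‖ = 1)
    (hz : ∀ n ∈ Ioo n₁ n₂, HasDerivAt z (((2 / (1 - k * n ^ 2) *
      (L / (b * Complex.normSq (lcPos k q₀ p₀ n))) : ℝ) : ℂ) * Complex.I * z n) n) :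
    IsOrbit (S.energyManifold β γ h) (S.collisionSet β γ h) (S.keplerField β γ)
      (S.lcState b c k q₀ p₀ L z) (lcSpeed b c k q₀ p₀) n₁ n₂ := by
  have hb := H.b_pos
  have hc := H.c_pos
  have hρ : ∀ n ∈ Ioo n₁ n₂, 0 < Complex.normSq (lcPos k q₀ p₀ n) := fun n h =>
    Complex.normSq_pos.2 (hq n h)
  have hE : ∀ n ∈ Ioo n₁ n₂, lcY k q₀ p₀ n ^ 2 + L ^ 2 / 4 =
      Complex.normSq (lcPos k q₀ p₀ n) * (k * Complex.normSq (lcPos k q₀ p₀ n) + γ / 2) :=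
    fun n h => by
    have h1 := normSq_lcMom (q₀ := q₀) (p₀ := p₀) (hn n h)
    have h2 := im_conj_lcPos_mul_lcMom (q₀ := q₀) (p₀ := p₀) (hn n h)
    have h3 : γ / 2 = Complex.normSq p₀ - k * Complex.normSq q₀ := by linarith
    rw [hL, ← h2, h3, ← h1, lcY, ← Complex.normSq_conj (lcPos k q₀ p₀ n), ← Complex.normSq_mul,
      Complex.normSq_apply]
    ring
  refine ⟨fun n h => H.state_mem hβ (hρ n h) (hz1 n h) hk (hE n h), fun n h => ?_, fun n h => ?_,
    fun n h => ?_⟩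
  · refine H.hasDerivAt_state hβ (hρ n h) (hasDerivAt_normSq_lcPos (hn n h)) ?_ (hz n h) (hE n h)
    refine (hasDerivAt_lcY (hn n h)).congr_deriv ?_
    rw [hp₀]; ring
  · have h1 := (hasDerivAt_normSq_lcPos (q₀ := q₀) (p₀ := p₀) (hn n h)).continuousAt
    have h2 : ContinuousAt (fun n : ℝ => 2 / (1 - k * n ^ 2)) n :=
      continuousAt_const.div (by fun_prop) (hn n h).ne'
    refine (h2.mul (h1.div ?_ ?_)).continuousWithinAt
    · exact continuousAt_const.mul (continuousAt_const.add ((h1.div_const c).pow 2))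
    · positivity
  · have := hρ n h
    have := hn n h
    rw [lcSpeed]
    positivity

end SphericalSurface

/-! ### Crossing the boundary of an isolating block -/

section Crossing

variable {E : Type*} [NormedAddCommGroup E] [NormedSpace ℝ E] {M N B : Set E} {F : E → E}

/-- The orbit of a curve leaves an isolating set, if the curve has no limit points in the regular
part of the state manifold at the two ends `l₁`, `l₂` of its open domain `J`. -/
theorem exists_notMem_of_isolates (hF : ∀ p ∈ M \ N, ContDiffAt ℝ 1 F p) (hB : Isolates M N F B)
    {X : ℝ → E} {g : ℝ → ℝ} {J : Set ℝ} (hJo : IsOpen J) (hJc : OrdConnected J) (hJ : J.Nonempty)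
    (hX : ∀ a b, Ioo a b ⊆ J → IsOrbit M N F X g a b)
    {l₁ l₂ : Filter ℝ} [l₁.NeBot] [l₂.NeBot] (hl₁ : ∀ n₀ ∈ J, ∀ᶠ n in l₁, n ≤ n₀ ∧ n ∈ J)
    (hl₂ : ∀ n₀ ∈ J, ∀ᶠ n in l₂, n₀ ≤ n ∧ n ∈ J) (hlim₁ : ∀ p ∈ M \ N, ¬ MapClusterPt p l₁ X)
    (hlim₂ : ∀ p ∈ M \ N, ¬ MapClusterPt p l₂ X) : ∃ n ∈ J, X n ∉ B := by
  by_contra! hin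
  have horb : ∀ n₁ ∈ J, ∀ n₂ ∈ J, ∃ a < n₁, ∃ b > n₂, IsOrbit M N F X g a b := by
    intro n₁ h₁ n₂ h₂
    obtain ⟨a, ha, haJ⟩ := exists_Ioc_subset_of_mem_nhds (hJo.mem_nhds h₁) (exists_lt n₁)
    obtain ⟨b, hb, hbJ⟩ := exists_Ico_subset_of_mem_nhds (hJo.mem_nhds h₂) (exists_gt n₂)
    refine ⟨a, ha, b, hb, hX a b fun n hn => ?_⟩
    rcases le_or_gt n n₁ with h3 | h3
    · exact haJ ⟨hn.1, h3⟩
    rcases le_or_gt n₂ n with h4 | h4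
    · exact hbJ ⟨h4, hn.2⟩
    · exact hJc.out h₁ h₂ ⟨h3.le, h4.le⟩
  obtain ⟨n₀, hn₀⟩ := hJ
  obtain ⟨a, ha, b, hb, ho⟩ := horb n₀ hn₀ n₀ hn₀
  obtain ⟨t, y, hy, hyB⟩ := hB.2 (X n₀) ⟨hin n₀ hn₀, (ho.mem n₀ ⟨ha, hb⟩).2⟩
  rcases le_total 0 t with ht | ht
  · refine hyB (IsOrbit.mem_of_flowsTo_of_nonneg (g := g) hF (l := l₂) ?_ hlim₂ ht hy)
    filter_upwards [hl₂ n₀ hn₀] with n hn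
    exact ⟨hn.1, horb n₀ hn₀ n hn.2, fun n' hn' => hin n' (hJc.out hn₀ hn.2 hn')⟩
  · refine hyB (IsOrbit.mem_of_flowsTo_of_nonpos (g := g) hF (l := l₁) ?_ hlim₁ ht hy)
    filter_upwards [hl₁ n₀ hn₀] with n hn
    exact ⟨hn.1, horb n hn.2 n₀ hn₀, fun n' hn' => hin n' (hJc.out hn.2 hn₀ hn')⟩

/-- At a boundary point of an isolating block right after which the orbit is in the block, the orbit
crosses the boundary transversally, and the block is locally one side `{0 ≤ κ}` of it. -/
theorem IsIsolatingBlock.exists_crossing [FiniteDimensional ℝ E] {H : Type*} [NormedAddCommGroup H]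
    [NormedSpace ℝ H] [FiniteDimensional ℝ H] (hF : ∀ p ∈ M \ N, ContDiffAt ℝ 1 F p)
    (hB : IsIsolatingBlock (Module.finrank ℝ H) M N F B) {X : ℝ → E} {g : ℝ → ℝ} {a b n₀ : ℝ}
    (hX : IsOrbit M N F X g a b) (hn₀ : n₀ ∈ Ioo a b) (hx : X n₀ ∈ relBoundary M B)
    (hin : ∀ᶠ n in 𝓝[>] n₀, X n ∈ B) {e : E → H} {e' : E →L[ℝ] H}
    (he : ∀ᶠ p in 𝓝 (X n₀), p ∈ M ↔ e p = 0) (hee : HasStrictFDerivAt e e' (X n₀))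
    (he' : e'.range = ⊤) :
    ∃ κ : E → ℝ, ∃ V, IsOpen V ∧ X n₀ ∈ V ∧ κ (X n₀) = 0 ∧
      (∀ p ∈ V, DifferentiableAt ℝ κ p ∧ 0 < fderiv ℝ κ p (F p)) ∧
      (∀ p ∈ M ∩ V, κ p = 0 → p ∈ relBoundary M B) ∧ (∀ p ∈ M ∩ V, p ∈ B ↔ 0 ≤ κ p) := by
  have hd := hX.deriv n₀ hn₀
  have hXc := hd.continuousAt
  have hg0 := hX.pos n₀ hn₀
  have hne : X n₀ ∉ egress M N F B := fun h => by
    obtain ⟨n, h1, h2⟩ := (((hX.mem_egress_iff hF hn₀ hx).1 h).and hin).exists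
    exact h1 h2
  have hnt : F (X n₀) ∉ tangentConeAt ℝ (relBoundary M B) (X n₀) := fun h => by
    have h1 : X n₀ ∈ tangency M F B := ⟨hx, h⟩
    rw [hB.tangency_eq] at h1
    exact hne h1.2
  have hw : e' (F (X n₀)) = 0 := by
    have h1 := hee.hasFDerivAt.comp_hasDerivAt n₀ hd
    have h2 : HasDerivAt (e ∘ X) 0 n₀ := by
      refine (hasDerivAt_const n₀ (0 : H)).congr_of_eventuallyEq ?_
      filter_upwards [hXc.eventually he, Ioo_mem_nhds hn₀.1 hn₀.2] with n h3 h4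
      exact h3.1 (hX.mem n h4).1
    have h3 := h1.unique h2
    rw [map_smul] at h3
    exact (smul_eq_zero.1 h3).resolve_left hg0.ne'
  obtain ⟨κ, V, hVo, hxV, hκ0, hκ, hz, hp, hm⟩ := exists_sides hB.boundary_smooth hx he hee he' hw
    hnt (hF _ (hX.mem n₀ hn₀)).continuousAt
  refine ⟨κ, V, hVo, hxV, hκ0, hκ, hz, ?_⟩
  have hbB : relBoundary M B ⊆ B := fun p hp => hB.isCompact.isClosed.closure_subset hp.2.1
  -- Right after `n₀` the curve is on the side `{0 < κ}`, so that side is contained in `B`.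
  have hp' : M ∩ V ∩ {p | 0 < κ p} ⊆ B := by
    refine hp.resolve_right fun hdis => ?_
    have hdκ : HasDerivAt (κ ∘ X) (fderiv ℝ κ (X n₀) (g n₀ • F (X n₀))) n₀ :=
      (hκ _ hxV).1.hasFDerivAt.comp_hasDerivAt n₀ hd
    have hpos : 0 < fderiv ℝ κ (X n₀) (g n₀ • F (X n₀)) := by
      rw [map_smul]; exact mul_pos hg0 (hκ _ hxV).2
    have h1 : ∀ᶠ n in 𝓝[>] n₀, 0 < κ (X n) := by
      have h2 := (hasDerivAt_iff_tendsto_slope.1 hdκ).eventually (lt_mem_nhds hpos)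
      have h3 := h2.filter_mono (nhdsWithin_mono n₀ (fun n (hn : n ∈ Ioi n₀) => ne_of_gt hn))
      filter_upwards [h3, self_mem_nhdsWithin] with n h4 (h5 : n₀ < n)
      rw [slope_def_field, Function.comp_apply, Function.comp_apply, hκ0, sub_zero] at h4
      exact (div_pos_iff_of_pos_right (sub_pos.2 h5)).1 h4
    have h2 : ∀ᶠ n in 𝓝[>] n₀, X n ∈ V ∧ n ∈ Ioo a b :=
      ((hXc.eventually (hVo.mem_nhds hxV)).and (Ioo_mem_nhds hn₀.1 hn₀.2)).filter_mono
        nhdsWithin_le_nhds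
    obtain ⟨n, h3, h4, h5⟩ := (h1.and (h2.and hin)).exists
    exact disjoint_left.1 hdis ⟨⟨(hX.mem n h4.2).1, h4.1⟩, h3⟩ h5
  -- The other side is not contained in `B`, as `X n₀` is a boundary point.
  have hm' : Disjoint (M ∩ V ∩ {p | κ p < 0}) B := by
    refine hm.resolve_left fun hsub => ?_
    obtain ⟨q, hqV, hqM, hqB⟩ := mem_closure_iff.1 hx.2.2 V hVo hxV
    rcases lt_trichotomy (κ q) 0 with h1 | h1 | h1
    · exact hqB (hsub ⟨⟨hqM, hqV⟩, h1⟩)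
    · exact hqB (hbB (hz q ⟨hqM, hqV⟩ h1))
    · exact hqB (hp' ⟨⟨hqM, hqV⟩, h1⟩)
  intro p hpMV
  constructor
  · intro hpB
    by_contra! hlt
    exact disjoint_left.1 hm' ⟨hpMV, hlt⟩ hpB
  · intro h0
    rcases h0.eq_or_lt with h1 | h1
    · exact hbB (hz p hpMV h1.symm)
    · exact hp' ⟨hpMV, h1⟩

/-- Along an orbit in the domain of a function that increases along the vector field, the function
increases. -/
theorem IsOrbit.strictMonoOn_comp {X : ℝ → E} {g : ℝ → ℝ} {a b n₁ n₂ : ℝ} (hX : IsOrbit M N F X g a b)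
    {κ : E → ℝ} {V : Set E} (hκ : ∀ p ∈ V, DifferentiableAt ℝ κ p ∧ 0 < fderiv ℝ κ p (F p))
    (h₁ : a < n₁) (h₂ : n₂ < b) (hV : ∀ n ∈ Icc n₁ n₂, X n ∈ V) :
    StrictMonoOn (κ ∘ X) (Icc n₁ n₂) := by
  have hd : ∀ n ∈ Icc n₁ n₂, HasDerivAt (κ ∘ X) (fderiv ℝ κ (X n) (g n • F (X n))) n :=
    fun n hn => (hκ _ (hV n hn)).1.hasFDerivAt.comp_hasDerivAt n
      (hX.deriv n ⟨h₁.trans_le hn.1, hn.2.trans_lt h₂⟩)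
  refine strictMonoOn_of_deriv_pos (convex_Icc _ _)
    (fun n hn => (hd n hn).continuousAt.continuousWithinAt) fun n hn => ?_
  have hn' := interior_subset hn
  rw [(hd n hn').deriv, map_smul]
  exact mul_pos (hX.pos n ⟨h₁.trans_le hn'.1, hn'.2.trans_lt h₂⟩) (hκ _ (hV n hn')).2

end Crossing

/-! ### Entering a block and caps around the pole -/

/-- The first exit of a curve from a closed set. -/
theorem exists_first_exit {E : Type*} [TopologicalSpace E] {B : Set E} (hB : IsClosed B) {X : ℝ → E}
    {a b : ℝ} (hab : a ≤ b) (hX : ContinuousOn X (Icc a b)) (ha : X a ∈ B) (hb : X b ∉ B) :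
    ∃ n ∈ Ico a b, (∀ n' ∈ Icc a n, X n' ∈ B) ∧ ∃ᶠ n' in 𝓝[>] n, X n' ∉ B := by
  set T := {n ∈ Icc a b | ∀ n' ∈ Icc a n, X n' ∈ B} with hT
  have haT : a ∈ T := ⟨left_mem_Icc.2 hab, fun n' hn' => by rwa [le_antisymm hn'.2 hn'.1]⟩
  have hbdd : BddAbove T := ⟨b, fun n hn => hn.1.2⟩
  have hs1 : a ≤ sSup T := le_csSup hbdd haT
  have hs2 : sSup T ≤ b := csSup_le ⟨a, haT⟩ fun n hn => hn.1.2
  have hlt : ∀ n' ∈ Ico a (sSup T), X n' ∈ B := fun n' hn' => by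
    obtain ⟨n, hn, h1⟩ := exists_lt_of_lt_csSup ⟨a, haT⟩ hn'.2
    exact hn.2 n' ⟨hn'.1, h1.le⟩
  have hsB : X (sSup T) ∈ B := by
    rcases hs1.eq_or_lt with h1 | h1
    · rwa [← h1]
    · have h2 : Tendsto X (𝓝[Ico a (sSup T)] (sSup T)) (𝓝 (X (sSup T))) :=
        (hX _ ⟨hs1, hs2⟩).mono fun n hn => ⟨hn.1, hn.2.le.trans hs2⟩
      have : (𝓝[Ico a (sSup T)] (sSup T)).NeBot := by
        rw [nhdsWithin_Ico_eq_nhdsLT h1]; infer_instance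
      exact hB.mem_of_tendsto h2 (eventually_mem_nhdsWithin.mono hlt)
  have hs3 : sSup T < b := hs2.lt_of_ne fun h => hb (h ▸ hsB)
  have hle : ∀ n' ∈ Icc a (sSup T), X n' ∈ B := fun n' hn' => by
    rcases hn'.2.eq_or_lt with h1 | h1
    · rwa [h1]
    · exact hlt n' ⟨hn'.1, h1⟩
  refine ⟨sSup T, ⟨hs1, hs3⟩, hle, fun h => ?_⟩
  obtain ⟨n, hn, h1⟩ := (mem_nhdsGT_iff_exists_mem_Ioc_Ioo_subset hs3).1 h
  have hm : (sSup T + n) / 2 ∈ T := by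
    refine ⟨⟨by linarith [hn.1], by linarith [hn.1, hn.2]⟩, fun n' hn' => ?_⟩
    rcases le_or_gt n' (sSup T) with h2 | h2
    · exact hle n' ⟨hn'.1, h2⟩
    · exact not_not.1 (h1 ⟨h2, by linarith [hn'.2, hn.1]⟩)
  have := le_csSup hbdd hm
  linarith [hn.1]

section Interior

variable {E : Type*} [NormedAddCommGroup E] [NormedSpace ℝ E] {M N B : Set E} {F : E → E}

omit [NormedSpace ℝ E] in
theorem mem_relBoundary_or_mem_nhdsWithin {p : E} (hM : p ∈ M) (hB : p ∈ B) :
    p ∈ relBoundary M B ∨ B ∈ 𝓝[M] p := by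
  by_cases h : p ∈ closure (M \ B)
  · exact Or.inl ⟨hM, subset_closure hB, h⟩
  · right
    filter_upwards [self_mem_nhdsWithin,
      mem_nhdsWithin_of_mem_nhds (isClosed_closure.isOpen_compl.mem_nhds h)] with q h1 h2
    by_contra h3
    exact h2 (subset_closure ⟨h1, h3⟩)

/-- At a boundary point of an isolating block right after which the orbit is in the block, the orbit
enters the block. -/
theorem IsIsolatingBlock.eventually_notMem [FiniteDimensional ℝ E] {H : Type*}
    [NormedAddCommGroup H] [NormedSpace ℝ H] [FiniteDimensional ℝ H]
    (hF : ∀ p ∈ M \ N, ContDiffAt ℝ 1 F p)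
    (hB : IsIsolatingBlock (Module.finrank ℝ H) M N F B) {X : ℝ → E} {g : ℝ → ℝ} {a b n₀ : ℝ}
    (hX : IsOrbit M N F X g a b) (hn₀ : n₀ ∈ Ioo a b) (hx : X n₀ ∈ relBoundary M B)
    (hin : ∀ᶠ n in 𝓝[>] n₀, X n ∈ B) {e : E → H} {e' : E →L[ℝ] H}
    (he : ∀ᶠ p in 𝓝 (X n₀), p ∈ M ↔ e p = 0) (hee : HasStrictFDerivAt e e' (X n₀))
    (he' : e'.range = ⊤) : ∀ᶠ n in 𝓝[<] n₀, X n ∉ B := by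
  obtain ⟨κ, V, hVo, hxV, hκ0, hκ, -, hs⟩ := hB.exists_crossing hF hX hn₀ hx hin he hee he'
  have h1 : ∀ᶠ n in 𝓝 n₀, X n ∈ V ∧ n ∈ Ioo a b :=
    ((hX.deriv n₀ hn₀).continuousAt.eventually (hVo.mem_nhds hxV)).and (Ioo_mem_nhds hn₀.1 hn₀.2)
  obtain ⟨ε, hε, h2⟩ := Metric.eventually_nhds_iff_ball.1 h1
  filter_upwards [Ioo_mem_nhdsLT (show n₀ - ε < n₀ by linarith)] with m hm hmB
  have h3 : ∀ n ∈ Icc m n₀, X n ∈ V ∧ n ∈ Ioo a b := fun n hn => h2 n (by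
    rw [Real.ball_eq_Ioo]; exact ⟨by linarith [hn.1, hm.1], by linarith [hn.2]⟩)
  have h4 := h3 m ⟨le_rfl, hm.2.le⟩
  have h5 := hX.strictMonoOn_comp hκ h4.2.1 hn₀.2 (fun n hn => (h3 n hn).1)
    ⟨le_rfl, hm.2.le⟩ ⟨hm.2.le, le_rfl⟩ hm.2
  simp only [Function.comp_apply, hκ0] at h5
  exact absurd ((hs _ ⟨(hX.mem _ h4.2).1, h4.1⟩).1 hmB) h5.not_ge

end Interior

namespace SphericalSurface

variable {S : SphericalSurface} {b c β γ h : ℝ}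

/-- The polar cap of states with gnomonic radius at most `ρ`. -/
def cap (S : SphericalSurface) (b c β γ h ρ : ℝ) : Set (ℝ × ℂ × ℝ × ℝ) :=
  {p ∈ S.energyManifold β γ h | p.1 ≤ S.param b c ρ}

namespace IsSpindle

variable (H : S.IsSpindle b c)
include H

theorem isCompact_cap (hβ : β ^ 2 = b ^ 2) (ρ : ℝ) : IsCompact (S.cap b c β γ h ρ) := by
  set K : Set (ℝ × ℂ × ℝ × ℝ) := {p | p.1 ∈ Icc 0 ρ ∧ ‖p.2.1‖ = 1 ∧
    (p.2.2.1 ^ 2 + p.2.2.2 ^ 2) / 2 = γ + h * p.1} with hK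
  have hcl : IsClosed K := by
    refine IsClosed.inter (isClosed_Icc.preimage continuous_fst) (IsClosed.inter ?_ ?_)
    · exact isClosed_eq (by fun_prop) (by fun_prop)
    · exact isClosed_eq (by fun_prop) (by fun_prop)
  set A := 2 * (|γ| + |h| * |ρ|) + 1 with hA
  have hA1 : 1 ≤ A := by
    have : 0 ≤ |γ| + |h| * |ρ| := by positivity
    linarith
  have hsub : K ⊆ Icc 0 ρ ×ˢ Metric.closedBall (0 : ℂ) 1 ×ˢ Icc (-A) A ×ˢ Icc (-A) A := by
    rintro ⟨r, z, u, v⟩ ⟨h1, h2, h3⟩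
    simp only at h1 h2 h3
    have h4 : h * r ≤ |h| * |ρ| := by
      calc h * r ≤ |h| * r := mul_le_mul_of_nonneg_right (le_abs_self h) h1.1
        _ ≤ |h| * |ρ| := mul_le_mul_of_nonneg_left (h1.2.trans (le_abs_self ρ)) (abs_nonneg h)
    have h5 := le_abs_self γ
    have h6 : u ^ 2 + v ^ 2 ≤ A := by linarith
    have hu : |u| ≤ A := abs_le_of_sq_le_sq (by nlinarith [sq_nonneg v]) (by linarith)
    have hv : |v| ≤ A := abs_le_of_sq_le_sq (by nlinarith [sq_nonneg u]) (by linarith)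
    exact ⟨h1, by simp [h2], abs_le.1 hu, abs_le.1 hv⟩
  have hKc : IsCompact K := (isCompact_Icc.prod ((isCompact_closedBall _ _).prod
    (isCompact_Icc.prod isCompact_Icc))).of_isClosed_subset hcl hsub
  have him : S.cap b c β γ h ρ = (fun p : ℝ × ℂ × ℝ × ℝ => (S.param b c p.1, p.2)) '' K := by
    ext p
    constructor
    · rintro ⟨h1, h2⟩
      have h3 := h2.trans_lt (H.param_lt_equator ρ)
      obtain ⟨h4, h5, h6⟩ := (H.mem_energyManifold_iff hβ h3).1 h1
      refine ⟨(S.gnomonic b c p.1, p.2), ⟨⟨H.gnomonic_nonneg ⟨h5, h3⟩, ?_⟩, h4, h6⟩, ?_⟩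
      · rwa [← H.param_gnomonic ⟨h5, h3⟩, H.param_strictMono.le_iff_le] at h2
      · exact Prod.ext (H.param_gnomonic ⟨h5, h3⟩) rfl
    · rintro ⟨⟨r, z, u, v⟩, ⟨h1, h2, h3⟩, rfl⟩
      refine ⟨(H.mem_energyManifold_iff hβ (H.param_lt_equator r)).2 ⟨h2, ?_, ?_⟩,
        H.param_strictMono.monotone h1.2⟩
      · rw [← param_zero (S := S) (b := b) (c := c)]
        exact H.param_strictMono.monotone h1.1
      · simpa only [H.gnomonic_param] using h3
  rw [him]
  exact hKc.image (by have := S.continuous_param (b := b) (c := c); fun_prop)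

/-- A set that contains the collisions in its interior contains a polar cap. -/
theorem exists_cap_subset (hβ : β ^ 2 = b ^ 2) {B : Set (ℝ × ℂ × ℝ × ℝ)}
    (hB : S.collisionSet β γ h ⊆ relInterior (S.energyManifold β γ h) B) :
    ∃ ρ > 0, ∀ p ∈ S.energyManifold β γ h, p.1 < S.param b c ρ → p ∈ B := by
  set M := S.energyManifold β γ h
  have hc : IsCompact (S.cap b c β γ h 1 ∩ closure (M \ B)) :=
    (H.isCompact_cap hβ 1).inter_right isClosed_closure
  rcases (S.cap b c β γ h 1 ∩ closure (M \ B)).eq_empty_or_nonempty with he | hne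
  · refine ⟨1, one_pos, fun p hp hlt => ?_⟩
    by_contra hpB
    have h1 : p ∈ S.cap b c β γ h 1 ∩ closure (M \ B) :=
      ⟨⟨hp, hlt.le⟩, subset_closure ⟨hp, hpB⟩⟩
    simp [he] at h1
  · obtain ⟨p₀, hp₀, hmin⟩ := hc.exists_isMinOn hne continuous_fst.continuousOn
    have h1 := hp₀.1.2.trans_lt (H.param_lt_equator 1)
    have h2 := ((H.mem_energyManifold_iff hβ h1).1 hp₀.1.1).2.1
    have h3 : S.rN < p₀.1 := h2.lt_of_ne fun heq => by
      have h4 := (hB ⟨hp₀.1.1, heq.symm⟩).2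
      have h5 := mem_closure_iff_nhdsWithin_neBot.1 hp₀.2
      rw [sdiff_eq, inter_comm, nhdsWithin_inter'] at h5
      have h6 : (Bᶜ) ∩ B ∈ 𝓟 Bᶜ ⊓ 𝓝[M] p₀ :=
        inter_mem (mem_inf_of_left (mem_principal_self _)) (mem_inf_of_right h4)
      rw [inf_comm] at h6
      simp only [compl_inter_self] at h6
      rw [nhdsWithin, inf_right_comm, ← nhdsWithin] at h5
      exact h5.ne (empty_mem_iff_bot.1 h6)
    refine ⟨S.gnomonic b c p₀.1, H.gnomonic_pos ⟨h3, h1⟩, fun p hp hlt => ?_⟩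
    rw [H.param_gnomonic ⟨h2, h1⟩] at hlt
    by_contra hpB
    exact hlt.not_ge (hmin ⟨⟨hp, hlt.le.trans hp₀.1.2⟩, subset_closure ⟨hp, hpB⟩⟩)

/-- Off the pole, the energy manifold is a regular level set of two functions. -/
theorem exists_defining_map (hβ : β ^ 2 = b ^ 2) (hγ : 0 < γ) {p : ℝ × ℂ × ℝ × ℝ}
    (hp : p ∈ S.energyManifold β γ h) (h1 : S.rN < p.1) (h2 : p.1 < S.equator b c) :
    ∃ (e : ℝ × ℂ × ℝ × ℝ → ℝ × ℝ) (e' : ℝ × ℂ × ℝ × ℝ →L[ℝ] ℝ × ℝ),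
      (∀ᶠ q in 𝓝 p, q ∈ S.energyManifold β γ h ↔ e q = 0) ∧ HasStrictFDerivAt e e' p ∧
        e'.range = ⊤ := by
  have hb := H.b_pos
  have hc := H.c_pos
  obtain ⟨hz, -, hE⟩ := (H.mem_energyManifold_iff hβ h2).1 hp
  have hang := H.angle_mem ⟨h1.le, h2⟩
  have hcos : 0 < Real.cos (b ^ 2 / c * (p.1 - S.rN)) :=
    Real.cos_pos_of_mem_Ioo ⟨by linarith [hang.1, Real.pi_pos], hang.2⟩
  set D := b ^ 2 / Real.cos (b ^ 2 / c * (p.1 - S.rN)) ^ 2 with hD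
  have hD0 : D ≠ 0 := by positivity
  have hg : HasStrictDerivAt (S.gnomonic b c) D p.1 := by
    have h3 : HasStrictDerivAt (fun r => b ^ 2 / c * (r - S.rN)) (b ^ 2 / c) p.1 := by
      simpa using HasStrictDerivAt.const_mul (b ^ 2 / c) ((hasStrictDerivAt_id p.1).sub_const S.rN)
    refine (HasStrictDerivAt.const_mul c
      ((Real.hasStrictDerivAt_tan hcos.ne').comp p.1 h3)).congr_deriv ?_
    rw [hD]; field_simp
  let fr : ℝ × ℂ × ℝ × ℝ →L[ℝ] ℝ := ContinuousLinearMap.fst ℝ _ _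
  let fz : ℝ × ℂ × ℝ × ℝ →L[ℝ] ℂ :=
    (ContinuousLinearMap.fst ℝ _ _).comp (ContinuousLinearMap.snd ℝ _ _)
  let fu : ℝ × ℂ × ℝ × ℝ →L[ℝ] ℝ := (ContinuousLinearMap.fst ℝ _ _).comp
    ((ContinuousLinearMap.snd ℝ _ _).comp (ContinuousLinearMap.snd ℝ _ _))
  let fv : ℝ × ℂ × ℝ × ℝ →L[ℝ] ℝ := (ContinuousLinearMap.snd ℝ _ _).comp
    ((ContinuousLinearMap.snd ℝ _ _).comp (ContinuousLinearMap.snd ℝ _ _))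
  have er := fr.hasStrictFDerivAt (x := p)
  have ex := (Complex.reCLM.comp fz).hasStrictFDerivAt (x := p)
  have ey := (Complex.imCLM.comp fz).hasStrictFDerivAt (x := p)
  have eu := fu.hasStrictFDerivAt (x := p)
  have ev := fv.hasStrictFDerivAt (x := p)
  have e1 := ((ex.mul ex).add (ey.mul ey)).sub_const 1
  have e2 := (((eu.mul eu).add (ev.mul ev)).const_mul (1 / 2)).sub
    ((hg.comp_hasStrictFDerivAt p er).const_mul h)
  refine ⟨_, _, ?_, e1.prodMk (e2.sub_const γ), ?_⟩
  · filter_upwards [(isOpen_Ioo.preimage continuous_fst).mem_nhds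
      (show p ∈ Prod.fst ⁻¹' Ioo S.rN (S.equator b c) from ⟨h1, h2⟩)] with q hq
    rw [H.mem_energyManifold_iff hβ hq.2, Prod.mk_eq_zero]
    have h3 : ‖q.2.1‖ = 1 ↔ q.2.1.re * q.2.1.re + q.2.1.im * q.2.1.im - 1 = 0 := by
      rw [← Complex.normSq_apply, Complex.normSq_eq_norm_sq, sub_eq_zero,
        pow_eq_one_iff_of_nonneg (norm_nonneg _) two_ne_zero]
    refine and_congr h3 ?_
    simp only [hq.1.le, true_and]
    change _ ↔ 1 / 2 * (q.2.2.1 * q.2.2.1 + q.2.2.2 * q.2.2.2) - h * S.gnomonic b c q.1 - γ = 0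
    constructor <;> intro h4 <;> linarith
  · rw [LinearMap.range_eq_top]
    rintro ⟨s, t⟩
    have hzz : p.2.1.re * p.2.1.re + p.2.1.im * p.2.1.im = 1 := by
      rw [← Complex.normSq_apply, Complex.normSq_eq_norm_sq, hz, one_pow]
    -- At rest points the derivative in the direction of `r` is needed, which is `-h D ≠ 0` there.
    by_cases huv : p.2.2.1 ^ 2 + p.2.2.2 ^ 2 = 0
    · have h0 : h ≠ 0 := fun h0 => by rw [huv, h0] at hE; linarith
      refine ⟨(-t / (h * D), (s / 2) • p.2.1, 0, 0), ?_⟩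
      simp [fr, fz, fu, fv, -Complex.real_smul]
      simp only [Complex.smul_re, Complex.smul_im, smul_eq_mul]
      refine ⟨by linear_combination s * hzz, by field_simp⟩
    · refine ⟨(0, (s / 2) • p.2.1, t / (p.2.2.1 ^ 2 + p.2.2.2 ^ 2) * p.2.2.1,
        t / (p.2.2.1 ^ 2 + p.2.2.2 ^ 2) * p.2.2.2), ?_⟩
      simp [fr, fz, fu, fv, -Complex.real_smul]
      simp only [Complex.smul_re, Complex.smul_im, smul_eq_mul]
      refine ⟨by linear_combination s * hzz, by field_simp; ring⟩

end IsSpindle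

end SphericalSurface

/-! ### Flybys of the pole -/

section Flyby

variable {b c γ h σ δ n : ℝ}

/-- The energy constant `k` of the flyby that passes the pole at the gnomonic radius `δ²`. Since the
angular momentum of the flyby depends on `k`, this is the solution of the linear equation
`2 k = h - L² / (2 c²)` with `L² = 4 δ² (k δ² + γ / 2)`. -/
def flybyEnergy (c γ h δ : ℝ) : ℝ := (h * c ^ 2 - γ * δ ^ 2) / (2 * (c ^ 2 + δ ^ 4))

/-- The size of the momentum of the flyby at the point of closest approach. -/
def flybyMom (c γ h δ : ℝ) : ℝ := √(flybyEnergy c γ h δ * δ ^ 2 + γ / 2)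

/-- A family of Levi-Civita solutions that pass the origin at the distance `δ`; for `δ = 0` the
solution runs through the origin. -/
def flybyPos (c γ h δ n : ℝ) : ℂ :=
  lcPos (flybyEnergy c γ h δ) δ (flybyMom c γ h δ * Complex.I) n

/-- The meridian along the flyby. For `σ = 1` and `σ = -1` the particle passes the pole on different
sides. As the cone angle is `2πb` and the Levi-Civita map doubles angles, the angle of `flybyPos` is
multiplied by `2 / b`. -/
def flybyMeridian (b c γ h σ δ n : ℝ) : ℂ :=
  Complex.exp (((σ * (2 / b) * (Complex.arg (flybyPos c γ h δ n) + Real.pi / 2) : ℝ) : ℂ) * Complex.I)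

theorem continuous_flybyEnergy (hc : 0 < c) : Continuous (flybyEnergy c γ h) := by
  unfold flybyEnergy
  exact Continuous.div (by fun_prop) (by fun_prop) fun δ => by positivity

theorem continuous_flybyMom (hc : 0 < c) : Continuous (flybyMom c γ h) := by
  have := continuous_flybyEnergy (γ := γ) (h := h) hc
  unfold flybyMom
  fun_prop

theorem flybyEnergy_zero (hc : 0 < c) : flybyEnergy c γ h 0 = h / 2 := by
  simp [flybyEnergy]; field_simp

theorem flybyMom_zero : flybyMom c γ h 0 = √(γ / 2) := by simp [flybyMom]

theorem flybyPos_eq : flybyPos c γ h δ n =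
    (((1 - flybyEnergy c γ h δ * n ^ 2)⁻¹ * ((1 + flybyEnergy c γ h δ * n ^ 2) * δ) : ℝ) : ℂ) +
      (((1 - flybyEnergy c γ h δ * n ^ 2)⁻¹ * (2 * n * flybyMom c γ h δ) : ℝ) : ℂ) * Complex.I := by
  simp only [flybyPos, lcPos, Complex.real_smul]
  push_cast
  ring

theorem flybyPos_zero (hc : 0 < c) : flybyPos c γ h 0 n =
    (((1 - h / 2 * n ^ 2)⁻¹ * (2 * n * √(γ / 2)) : ℝ) : ℂ) * Complex.I := by
  rw [flybyPos_eq, flybyEnergy_zero hc, flybyMom_zero]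
  simp

theorem flybyPos_mem_slitPlane (hw : 0 < flybyMom c γ h δ) (hn : 0 < 1 - flybyEnergy c γ h δ * n ^ 2)
    (h0 : 0 < δ ∨ n ≠ 0) : flybyPos c γ h δ n ∈ Complex.slitPlane := by
  rw [Complex.mem_slitPlane_iff, flybyPos_eq]
  by_cases hn0 : n = 0
  · left
    simpa [hn0] using h0
  · right
    rw [Complex.add_im, Complex.ofReal_im, zero_add, Complex.im_ofReal_mul, Complex.I_im, mul_one]
    exact mul_ne_zero (inv_ne_zero hn.ne') (mul_ne_zero (mul_ne_zero two_ne_zero hn0) hw.ne')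

theorem continuousAt_flybyPos (hc : 0 < c) (hn : 0 < 1 - flybyEnergy c γ h δ * n ^ 2) :
    ContinuousAt (fun x : ℝ × ℝ => flybyPos c γ h x.1 x.2) (δ, n) := by
  have h1 := (continuous_flybyEnergy (γ := γ) (h := h) hc).comp (continuous_fst (X := ℝ) (Y := ℝ))
  have h2 := (continuous_flybyMom (γ := γ) (h := h) hc).comp (continuous_fst (X := ℝ) (Y := ℝ))
  simp only [Function.comp_def] at h1 h2
  have h3 : ContinuousAt (fun x : ℝ × ℝ => (1 - flybyEnergy c γ h x.1 * x.2 ^ 2)⁻¹) (δ, n) :=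
    ContinuousAt.inv₀ (by fun_prop) hn.ne'
  unfold flybyPos lcPos
  exact h3.smul (by fun_prop)

end Flyby

namespace SphericalSurface

variable {S : SphericalSurface} {b c β γ h σ δ n : ℝ}

/-- The states along the flyby. -/
def flyby (S : SphericalSurface) (b c γ h σ δ : ℝ) : ℝ → ℝ × ℂ × ℝ × ℝ :=
  S.lcState b c (flybyEnergy c γ h δ) δ (flybyMom c γ h δ * Complex.I)
    (σ * (2 * δ * flybyMom c γ h δ)) (flybyMeridian b c γ h σ δ)

namespace IsSpindle

variable (H : S.IsSpindle b c)
include H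

theorem isOrbit_flyby (hβ : β ^ 2 = b ^ 2) (hσ : σ ^ 2 = 1) (hw : 0 < flybyMom c γ h δ)
    {n₁ n₂ : ℝ} (hn : ∀ n ∈ Ioo n₁ n₂, 0 < 1 - flybyEnergy c γ h δ * n ^ 2)
    (h0 : ∀ n ∈ Ioo n₁ n₂, 0 < δ ∨ n ≠ 0) :
    IsOrbit (S.energyManifold β γ h) (S.collisionSet β γ h) (S.keplerField β γ)
      (S.flyby b c γ h σ δ)
      (lcSpeed b c (flybyEnergy c γ h δ) δ (flybyMom c γ h δ * Complex.I)) n₁ n₂ := by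
  have hb := H.b_pos
  have hc := H.c_pos
  have hw2 : flybyMom c γ h δ ^ 2 = flybyEnergy c γ h δ * δ ^ 2 + γ / 2 :=
    Real.sq_sqrt (Real.sqrt_pos.1 hw).le
  have him : (starRingEnd ℂ (δ : ℂ) * (flybyMom c γ h δ * Complex.I)).im = δ * flybyMom c γ h δ := by
    simp
  have hs : ∀ n ∈ Ioo n₁ n₂, flybyPos c γ h δ n ∈ Complex.slitPlane := fun n h =>
    flybyPos_mem_slitPlane hw (hn n h) (h0 n h)
  refine H.isOrbit hβ ?_ ?_ ?_ hn (fun n h => Complex.slitPlane_ne_zero (hs n h)) ?_ ?_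
  · simp [Complex.normSq_apply]
    linear_combination hw2
  · rw [him]
    linear_combination 4 * δ ^ 2 * flybyMom c γ h δ ^ 2 * hσ
  · rw [mul_pow, hσ, one_mul, mul_pow, hw2, flybyEnergy]
    have : c ^ 2 + δ ^ 4 ≠ 0 := by positivity
    field_simp
    ring
  · intro n _
    rw [flybyMeridian, Complex.norm_exp_ofReal_mul_I]
  · intro n hnI
    have h1 : HasDerivAt (flybyPos c γ h δ) _ n := hasDerivAt_lcPos (hn n hnI)
    have h2 := Complex.imCLM.hasFDerivAt.comp_hasDerivAt n (h1.clog_real (hs n hnI))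
    have h3 : HasDerivAt (fun n => Complex.arg (flybyPos c γ h δ n)) _ n :=
      h2.congr_of_eventuallyEq (Eventually.of_forall fun n => (Complex.log_im _).symm)
    have h4 := ((h3.add_const (Real.pi / 2)).const_mul (σ * (2 / b))).ofReal_comp
    have h5 := (h4.mul_const Complex.I).cexp
    refine h5.congr_deriv ?_
    rw [Complex.imCLM_apply, flybyPos, im_smul_div_eq, im_conj_lcPos_mul_lcMom (hn n hnI), him,
      mul_comm (Complex.exp _)]
    refine congrArg (fun x : ℝ => (x : ℂ) * Complex.I * flybyMeridian b c γ h σ δ n) ?_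
    have := (Complex.normSq_pos.2 (Complex.slitPlane_ne_zero (hs n hnI))).ne'
    rw [flybyPos] at this
    field_simp

theorem continuousAt_flyby (hw : 0 < flybyMom c γ h δ)
    (hn : 0 < 1 - flybyEnergy c γ h δ * n ^ 2) (h0 : 0 < δ ∨ n ≠ 0) :
    ContinuousAt (fun x : ℝ × ℝ => S.flyby b c γ h σ x.1 x.2) (δ, n) := by
  have hs := flybyPos_mem_slitPlane hw hn h0
  have hq := continuousAt_flybyPos (γ := γ) (h := h) H.c_pos hn
  have h1 := (continuous_flybyEnergy (γ := γ) (h := h) H.c_pos).comp (continuous_fst (X := ℝ) (Y := ℝ))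
  have h2 := (continuous_flybyMom (γ := γ) (h := h) H.c_pos).comp (continuous_fst (X := ℝ) (Y := ℝ))
  simp only [Function.comp_def] at h1 h2
  have h3 : ContinuousAt (fun x : ℝ × ℝ => (1 - flybyEnergy c γ h x.1 * x.2 ^ 2)⁻¹) (δ, n) :=
    ContinuousAt.inv₀ (by fun_prop) hn.ne'
  have hp : ContinuousAt (fun x : ℝ × ℝ => lcMom (flybyEnergy c γ h x.1) x.1
      (flybyMom c γ h x.1 * Complex.I) x.2) (δ, n) := by
    unfold lcMom
    exact h3.smul (by fun_prop)
  have hρ : ContinuousAt (fun x : ℝ × ℝ => Complex.normSq (flybyPos c γ h x.1 x.2)) (δ, n) :=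
    Complex.continuous_normSq.continuousAt.comp hq
  have hρ0 : 0 < Complex.normSq (flybyPos c γ h δ n) :=
    Complex.normSq_pos.2 (Complex.slitPlane_ne_zero hs)
  have hsq : ContinuousAt (fun x : ℝ × ℝ => √(Complex.normSq (flybyPos c γ h x.1 x.2))) (δ, n) :=
    Real.continuous_sqrt.continuousAt.comp hρ
  have hy : ContinuousAt (fun x : ℝ × ℝ => lcY (flybyEnergy c γ h x.1) x.1
      (flybyMom c γ h x.1 * Complex.I) x.2) (δ, n) := by
    unfold lcY
    exact Complex.continuous_re.continuousAt.comp
      ((Complex.continuous_conj.continuousAt.comp hq).mul hp)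
  have harg : ContinuousAt (fun x : ℝ × ℝ => Complex.arg (flybyPos c γ h x.1 x.2)) (δ, n) :=
    ContinuousAt.comp (g := Complex.arg) (Complex.continuousAt_arg hs) hq
  have hz : ContinuousAt (fun x : ℝ × ℝ => flybyMeridian b c γ h σ x.1 x.2) (δ, n) := by
    unfold flybyMeridian
    refine Complex.continuous_exp.continuousAt.comp (ContinuousAt.mul ?_ continuousAt_const)
    exact Complex.continuous_ofReal.continuousAt.comp
      (continuousAt_const.mul (harg.add continuousAt_const))
  unfold flyby lcState state
  refine (continuous_param.continuousAt.comp hρ).prodMk (hz.prodMk (ContinuousAt.prodMk ?_ ?_))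
  · refine ContinuousAt.div ?_ hsq (Real.sqrt_pos.2 hρ0).ne'
    refine ContinuousAt.mul (by fun_prop) (Real.continuous_sqrt.continuousAt.comp ?_)
    exact continuousAt_const.add ((hρ.div_const c).pow 2)
  · exact (continuousAt_const.mul hy).div hsq (Real.sqrt_pos.2 hρ0).ne'

omit H in
theorem flyby_fst : (S.flyby b c γ h σ δ n).1 =
    S.param b c (Complex.normSq (flybyPos c γ h δ n)) := rfl

/-- Before the collision, the radial solution does not depend on the side `σ`. -/
theorem flyby_zero_of_neg (hγ : 0 < γ) (hn0 : n < 0) (hn : 0 < 1 - h / 2 * n ^ 2) :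
    S.flyby b c γ h σ 0 n = S.flyby b c γ h 1 0 n := by
  have h1 : Complex.arg (flybyPos c γ h 0 n) = -(Real.pi / 2) := by
    rw [flybyPos_zero H.c_pos]
    rw [Complex.arg_eq_neg_pi_div_two_iff]
    have : 0 < √(γ / 2) := Real.sqrt_pos.2 (by positivity)
    have h2 : (1 - h / 2 * n ^ 2)⁻¹ * (2 * n * √(γ / 2)) < 0 :=
      mul_neg_of_pos_of_neg (inv_pos.2 hn) (mul_neg_of_neg_of_pos (by linarith) this)
    exact ⟨by rw [Complex.re_ofReal_mul, Complex.I_re, mul_zero],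
      by rwa [Complex.im_ofReal_mul, Complex.I_im, mul_one]⟩
  simp only [flyby, lcState, flybyMeridian, h1]
  simp

/-- The radial solution leaves on the meridian that is the limit of the outgoing meridians of the
flybys. -/
theorem flyby_zero_of_pos (hγ : 0 < γ) (hn0 : 0 < n) (hn : 0 < 1 - h / 2 * n ^ 2) :
    (S.flyby b c γ h σ 0 n).2.1 =
      Complex.exp (((σ * (2 / b) * Real.pi : ℝ) : ℂ) * Complex.I) := by
  have h1 : Complex.arg (flybyPos c γ h 0 n) = Real.pi / 2 := by
    rw [flybyPos_zero H.c_pos]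
    rw [Complex.arg_eq_pi_div_two_iff]
    have : 0 < √(γ / 2) := Real.sqrt_pos.2 (by positivity)
    have h2 : 0 < (1 - h / 2 * n ^ 2)⁻¹ * (2 * n * √(γ / 2)) := by positivity
    exact ⟨by rw [Complex.re_ofReal_mul, Complex.I_re, mul_zero],
      by rwa [Complex.im_ofReal_mul, Complex.I_im, mul_one]⟩
  simp only [flyby, lcState, flybyMeridian, h1, state]
  rw [add_halves]

/-- A curve of states does not accumulate in the regular part of the energy manifold when its
gnomonic radius tends to `0` or to infinity. -/
theorem not_mapClusterPt (hβ : β ^ 2 = b ^ 2) {l : Filter ℝ} {X : ℝ → ℝ × ℂ × ℝ × ℝ} {ρ : ℝ → ℝ}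
    (hX : ∀ n, (X n).1 = S.param b c (ρ n)) (hl : Tendsto ρ l (𝓝 0) ∨ Tendsto ρ l atTop) :
    ∀ p ∈ S.energyManifold β γ h \ S.collisionSet β γ h, ¬ MapClusterPt p l X := by
  intro p hp hcl
  have h1 : MapClusterPt p.1 l (fun n => S.param b c (ρ n)) := by
    have := hcl.continuousAt_comp (f := Prod.fst) continuous_fst.continuousAt
    simpa only [Function.comp_def, hX] using this
  rcases hl with hl | hl
  · have h2 : Tendsto (fun n => S.param b c (ρ n)) l (𝓝 S.rN) := by
      rw [← param_zero (S := S) (b := b) (c := c)]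
      exact (continuous_param.tendsto 0).comp hl
    have h3 : p.1 = S.rN := by
      by_contra hne
      exact h1.clusterPt.neBot.ne (disjoint_iff.1 ((disjoint_nhds_nhds.2 hne).mono_right h2))
    exact hp.2 ⟨hp.1, h3⟩
  · have h2 : Tendsto (fun n => S.param b c (ρ n)) l (𝓝 (S.equator b c)) := by
      have h4 : Tendsto (fun n => ρ n / c) l atTop := hl.atTop_div_const H.c_pos
      have h5 := (tendsto_nhdsWithin_iff.1 Real.tendsto_arctan_atTop).1.comp h4
      exact (h5.const_mul _).const_add _
    have h3 : p.1 = S.equator b c := by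
      by_contra hne
      exact h1.clusterPt.neBot.ne (disjoint_iff.1 ((disjoint_nhds_nhds.2 hne).mono_right h2))
    exact H.fst_ne_equator hβ hp.1 h3

end IsSpindle

end SphericalSurface

/-! ### The radial solution leaves isolating sets -/

theorem ordConnected_one_sub_pos (k : ℝ) : OrdConnected {n : ℝ | 0 < 1 - k * n ^ 2} := by
  refine ⟨fun n₁ h₁ n₂ h₂ n hn => ?_⟩
  simp only [mem_ofPred_eq] at *
  have h3 : n ^ 2 ≤ max (n₁ ^ 2) (n₂ ^ 2) := by
    rcases le_total 0 n with h | h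
    · exact le_max_of_le_right (by nlinarith [hn.2])
    · exact le_max_of_le_left (by nlinarith [hn.1])
  rcases le_total k 0 with hk | hk
  · nlinarith [sq_nonneg n]
  · rcases le_max_iff.1 h3 with h | h <;> nlinarith

/-- At the far end of its domain, the radius of a radial solution tends to `0` or to infinity. -/
theorem exists_radial_end (k : ℝ) {a : ℝ} (ha : 0 < a) : ∃ l : Filter ℝ, l.NeBot ∧
    (∀ n₀, 0 < n₀ → 0 < 1 - k * n₀ ^ 2 → ∀ᶠ n in l, n₀ ≤ n ∧ 0 < n ∧ 0 < 1 - k * n ^ 2) ∧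
    (Tendsto (fun n => ((1 - k * n ^ 2)⁻¹ * (2 * n * a)) ^ 2) l (𝓝 0) ∨
      Tendsto (fun n => ((1 - k * n ^ 2)⁻¹ * (2 * n * a)) ^ 2) l atTop) := by
  rcases lt_trichotomy k 0 with hk | rfl | hk
  · refine ⟨atTop, inferInstance, fun n₀ h0 _ => ?_, Or.inl ?_⟩
    · filter_upwards [eventually_ge_atTop n₀] with n hn
      exact ⟨hn, h0.trans_le hn, by nlinarith [sq_nonneg n]⟩
    · have h1 : Tendsto (fun n : ℝ => 2 * a / (-k) * n⁻¹) atTop (𝓝 0) := by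
        simpa using tendsto_inv_atTop_zero.const_mul (2 * a / (-k))
      have h2 : Tendsto (fun n : ℝ => (1 - k * n ^ 2)⁻¹ * (2 * n * a)) atTop (𝓝 0) := by
        refine tendsto_of_tendsto_of_tendsto_of_le_of_le' tendsto_const_nhds h1 ?_ ?_
        · filter_upwards [eventually_gt_atTop 0] with n hn
          have : 0 < 1 - k * n ^ 2 := by nlinarith [sq_nonneg n]
          positivity
        · filter_upwards [eventually_gt_atTop 0] with n hn
          have : 0 < 1 - k * n ^ 2 := by nlinarith [sq_nonneg n]
          have hk' : 0 < -k := by linarith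
          rw [← div_eq_inv_mul, ← div_eq_mul_inv, div_div, div_le_div_iff₀ this (by positivity)]
          nlinarith [mul_pos ha hn]
      simpa using h2.pow 2
  · refine ⟨atTop, inferInstance, fun n₀ h0 _ => ?_, Or.inr ?_⟩
    · filter_upwards [eventually_ge_atTop n₀] with n hn
      exact ⟨hn, h0.trans_le hn, by simp⟩
    · have h1 : Tendsto (fun n : ℝ => 2 * n * a) atTop atTop :=
        (tendsto_id.const_mul_atTop two_pos).atTop_mul_const ha
      simpa [Function.comp_def] using (tendsto_pow_atTop two_ne_zero).comp h1
  · have hs : 0 < √k := Real.sqrt_pos.2 hk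
    have hkk : √k ^ 2 = k := Real.sq_sqrt hk.le
    have hpos : ∀ n, 0 < n → n < 1 / √k → 0 < 1 - k * n ^ 2 := fun n h0 h1 => by
      have h2 : n * √k < 1 := (lt_div_iff₀ hs).1 h1
      have h3 : 0 < n * √k := by positivity
      rw [← hkk]
      nlinarith
    refine ⟨𝓝[<] (1 / √k), inferInstance, fun n₀ h0 h1 => ?_, Or.inr ?_⟩
    · have h2 : n₀ < 1 / √k := by
        rw [lt_div_iff₀ hs]
        rw [← hkk] at h1
        nlinarith [mul_pos h0 hs]
      filter_upwards [Ioo_mem_nhdsLT h2] with n hn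
      exact ⟨hn.1.le, h0.trans hn.1, hpos n (h0.trans hn.1) hn.2⟩
    · have h1 : Tendsto (fun n : ℝ => 1 - k * n ^ 2) (𝓝[<] (1 / √k)) (𝓝[>] 0) := by
        refine tendsto_nhdsWithin_iff.2 ⟨?_, ?_⟩
        · have : Tendsto (fun n : ℝ => 1 - k * n ^ 2) (𝓝 (1 / √k)) (𝓝 (1 - k * (1 / √k) ^ 2)) :=
            Continuous.tendsto (by fun_prop) _
          rw [div_pow, hkk, one_pow, mul_one_div_cancel hk.ne', sub_self] at this
          exact this.mono_left nhdsWithin_le_nhds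
        · have : 0 < 1 / √k := by positivity
          filter_upwards [Ioo_mem_nhdsLT this] with n hn using hpos n hn.1 hn.2
      have h2 : Tendsto (fun n : ℝ => 2 * n * a) (𝓝[<] (1 / √k)) (𝓝 (2 * (1 / √k) * a)) :=
        (Continuous.tendsto (by fun_prop) _).mono_left nhdsWithin_le_nhds
      have h3 := (tendsto_inv_nhdsGT_zero.comp h1).atTop_mul_pos (by positivity) h2
      exact (tendsto_pow_atTop two_ne_zero).comp h3

namespace SphericalSurface

variable {S : SphericalSurface} {b c β γ h σ δ n : ℝ}

namespace IsSpindle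

variable (H : S.IsSpindle b c)
include H

theorem flyby_zero_fst (n : ℝ) : (S.flyby b c γ h σ 0 n).1 =
    S.param b c (((1 - h / 2 * n ^ 2)⁻¹ * (2 * n * √(γ / 2))) ^ 2) := by
  rw [flyby_fst, flybyPos_zero H.c_pos]
  congr 1
  simp only [Complex.normSq_mul, Complex.normSq_ofReal, Complex.normSq_I]
  ring

/-- The radial solution leaves an isolating set before and after the collision. -/
theorem exists_flyby_notMem (hβ : β ^ 2 = b ^ 2) (hγ : 0 < γ) (hσ : σ ^ 2 = 1)
    {B : Set (ℝ × ℂ × ℝ × ℝ)}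
    (hB : Isolates (S.energyManifold β γ h) (S.collisionSet β γ h) (S.keplerField β γ) B) :
    (∃ n, 0 < n ∧ 0 < 1 - h / 2 * n ^ 2 ∧ S.flyby b c γ h σ 0 n ∉ B) ∧
      ∃ n, n < 0 ∧ 0 < 1 - h / 2 * n ^ 2 ∧ S.flyby b c γ h σ 0 n ∉ B := by
  have hF := H.contDiffAt (h := h) hβ hγ
  have ha : 0 < √(γ / 2) := Real.sqrt_pos.2 (by positivity)
  obtain ⟨l, hl, hl1, hl2⟩ := exists_radial_end (h / 2) ha
  have hopen : IsOpen {n : ℝ | 0 < 1 - h / 2 * n ^ 2} := isOpen_lt continuous_const (by fun_prop)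
  have hord := ordConnected_one_sub_pos (h / 2)
  have hne : (0 : ℝ) ∈ {n : ℝ | 0 < 1 - h / 2 * n ^ 2} := by simp
  have hcont : ContinuousAt (fun n : ℝ => ((1 - h / 2 * n ^ 2)⁻¹ * (2 * n * √(γ / 2))) ^ 2) 0 :=
    ((ContinuousAt.inv₀ (by fun_prop) (by simp)).mul (by fun_prop)).pow 2
  have h0 : Tendsto (fun n : ℝ => ((1 - h / 2 * n ^ 2)⁻¹ * (2 * n * √(γ / 2))) ^ 2) (𝓝 0) (𝓝 0) := by
    simpa [ContinuousAt] using hcont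
  have horb : ∀ J ⊆ {n : ℝ | 0 < 1 - h / 2 * n ^ 2}, 0 ∉ J → ∀ n₁ n₂, Ioo n₁ n₂ ⊆ J →
      IsOrbit (S.energyManifold β γ h) (S.collisionSet β γ h) (S.keplerField β γ)
      (S.flyby b c γ h σ 0)
      (lcSpeed b c (flybyEnergy c γ h 0) (0 : ℝ) (flybyMom c γ h 0 * Complex.I)) n₁ n₂ :=
    fun J hJ hJ0 n₁ n₂ hI => H.isOrbit_flyby hβ hσ (by rwa [flybyMom_zero])
      (fun n hn => by rw [flybyEnergy_zero H.c_pos]; exact hJ (hI hn))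
      fun n hn => Or.inr fun h => hJ0 (h ▸ hI hn)
  constructor
  · have hJ : (Ioi 0 ∩ {n : ℝ | 0 < 1 - h / 2 * n ^ 2}).Nonempty :=
      Filter.nonempty_of_mem (f := 𝓝[>] 0)
        (inter_mem self_mem_nhdsWithin (mem_nhdsWithin_of_mem_nhds (hopen.mem_nhds hne)))
    refine (exists_notMem_of_isolates hF hB (J := Ioi 0 ∩ {n | 0 < 1 - h / 2 * n ^ 2})
      (isOpen_Ioi.inter hopen) (ordConnected_Ioi.inter hord) hJ
      (horb _ inter_subset_right fun h => lt_irrefl (0 : ℝ) h.1) (l₁ := 𝓝[>] 0) (l₂ := l) ?_ ?_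
      (H.not_mapClusterPt hβ H.flyby_zero_fst (Or.inl (h0.mono_left nhdsWithin_le_nhds)))
      (H.not_mapClusterPt hβ H.flyby_zero_fst hl2)).imp
        fun n hn => ⟨hn.1.1, hn.1.2, hn.2⟩
    · intro n₀ hn₀
      filter_upwards [Ioo_mem_nhdsGT hn₀.1, mem_nhdsWithin_of_mem_nhds (hopen.mem_nhds hne)]
        with n h1 h2 using ⟨h1.2.le, h1.1, h2⟩
    · intro n₀ hn₀
      filter_upwards [hl1 n₀ hn₀.1 hn₀.2] with n h1 using ⟨h1.1, h1.2⟩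
  · have hJ : (Iio 0 ∩ {n : ℝ | 0 < 1 - h / 2 * n ^ 2}).Nonempty :=
      Filter.nonempty_of_mem (f := 𝓝[<] 0)
        (inter_mem self_mem_nhdsWithin (mem_nhdsWithin_of_mem_nhds (hopen.mem_nhds hne)))
    refine (exists_notMem_of_isolates hF hB (J := Iio 0 ∩ {n | 0 < 1 - h / 2 * n ^ 2})
      (isOpen_Iio.inter hopen) (ordConnected_Iio.inter hord) hJ
      (horb _ inter_subset_right fun h => lt_irrefl (0 : ℝ) h.1) (l₁ := l.map Neg.neg)
      (l₂ := 𝓝[<] 0) ?_ ?_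
      (H.not_mapClusterPt hβ H.flyby_zero_fst ?_)
      (H.not_mapClusterPt hβ H.flyby_zero_fst (Or.inl (h0.mono_left nhdsWithin_le_nhds)))).imp
        fun n hn => ⟨hn.1.1, hn.1.2, hn.2⟩
    · intro n₀ hn₀
      rw [eventually_map]
      filter_upwards [hl1 (-n₀) (neg_pos.2 hn₀.1) (by rw [neg_sq]; exact hn₀.2)] with n h1
      exact ⟨by linarith [h1.1], neg_neg_of_pos h1.2.1, by
        change 0 < 1 - h / 2 * (-n) ^ 2; rw [neg_sq]; exact h1.2.2⟩
    · intro n₀ hn₀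
      filter_upwards [Ioo_mem_nhdsLT hn₀.1, mem_nhdsWithin_of_mem_nhds (hopen.mem_nhds hne)]
        with n h1 h2 using ⟨h1.1.le, h1.2, h2⟩
    · rw [tendsto_map'_iff, tendsto_map'_iff]
      refine hl2.imp ?_ ?_ <;> intro h1 <;> refine h1.congr fun n => ?_ <;>
        simp only [Function.comp_apply] <;> ring

end IsSpindle

end SphericalSurface

/-! ### Flybys cross the block -/

namespace SphericalSurface

variable {S : SphericalSurface} {b c β γ h σ : ℝ}

namespace IsSpindle

variable (H : S.IsSpindle b c)
include H

/-- Along a compact interval of parameters, an open condition on the radial solution carries over to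
the flybys that are close to it. -/
theorem eventually_flyby (hγ : 0 < γ) {n₁ n₂ : ℝ} {P : ℝ × ℂ × ℝ × ℝ → Prop}
    (h1 : ∀ n ∈ Icc n₁ n₂, 0 < 1 - h / 2 * n ^ 2) (h0 : ∀ n ∈ Icc n₁ n₂, n ≠ 0)
    (hP : ∀ n ∈ Icc n₁ n₂, ∀ᶠ p in 𝓝 (S.flyby b c γ h σ 0 n), P p) :
    ∀ᶠ δ in 𝓝[>] 0, ∀ n ∈ Icc n₁ n₂, P (S.flyby b c γ h σ δ n) := by
  refine Filter.Eventually.filter_mono nhdsWithin_le_nhds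
    (isCompact_Icc.eventually_forall_of_forall_eventually fun n hn => ?_)
  have hc : ContinuousAt (fun x : ℝ × ℝ => S.flyby b c γ h σ x.1 x.2) (0, n) :=
    H.continuousAt_flyby (by rw [flybyMom_zero]; exact Real.sqrt_pos.2 (by positivity))
      (by rw [flybyEnergy_zero H.c_pos]; exact h1 n hn) (Or.inr (h0 n hn))
  exact hc.eventually (hP n hn)

/-- Suppose that the radial solution enters an isolating block at the parameter `ns` and stays in its
interior until the collision. Then nearby flybys cross the block and leave it close to the meridian
on which the continuation of the radial solution runs. -/
theorem exists_crossing_flyby (hβ : β ^ 2 = b ^ 2) (hγ : 0 < γ) (hσ : σ ^ 2 = 1)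
    {B : Set (ℝ × ℂ × ℝ × ℝ)}
    (hB : IsIsolatingBlock 2 (S.energyManifold β γ h) (S.collisionSet β γ h) (S.keplerField β γ) B)
    (hiso : Isolates (S.energyManifold β γ h) (S.collisionSet β γ h) (S.keplerField β γ) B)
    {ns : ℝ} (hns : ns < 0) (hns1 : 0 < 1 - h / 2 * ns ^ 2)
    (hx : S.flyby b c γ h σ 0 ns ∈ relBoundary (S.energyManifold β γ h) B)
    (hint : ∀ n ∈ Ioo ns 0, B ∈ 𝓝[S.energyManifold β γ h] (S.flyby b c γ h σ 0 n))
    {U : Set (ℝ × ℂ × ℝ × ℝ)} (hU : U ∈ 𝓝 (S.flyby b c γ h σ 0 ns)) {W : Set ℂ}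
    (hW : W ∈ 𝓝 (Complex.exp (((σ * (2 / b) * Real.pi : ℝ) : ℂ) * Complex.I))) :
    ∃ x ∈ U, x ∈ ingress (S.energyManifold β γ h) (S.collisionSet β γ h) (S.keplerField β γ) B ∧
      x ∉ asymptoticIn (S.energyManifold β γ h) (S.collisionSet β γ h) (S.keplerField β γ) B ∧
      ∃ y, y.2.1 ∈ W ∧ FlowsTo (S.energyManifold β γ h) (S.collisionSet β γ h) (S.keplerField β γ) x
        (exitTime (S.energyManifold β γ h) (S.collisionSet β γ h) (S.keplerField β γ) B x) y := by
  set M := S.energyManifold β γ h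
  set N := S.collisionSet β γ h
  set F := S.keplerField β γ
  set X := S.flyby b c γ h σ
  have hc := H.c_pos
  have hF : ∀ p ∈ M \ N, ContDiffAt ℝ 1 F p := H.contDiffAt hβ hγ
  have hBc := hB.isCompact.isClosed
  have hw0 : 0 < √(γ / 2) := Real.sqrt_pos.2 (by positivity)
  have hopen : IsOpen {n : ℝ | 0 < 1 - h / 2 * n ^ 2} := isOpen_lt continuous_const (by fun_prop)
  have hord := ordConnected_one_sub_pos (h / 2)
  obtain ⟨n₁, hn₁0, hn₁, hn₁B⟩ := (H.exists_flyby_notMem hβ hγ hσ hiso).1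
  -- An interval around the crossing parameter.
  obtain ⟨a, ha, haI⟩ := exists_Ioc_subset_of_mem_nhds (hopen.mem_nhds hns1) (exists_lt ns)
  have hI : ∀ n ∈ Ioc a n₁, 0 < 1 - h / 2 * n ^ 2 := fun n hn => by
    rcases le_total n ns with h1 | h1
    · exact haI ⟨hn.1, h1⟩
    · exact hord.out hns1 hn₁ ⟨h1, hn.2⟩
  have hmom : 0 < flybyMom c γ h 0 := by rwa [flybyMom_zero]
  have hX0 : IsOrbit M N F (X 0) (lcSpeed b c (flybyEnergy c γ h 0) (0 : ℝ)
      (flybyMom c γ h 0 * Complex.I)) a 0 :=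
    H.isOrbit_flyby hβ hσ hmom
      (fun n hn => by rw [flybyEnergy_zero hc]; exact hI n ⟨hn.1, hn.2.le.trans hn₁0.le⟩)
      fun n hn => Or.inr hn.2.ne
  have hreg : ∀ n ∈ Ioo a 0, ∃ (e : ℝ × ℂ × ℝ × ℝ → ℝ × ℝ) (e' : ℝ × ℂ × ℝ × ℝ →L[ℝ] ℝ × ℝ),
      (∀ᶠ q in 𝓝 (X 0 n), q ∈ M ↔ e q = 0) ∧ HasStrictFDerivAt e e' (X 0 n) ∧ e'.range = ⊤ := by
    intro n hn
    have h1 := (hX0.mem n hn).1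
    refine H.exists_defining_map hβ hγ h1 (mem_Ioo_of_mem_diff hγ (hX0.mem n hn)).1.1 ?_
    exact H.param_lt_equator _
  obtain ⟨e, e', he, hee, he'⟩ := hreg ns ⟨ha, hns⟩
  have hdim : Module.finrank ℝ (ℝ × ℝ) = 2 := by simp
  have hMB : ∀ n ∈ Ioo ns 0, X 0 n ∈ B := fun n hn =>
    mem_of_mem_nhdsWithin (hX0.mem n ⟨ha.trans hn.1, hn.2⟩).1 (hint n hn)
  obtain ⟨κ, V, hVo, hxV, hκ0, hκ, hκb, hκB⟩ := IsIsolatingBlock.exists_crossing (H := ℝ × ℝ) hF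
    (by rwa [hdim]) hX0 ⟨ha, hns⟩ hx
    (by filter_upwards [Ioo_mem_nhdsGT hns] with n hn using hMB n hn) he hee he'
  -- Parameters `nm < ns < np` between which the orbit crosses the boundary.
  have h1 : ∀ᶠ n in 𝓝 ns, X 0 n ∈ V ∩ interior U ∧ n ∈ Ioo a 0 :=
    ((hX0.deriv ns ⟨ha, hns⟩).continuousAt.eventually ((hVo.inter isOpen_interior).mem_nhds
      ⟨hxV, mem_interior_iff_mem_nhds.2 hU⟩)).and (Ioo_mem_nhds ha hns)
  obtain ⟨ε, hε, h2⟩ := Metric.eventually_nhds_iff_ball.1 h1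
  have h3 : ∀ n ∈ Icc (ns - ε / 2) (ns + ε / 2), X 0 n ∈ V ∩ interior U ∧ n ∈ Ioo a 0 :=
    fun n hn => h2 n (by rw [Real.ball_eq_Ioo]; exact ⟨by linarith [hn.1], by linarith [hn.2]⟩)
  set nm := ns - ε / 2 with hnm
  set np := ns + ε / 2 with hnp
  have hnms : nm < ns := by linarith
  have hsnp : ns < np := by linarith
  have ham : a < nm := (h3 nm ⟨le_rfl, by linarith⟩).2.1
  have hnp0 : np < 0 := (h3 np ⟨by linarith, le_rfl⟩).2.2
  have hmono := hX0.strictMonoOn_comp hκ ham hnp0 (fun n hn => (h3 n hn).1.1)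
  have hκm : κ (X 0 nm) < 0 := by
    simpa [hκ0] using hmono ⟨le_rfl, by linarith⟩ ⟨hnms.le, hsnp.le⟩ hnms
  have hκp : 0 < κ (X 0 np) := by
    simpa [hκ0] using hmono ⟨hnms.le, hsnp.le⟩ ⟨by linarith, le_rfl⟩ hsnp
  -- Close to the collision the flybys are in a polar cap that is contained in the block.
  obtain ⟨ρ₁, hρ₁, hcap⟩ := H.exists_cap_subset hβ hiso.1
  have h4 : ∀ᶠ x : ℝ × ℝ in 𝓝 (0, 0), Complex.normSq (flybyPos c γ h x.1 x.2) < ρ₁ := by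
    have h5 : ContinuousAt (fun x : ℝ × ℝ => flybyPos c γ h x.1 x.2) (0, 0) :=
      continuousAt_flybyPos hc (by simp)
    have h6 : ContinuousAt (fun x : ℝ × ℝ => Complex.normSq (flybyPos c γ h x.1 x.2)) (0, 0) :=
      Complex.continuous_normSq.continuousAt.comp h5
    refine h6.eventually (gt_mem_nhds ?_)
    simpa [flybyPos] using hρ₁
  rw [nhds_prod_eq] at h4
  obtain ⟨Pδ, hPδ, Pn, hPn, h4⟩ := eventually_prod_iff.1 h4
  obtain ⟨ε', hε', h5⟩ := Metric.eventually_nhds_iff_ball.1 hPn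
  set η := min (ε' / 2) (min (n₁ / 2) (-np / 2)) with hη
  have hη0 : 0 < η := lt_min (by linarith) (lt_min (by linarith) (by linarith))
  have hηn₁ : η < n₁ := by
    have : η ≤ n₁ / 2 := (min_le_right _ _).trans (min_le_left _ _)
    linarith
  have hηnp : np < -η := by
    have : η ≤ -np / 2 := (min_le_right _ _).trans (min_le_right _ _)
    linarith
  have hηε : η < ε' := by
    have : η ≤ ε' / 2 := min_le_left _ _
    linarith
  -- The parameters `δ` of the flybys that are close enough to the radial solution.
  have g1 := H.eventually_flyby (σ := σ) hγ (n₁ := nm) (n₂ := np) (P := fun p => p ∈ V ∩ interior U)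
    (fun n hn => hI n ⟨ham.trans_le hn.1, by linarith [hn.2]⟩) (fun n hn => by linarith [hn.2])
    (fun n hn => (hVo.inter isOpen_interior).mem_nhds (h3 n hn).1)
  have hκc : ∀ n ∈ Icc nm np, ContinuousAt κ (X 0 n) := fun n hn =>
    (hκ _ (h3 n hn).1.1).1.continuousAt
  have g2 := H.eventually_flyby (σ := σ) hγ (n₁ := nm) (n₂ := nm) (P := fun p => κ p < 0)
    (fun n hn => hI n ⟨ham.trans_le hn.1, by linarith [hn.2]⟩) (fun n hn => by linarith [hn.2])
    (fun n hn => by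
      rw [le_antisymm hn.2 hn.1]
      exact (hκc nm ⟨le_rfl, by linarith⟩).eventually (gt_mem_nhds hκm))
  have g3 := H.eventually_flyby (σ := σ) hγ (n₁ := np) (n₂ := np) (P := fun p => 0 < κ p)
    (fun n hn => hI n ⟨by linarith [hn.1], by linarith [hn.2]⟩) (fun n hn => by linarith [hn.2])
    (fun n hn => by
      rw [le_antisymm hn.2 hn.1]
      exact (hκc np ⟨by linarith, le_rfl⟩).eventually (lt_mem_nhds hκp))
  have g4 := H.eventually_flyby (σ := σ) hγ (n₁ := np) (n₂ := -η) (P := fun p => p ∈ M → p ∈ B)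
    (fun n hn => hI n ⟨by linarith [hn.1], by linarith [hn.2]⟩) (fun n hn => by linarith [hn.2])
    (fun n hn => eventually_nhdsWithin_iff.1
      (hint n ⟨hsnp.trans_le hn.1, by linarith [hn.2]⟩))
  have g5 := H.eventually_flyby (σ := σ) hγ (n₁ := η) (n₂ := n₁) (P := fun p => p.2.1 ∈ W)
    (fun n hn => hI n ⟨by linarith [hn.1], hn.2⟩) (fun n hn => by linarith [hn.1])
    (fun n hn => by
      have h6 := H.flyby_zero_of_pos (σ := σ) hγ (show 0 < n by linarith [hn.1])
        (hI n ⟨by linarith [hn.1], hn.2⟩)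
      exact (show Continuous fun p : ℝ × ℂ × ℝ × ℝ => p.2.1 by fun_prop).continuousAt.eventually
        (by dsimp only; rw [h6]; exact hW))
  have g6 := H.eventually_flyby (σ := σ) hγ (n₁ := n₁) (n₂ := n₁) (P := fun p => p ∉ B)
    (fun n hn => hI n ⟨by linarith [hn.1], hn.2⟩) (fun n hn => by linarith [hn.1])
    (fun n hn => by
      rw [le_antisymm hn.2 hn.1]
      exact hBc.isOpen_compl.mem_nhds hn₁B)
  have g7 : ∀ᶠ δ in 𝓝[>] 0, Pδ δ := hPδ.filter_mono nhdsWithin_le_nhds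
  have g8 : ∀ᶠ δ in 𝓝[>] 0, 0 < flybyMom c γ h δ :=
    ((continuous_flybyMom hc).continuousAt.eventually (lt_mem_nhds hmom)).filter_mono
      nhdsWithin_le_nhds
  obtain ⟨n₂, hn₂, hn₂I⟩ := exists_Ico_subset_of_mem_nhds (hopen.mem_nhds hn₁) (exists_gt n₁)
  obtain ⟨a', ha', ham'⟩ := exists_between ham
  obtain ⟨n₂', hn₂', hn₂''⟩ := exists_between hn₂
  have g9 : ∀ᶠ δ in 𝓝[>] 0, ∀ n ∈ Icc a' n₂', 0 < 1 - flybyEnergy c γ h δ * n ^ 2 := by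
    refine Filter.Eventually.filter_mono nhdsWithin_le_nhds
      (isCompact_Icc.eventually_forall_of_forall_eventually fun n hn => ?_)
    have h6 : Continuous fun x : ℝ × ℝ => 1 - flybyEnergy c γ h x.1 * x.2 ^ 2 := by
      have := continuous_flybyEnergy (γ := γ) (h := h) hc
      fun_prop
    refine h6.continuousAt.eventually (lt_mem_nhds ?_)
    dsimp only
    rw [flybyEnergy_zero hc]
    rcases le_total n n₁ with h7 | h7
    · exact hI n ⟨ha'.trans_le hn.1, h7⟩
    · exact hn₂I ⟨h7, hn.2.trans_lt hn₂''⟩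
  obtain ⟨δ, ⟨⟨⟨⟨⟨⟨⟨⟨⟨g1, g2⟩, g3⟩, g4⟩, g5⟩, g6⟩, g7⟩, g8⟩, g9⟩, hδ⟩⟩ :=
    (((((((((g1.and g2).and g3).and g4).and g5).and g6).and g7).and g8).and g9).and
      self_mem_nhdsWithin).exists
  replace g2 := g2 nm ⟨le_rfl, le_rfl⟩
  replace g3 := g3 np ⟨le_rfl, le_rfl⟩
  replace g6 := g6 n₁ ⟨le_rfl, le_rfl⟩
  have hXδ : IsOrbit M N F (X δ) (lcSpeed b c (flybyEnergy c γ h δ) δ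
      (flybyMom c γ h δ * Complex.I)) a' n₂' :=
    H.isOrbit_flyby hβ hσ g8 (fun n hn => g9 n ⟨hn.1.le, hn.2.le⟩) fun n hn => Or.inl hδ
  have hcont : ContinuousOn (X δ) (Icc nm n₁) := fun n hn =>
    (hXδ.deriv n ⟨ham'.trans_le hn.1, hn.2.trans_lt hn₂'⟩).continuousAt.continuousWithinAt
  have hmonoδ := hXδ.strictMonoOn_comp hκ ham' (by linarith : np < n₂') (fun n hn => (g1 n hn).1)
  -- The parameter of entry.
  obtain ⟨nδ, hnδ, hκδ⟩ : ∃ nδ ∈ Ioo nm np, κ (X δ nδ) = 0 := by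
    have h6 : ContinuousOn (κ ∘ X δ) (Icc nm np) := fun n hn =>
      (ContinuousAt.comp (hκ _ (g1 n hn).1).1.continuousAt
        (hXδ.deriv n ⟨ham'.trans_le hn.1, by linarith [hn.2]⟩).continuousAt).continuousWithinAt
    exact intermediate_value_Ioo (by linarith : nm ≤ np) h6 ⟨g2, g3⟩
  have hnδI : nδ ∈ Ioo a' n₂' := ⟨by linarith [hnδ.1], by linarith [hnδ.2]⟩
  have hmem : ∀ n ∈ Icc nm n₁, X δ n ∈ M := fun n hn =>
    (hXδ.mem n ⟨ham'.trans_le hn.1, hn.2.trans_lt hn₂'⟩).1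
  have hxb : X δ nδ ∈ relBoundary M B :=
    hκb _ ⟨hmem nδ ⟨hnδ.1.le, by linarith [hnδ.2]⟩, (g1 nδ ⟨hnδ.1.le, hnδ.2.le⟩).1⟩ hκδ
  have hinB : ∀ n ∈ Icc nδ η, X δ n ∈ B := fun n hn => by
    have hM := hmem n ⟨hnδ.1.le.trans hn.1, by linarith [hn.2]⟩
    rcases le_or_gt n np with h6 | h6
    · have h7 : n ∈ Icc nm np := ⟨hnδ.1.le.trans hn.1, h6⟩
      refine (hκB _ ⟨hM, (g1 n h7).1⟩).2 ?_
      rw [← hκδ]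
      exact hmonoδ.monotoneOn ⟨hnδ.1.le, hnδ.2.le⟩ h7 hn.1
    rcases le_or_gt n (-η) with h7 | h7
    · exact g4 n ⟨h6.le, h7⟩ hM
    · refine hcap _ hM (H.param_strictMono (h4 g7 (h5 n ?_)))
      rw [Real.ball_eq_Ioo]
      exact ⟨by linarith, by linarith [hn.2]⟩
  obtain ⟨ne, hne, hne1, hne2⟩ := exists_first_exit hBc hηn₁.le
    (hcont.mono (Icc_subset_Icc_left (by linarith))) (hinB η ⟨by linarith [hnδ.2], le_rfl⟩) g6
  have hfl := hXδ.flowsTo_exitTime (n₁ := ne) hF hnδI.1 (by linarith [hnδ.2, hne.1])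
    (by linarith [hne.2]) (fun n hn => by
      rcases le_total n η with h6 | h6
      · exact hinB n ⟨hn.1, h6⟩
      · exact hne1 n ⟨h6, hn.2⟩) hne2
  refine ⟨X δ nδ, interior_subset (g1 nδ ⟨hnδ.1.le, hnδ.2.le⟩).2, ?_, hfl.1, X δ ne,
    g5 ne ⟨hne.1, hne.2.le⟩, hfl.2⟩
  rw [hXδ.mem_ingress_iff hF hnδI hxb]
  filter_upwards [Ioo_mem_nhdsLT hnδ.1] with n hn hnB
  have h7 : n ∈ Icc nm np := ⟨hn.1.le, hn.2.le.trans hnδ.2.le⟩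
  have h8 := (hκB _ ⟨hmem n ⟨hn.1.le, by linarith [hn.2, hnδ.2]⟩, (g1 n h7).1⟩).1 hnB
  rw [← hκδ] at h8
  exact (hmonoδ h7 ⟨hnδ.1.le, hnδ.2.le⟩ hn.2).not_ge h8

end IsSpindle

end SphericalSurface

/-! ### Block regularizability makes `2 / b` an integer -/

namespace SphericalSurface

variable {S : SphericalSurface} {b c β γ h σ : ℝ}

namespace IsSpindle

variable (H : S.IsSpindle b c)
include H

theorem isOrbit_flyby_zero (hβ : β ^ 2 = b ^ 2) (hγ : 0 < γ) (hσ : σ ^ 2 = 1) {n₁ n₂ : ℝ}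
    (hn : ∀ n ∈ Ioo n₁ n₂, 0 < 1 - h / 2 * n ^ 2) (h0 : ∀ n ∈ Ioo n₁ n₂, n ≠ 0) :
    IsOrbit (S.energyManifold β γ h) (S.collisionSet β γ h) (S.keplerField β γ)
      (S.flyby b c γ h σ 0)
      (lcSpeed b c (flybyEnergy c γ h 0) (0 : ℝ) (flybyMom c γ h 0 * Complex.I)) n₁ n₂ :=
  H.isOrbit_flyby hβ hσ (by rw [flybyMom_zero]; exact Real.sqrt_pos.2 (by positivity))
    (fun n hn' => by rw [flybyEnergy_zero H.c_pos]; exact hn n hn') fun n hn => Or.inr (h0 n hn)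

/-- The radial solution has a last entry into an isolating block before the collision, and is in the
interior of the block from then on. -/
theorem exists_last_entry (hβ : β ^ 2 = b ^ 2) (hγ : 0 < γ) {B : Set (ℝ × ℂ × ℝ × ℝ)}
    (hB : IsIsolatingBlock 2 (S.energyManifold β γ h) (S.collisionSet β γ h) (S.keplerField β γ) B)
    (hiso : Isolates (S.energyManifold β γ h) (S.collisionSet β γ h) (S.keplerField β γ) B) :
    ∃ ns < 0, 0 < 1 - h / 2 * ns ^ 2 ∧
      S.flyby b c γ h 1 0 ns ∈ ingress (S.energyManifold β γ h) (S.collisionSet β γ h)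
        (S.keplerField β γ) B ∧
      ∀ n ∈ Ioo ns 0, B ∈ 𝓝[S.energyManifold β γ h] (S.flyby b c γ h 1 0 n) := by
  set M := S.energyManifold β γ h
  set X := S.flyby b c γ h 1 0
  have hF := H.contDiffAt (h := h) hβ hγ
  have hopen : IsOpen {n : ℝ | 0 < 1 - h / 2 * n ^ 2} := isOpen_lt continuous_const (by fun_prop)
  have hord := ordConnected_one_sub_pos (h / 2)
  have h0 : (0 : ℝ) ∈ {n : ℝ | 0 < 1 - h / 2 * n ^ 2} := by simp
  have hdim : Module.finrank ℝ (ℝ × ℝ) = 2 := by simp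
  obtain ⟨n₂, hn₂0, hn₂, hn₂B⟩ := (H.exists_flyby_notMem hβ hγ (one_pow 2) hiso).2
  obtain ⟨a, ha, haI⟩ := exists_Ioc_subset_of_mem_nhds (hopen.mem_nhds hn₂) (exists_lt n₂)
  have hI : ∀ n ∈ Ioo a 0, 0 < 1 - h / 2 * n ^ 2 := fun n hn => by
    rcases le_total n n₂ with h1 | h1
    · exact haI ⟨hn.1, h1⟩
    · exact hord.out hn₂ h0 ⟨h1, hn.2.le⟩
  have hX := H.isOrbit_flyby_zero (σ := 1) hβ hγ (one_pow 2) hI fun n hn => hn.2.ne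
  have hcont : ∀ n ∈ Ioo a 0, ContinuousAt X n := fun n hn => (hX.deriv n hn).continuousAt
  obtain ⟨ρ₁, hρ₁, hcap⟩ := H.exists_cap_subset hβ hiso.1
  obtain ⟨η, hη, hηB⟩ : ∃ η > 0, ∀ n ∈ Ioo (-η) 0, n ∈ Ioo a 0 → X n ∈ B := by
    have h1 : ContinuousAt (fun n : ℝ => ((1 - h / 2 * n ^ 2)⁻¹ * (2 * n * √(γ / 2))) ^ 2) 0 :=
      ((ContinuousAt.inv₀ (by fun_prop) (by simp)).mul (by fun_prop)).pow 2
    obtain ⟨η, hη, h2⟩ := Metric.eventually_nhds_iff_ball.1 (h1.eventually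
      (gt_mem_nhds (by simpa using hρ₁ : _ < ρ₁)))
    refine ⟨η, hη, fun n hn hna => hcap _ (hX.mem n hna).1 ?_⟩
    rw [H.flyby_zero_fst]
    refine H.param_strictMono (h2 n ?_)
    rw [Real.ball_eq_Ioo]
    exact ⟨by linarith [hn.1], by linarith [hn.2]⟩
  have hηn₂ : n₂ ≤ -η := by
    by_contra! hlt
    exact hn₂B (hηB n₂ ⟨hlt, hn₂0⟩ ⟨ha, hn₂0⟩)
  -- Backwards from the collision, `-m` is the first parameter at which the curve leaves the block.
  obtain ⟨m, hm, hm1, hm2⟩ := exists_first_exit hB.isCompact.isClosed (X := fun n => X (-n))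
    (a := η / 2) (b := -n₂) (by linarith)
    (fun n hn => ((hcont (-n) ⟨by linarith [hn.2], by linarith [hn.1]⟩).comp
      continuous_neg.continuousAt).continuousWithinAt)
    (hηB _ ⟨by linarith, by linarith⟩ ⟨by linarith, by linarith⟩) (by simpa using hn₂B)
  have hmI : -m ∈ Ioo a 0 := ⟨by linarith [hm.2], by linarith [hm.1]⟩
  have hin : ∀ n ∈ Ico (-m) 0, X n ∈ B := fun n hn => by
    rcases le_or_gt n (-(η / 2)) with h1 | h1
    · simpa using hm1 (-n) ⟨by linarith, by linarith [hn.1]⟩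
    · exact hηB n ⟨by linarith, hn.2⟩ ⟨hmI.1.trans_le hn.1, hn.2⟩
  have hreg : ∀ n ∈ Ioo a 0, ∃ (e : ℝ × ℂ × ℝ × ℝ → ℝ × ℝ) (e' : ℝ × ℂ × ℝ × ℝ →L[ℝ] ℝ × ℝ),
      (∀ᶠ q in 𝓝 (X n), q ∈ M ↔ e q = 0) ∧ HasStrictFDerivAt e e' (X n) ∧ e'.range = ⊤ :=
    fun n hn => H.exists_defining_map hβ hγ (hX.mem n hn).1
      (mem_Ioo_of_mem_diff hγ (hX.mem n hn)).1.1 (H.param_lt_equator _)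
  -- A boundary point after `-m` would be a point of entry, but the curve is in the block before it.
  have henter : ∀ n ∈ Ico (-m) 0, X n ∈ relBoundary M B → ∀ᶠ n' in 𝓝[<] n, X n' ∉ B := by
    intro n hn hb
    have hna : n ∈ Ioo a 0 := ⟨hmI.1.trans_le hn.1, hn.2⟩
    obtain ⟨e, e', he, hee, he'⟩ := hreg n hna
    exact IsIsolatingBlock.eventually_notMem (H := ℝ × ℝ) hF (by rwa [hdim]) hX hna hb
      (by filter_upwards [Ioo_mem_nhdsGT hn.2] with n' hn' using hin n' ⟨hn.1.trans hn'.1.le, hn'.2⟩)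
      he hee he'
  have hmb : X (-m) ∈ relBoundary M B := by
    refine (mem_relBoundary_or_mem_nhdsWithin (hX.mem _ hmI).1
      (hin _ ⟨le_rfl, hmI.2⟩)).resolve_right fun h1 => ?_
    have h2 : ContinuousAt (fun n => X (-n)) m := (hcont _ hmI).comp continuous_neg.continuousAt
    have h3 := h2.eventually (eventually_nhdsWithin_iff.1 h1)
    have h4 : ∀ᶠ n in 𝓝 m, -n ∈ Ioo a 0 :=
      continuous_neg.continuousAt.eventually (isOpen_Ioo.mem_nhds hmI)
    obtain ⟨n, h5, h6, h7⟩ := (hm2.and_eventually ((h3.and h4).filter_mono nhdsWithin_le_nhds)).exists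
    exact h5 (h6 (hX.mem _ h7).1)
  refine ⟨-m, hmI.2, hI _ hmI, ?_, fun n hn => ?_⟩
  · exact (hX.mem_ingress_iff hF hmI hmb).2 (henter _ ⟨le_rfl, hmI.2⟩ hmb)
  · refine (mem_relBoundary_or_mem_nhdsWithin (hX.mem _ ⟨hmI.1.trans hn.1, hn.2⟩).1
      (hin _ ⟨hn.1.le, hn.2⟩)).resolve_left fun h1 => ?_
    obtain ⟨n', h2, h3⟩ := ((henter n ⟨hn.1.le, hn.2⟩ h1).and (Ioo_mem_nhdsLT hn.1)).exists
    exact h2 (hin n' ⟨h3.1.le, h3.2.trans hn.2⟩)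

/-- If the collisions are block regularizable, the two continuations of the radial solution that are
limits of flybys on either side of the pole agree, so that `4π / b` is a multiple of `2π`. -/
theorem exists_eq_two_div (hβ : β ^ 2 = b ^ 2) (hγ : 0 < γ)
    (hreg : IsBlockRegularizable 2 (S.energyManifold β γ h) (S.collisionSet β γ h)
      (S.keplerField β γ)) : ∃ m : ℕ, 0 < m ∧ b = 2 / (m : ℝ) := by
  obtain ⟨B, hB, hiso, Ψ, ⟨hΨd, hΨ⟩, -⟩ := hreg
  have hb := H.b_pos
  have hF := H.contDiffAt (h := h) hβ hγ
  obtain ⟨ns, hns, hns1, hx, hint⟩ := H.exists_last_entry hβ hγ hB hiso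
  obtain ⟨U, hUo, hxU, g, hg, hgΨ⟩ := hΨd.1 ⟨_, hx⟩
  have hgc : ContinuousAt g (S.flyby b c γ h 1 0 ns) :=
    (hg.continuousOn _ hxU).continuousAt (hUo.mem_nhds hxU)
  have hord := ordConnected_one_sub_pos (h / 2)
  have h0 : (0 : ℝ) ∈ {n : ℝ | 0 < 1 - h / 2 * n ^ 2} := by simp
  -- The image of the entry point of the radial solution, from the flybys on the side `σ`.
  have key : ∀ σ : ℝ, σ ^ 2 = 1 → (g (S.flyby b c γ h 1 0 ns)).2.1 =
      Complex.exp (((σ * (2 / b) * Real.pi : ℝ) : ℂ) * Complex.I) := by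
    intro σ hσ
    by_contra hne
    obtain ⟨W₁, W₂, hW₁, hW₂, hm₁, hm₂, hdis⟩ := t2_separation hne
    have hneg : ∀ n ∈ Ico ns 0, S.flyby b c γ h σ 0 n = S.flyby b c γ h 1 0 n := fun n hn =>
      H.flyby_zero_of_neg hγ hn.2 (hord.out hns1 h0 ⟨hn.1, hn.2.le⟩)
    have h1 : ContinuousAt (fun p => (g p).2.1) (S.flyby b c γ h 1 0 ns) :=
      (show Continuous fun p : ℝ × ℂ × ℝ × ℝ => p.2.1 by fun_prop).continuousAt.comp hgc
    obtain ⟨x, hxU', hxi, hxa, y, hyW, hxy⟩ := H.exists_crossing_flyby hβ hγ hσ hB hiso hns hns1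
      (by rw [hneg ns ⟨le_rfl, hns⟩]; exact hx.1)
      (fun n hn => by rw [hneg n ⟨hn.1.le, hn.2⟩]; exact hint n hn)
      (U := U ∩ {p | (g p).2.1 ∈ W₁})
      (by
        rw [hneg ns ⟨le_rfl, hns⟩]
        exact inter_mem (hUo.mem_nhds hxU) (h1.eventually (hW₁.mem_nhds hm₁)))
      (hW₂.mem_nhds hm₂)
    have h2 := (hΨ ⟨x, hxi⟩ hxa).unique hF hxy
    rw [hgΨ ⟨x, hxi⟩ hxU'.1] at h2
    refine disjoint_left.1 hdis hxU'.2 ?_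
    rwa [show g x = y from h2]
  have h1 := (key 1 (by norm_num)).symm.trans (key (-1) (by norm_num))
  obtain ⟨n, hn⟩ := Complex.exp_eq_exp_iff_exists_int.1 h1
  have h2 : (2 / b : ℝ) = n := by
    have h3 := congrArg Complex.im hn
    simp at h3
    have := Real.pi_pos.ne'
    have h4 : Real.pi * (2 / b) = Real.pi * n := by linarith
    exact mul_left_cancel₀ this h4
  have h3 : (0 : ℝ) < n := by rw [← h2]; positivity
  lift n to ℕ using by exact_mod_cast h3.le
  refine ⟨n, by exact_mod_cast h3, ?_⟩
  have h4 : (2 / b : ℝ) = (n : ℝ) := by exact_mod_cast h2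
  rw [← h4]
  field_simp

end IsSpindle

end SphericalSurface

/-! ### Lifting orbits to the Levi-Civita plane for `b = 2 / m` -/

section LeviCivita

open Complex

variable {k : ℝ} {q₀ p₀ : ℂ} {n : ℝ}

/-- The radius along a Levi-Civita solution. -/
theorem normSq_lcPos_mul (hn : 0 < 1 - k * n ^ 2) :
    normSq (lcPos k q₀ p₀ n) * (1 - k * n ^ 2) ^ 2 = (1 + k * n ^ 2) ^ 2 * normSq q₀ +
      4 * n * (1 + k * n ^ 2) * (starRingEnd ℂ q₀ * p₀).re + 4 * n ^ 2 * normSq p₀ := by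
  simp only [lcPos, normSq_apply, real_smul, mul_re, mul_im, add_re, add_im, ofReal_re,
    ofReal_im, conj_re, conj_im]
  field_simp
  ring

/-- The angle on the surface is `m` times the angle of `q`. -/
def lcMeridian (m : ℕ) (k : ℝ) (q₀ p₀ : ℂ) (n : ℝ) : ℂ :=
  (lcPos k q₀ p₀ n / (‖lcPos k q₀ p₀ n‖ : ℂ)) ^ m

end LeviCivita

namespace SphericalSurface

variable {S : SphericalSurface} {b c β γ h : ℝ} {m : ℕ} {k : ℝ} {q₀ p₀ : ℂ} {p : ℝ × ℂ × ℝ × ℝ}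

/-- The curve of states on the spindle with `b = 2 / m` that belongs to a Levi-Civita solution: the
plane of the position `q`, without the origin, is an `m`-fold cover of the punctured hemisphere. -/
def coverState (S : SphericalSurface) (b c : ℝ) (m : ℕ) (k : ℝ) (q₀ p₀ : ℂ) : ℝ → ℝ × ℂ × ℝ × ℝ :=
  S.lcState b c k q₀ p₀ (2 * (starRingEnd ℂ q₀ * p₀).im) (lcMeridian m k q₀ p₀)

/-- The Levi-Civita solution with initial values `q₀`, `p₀` and energy constant `k` describes the
orbit of the state `p`. -/
structure IsLift (S : SphericalSurface) (b c γ h : ℝ) (m : ℕ) (k : ℝ) (q₀ p₀ : ℂ)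
    (p : ℝ × ℂ × ℝ × ℝ) : Prop where
  ne_zero : q₀ ≠ 0
  normSq_position : Complex.normSq q₀ = S.gnomonic b c p.1
  normSq_mom : Complex.normSq p₀ = k * Complex.normSq q₀ + γ / 2
  energy : 2 * k = h - (2 * (starRingEnd ℂ q₀ * p₀).im) ^ 2 / (2 * c ^ 2)
  re_eq : 2 * (starRingEnd ℂ q₀ * p₀).re = p.2.2.2 * ‖q₀‖
  im_eq : 2 * (starRingEnd ℂ q₀ * p₀).im =
    p.2.2.1 * ‖q₀‖ / √(1 + (Complex.normSq q₀ / c) ^ 2)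
  coverState_zero : S.coverState b c m k q₀ p₀ 0 = p

/-- The initial position is `√ρ μ`, where `μ` is one of the `m`-th roots of the meridian. -/
theorem IsSpindle.exists_lift (H : S.IsSpindle b c) (hβ : β ^ 2 = b ^ 2) (hm0 : 0 < m)
    (hp : p ∈ S.energyManifold β γ h) (h1 : S.rN < p.1) (h2 : p.1 < S.equator b c) :
    ∃ k q₀ p₀, S.IsLift b c γ h m k q₀ p₀ p := by
  obtain ⟨ρ, y, L, k, hρ, hρe, hy, hL, hz, hk, hE, hpe⟩ := H.exists_eq_state hβ hp h1 h2
  obtain ⟨μ, hμ⟩ := IsAlgClosed.exists_pow_nat_eq p.2.1 hm0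
  have hμ1 : ‖μ‖ = 1 := by
    have h3 : ‖μ‖ ^ m = 1 := by rw [← norm_pow, hμ, hz]
    exact (pow_eq_one_iff_of_nonneg (norm_nonneg _) hm0.ne').1 h3
  have hs : 0 < √ρ := Real.sqrt_pos.2 hρ
  have hs2 : √ρ ^ 2 = ρ := Real.sq_sqrt hρ.le
  have hμμ : starRingEnd ℂ μ * μ = 1 := by
    rw [← Complex.normSq_eq_conj_mul_self, Complex.normSq_eq_norm_sq, hμ1]; simp
  have hμn : Complex.normSq μ = 1 := by rw [Complex.normSq_eq_norm_sq, hμ1, one_pow]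
  have hμ0 : μ ≠ 0 := fun h => by simp [h] at hμ1
  set q₀ : ℂ := (√ρ : ℝ) * μ with hq₀
  set p₀ : ℂ := ((y / √ρ : ℝ) + (L / 2 / √ρ : ℝ) * Complex.I) * μ with hp₀
  have hq0 : q₀ ≠ 0 := mul_ne_zero (Complex.ofReal_ne_zero.2 hs.ne') hμ0
  have hqn : ‖q₀‖ = √ρ := by simp [hq₀, hμ1, abs_of_pos hs]
  have hqq : Complex.normSq q₀ = ρ := by rw [Complex.normSq_eq_norm_sq, hqn, hs2]
  have hqp : starRingEnd ℂ q₀ * p₀ = ((y : ℝ) : ℂ) + ((L / 2 : ℝ) : ℂ) * Complex.I := by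
    rw [hq₀, hp₀, map_mul, Complex.conj_ofReal]
    have : (√ρ : ℂ) ≠ 0 := Complex.ofReal_ne_zero.2 hs.ne'
    push_cast
    field_simp
    linear_combination (2 * (y : ℂ) + L * Complex.I) * hμμ
  have hre : (starRingEnd ℂ q₀ * p₀).re = y := by simp [hqp]
  have him : (starRingEnd ℂ q₀ * p₀).im = L / 2 := by simp [hqp]
  refine ⟨k, q₀, p₀, ⟨hq0, hqq.trans hρe, ?_, ?_, ?_, ?_, ?_⟩⟩
  · rw [hqq, hp₀, Complex.normSq_mul, hμn, mul_one, Complex.normSq_add_mul_I]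
    have : y ^ 2 + (L / 2) ^ 2 = ρ * (k * ρ + γ / 2) := by linarith
    rw [div_pow, div_pow _ (√ρ), ← add_div, this, hs2]
    field_simp
  · rw [him, hk]; ring
  · rw [hre, hqn, hy]; ring
  · rw [him, hqn, hqq, ← hL]; ring
  · rw [coverState, lcState, lcPos_zero, hqq, lcY, lcPos_zero, lcMom_zero, hre, him, lcMeridian,
      lcPos_zero, hqn]
    have h3 : q₀ / ((√ρ : ℝ) : ℂ) = μ := by
      rw [hq₀, mul_div_cancel_left₀ _ (Complex.ofReal_ne_zero.2 hs.ne')]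
    rw [h3, hμ, mul_div_cancel₀ L two_ne_zero]
    exact hpe.symm

theorem coverState_fst (n : ℝ) : (S.coverState b c m k q₀ p₀ n).1 =
    S.param b c (Complex.normSq (lcPos k q₀ p₀ n)) := rfl

theorem IsSpindle.coverState_mem_cap_iff (H : S.IsSpindle b c) {ρ₀ n : ℝ}
    (hM : S.coverState b c m k q₀ p₀ n ∈ S.energyManifold β γ h) :
    S.coverState b c m k q₀ p₀ n ∈ S.cap b c β γ h ρ₀ ↔ Complex.normSq (lcPos k q₀ p₀ n) ≤ ρ₀ := by
  rw [cap, mem_ofPred_eq, coverState_fst, H.param_strictMono.le_iff_le]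
  exact and_iff_right hM

namespace IsLift

variable (P : S.IsLift b c γ h m k q₀ p₀ p)
include P

theorem isOrbit (H : S.IsSpindle b c) (hβ : β ^ 2 = b ^ 2) (hm : b = 2 / (m : ℝ)) (hm0 : 0 < m)
    {n₁ n₂ : ℝ} (hn : ∀ n ∈ Ioo n₁ n₂, 0 < 1 - k * n ^ 2)
    (hq : ∀ n ∈ Ioo n₁ n₂, lcPos k q₀ p₀ n ≠ 0) :
    IsOrbit (S.energyManifold β γ h) (S.collisionSet β γ h) (S.keplerField β γ)
      (S.coverState b c m k q₀ p₀) (lcSpeed b c k q₀ p₀) n₁ n₂ := by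
  refine H.isOrbit hβ P.normSq_mom (by ring) P.energy hn hq (fun n hnI => ?_) fun n hnI => ?_
  · have := norm_ne_zero_iff.2 (hq n hnI)
    simp [lcMeridian, this]
  · have h1 := (HasDerivAt.div_norm (hasDerivAt_lcPos (q₀ := q₀) (p₀ := p₀) (hn n hnI))
      (hq n hnI)).pow m
    refine h1.congr_deriv ?_
    rw [im_smul_div_eq, im_conj_lcPos_mul_lcMom (hn n hnI)]
    have h2 := (Complex.normSq_pos.2 (hq n hnI)).ne'
    have h3 : (m : ℝ) ≠ 0 := by exact_mod_cast hm0.ne'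
    have h4 : 2 / (1 - k * n ^ 2) *
        (2 * (starRingEnd ℂ q₀ * p₀).im / (b * Complex.normSq (lcPos k q₀ p₀ n))) =
        m * (2 / (1 - k * n ^ 2) * ((starRingEnd ℂ q₀ * p₀).im /
          Complex.normSq (lcPos k q₀ p₀ n))) := by
      have := (hn n hnI).ne'
      rw [hm]
      field_simp
    rw [h4, lcMeridian]
    obtain ⟨j, rfl⟩ : ∃ j, m = j + 1 := ⟨m - 1, by omega⟩
    rw [Nat.add_sub_cancel, pow_succ]
    push_cast
    ring

/-- A Levi-Civita solution without collision on a closed interval describes an orbit on a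
neighbourhood of the interval. -/
theorem exists_isOrbit_Icc (H : S.IsSpindle b c) (hβ : β ^ 2 = b ^ 2) (hm : b = 2 / (m : ℝ))
    (hm0 : 0 < m) {n₁ n₂ : ℝ} (h12 : n₁ ≤ n₂) (hn : ∀ n ∈ Icc n₁ n₂, 0 < 1 - k * n ^ 2)
    (hq : ∀ n ∈ Icc n₁ n₂, lcPos k q₀ p₀ n ≠ 0) : ∃ a < n₁, ∃ d > n₂,
      IsOrbit (S.energyManifold β γ h) (S.collisionSet β γ h) (S.keplerField β γ)
        (S.coverState b c m k q₀ p₀) (lcSpeed b c k q₀ p₀) a d := by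
  have hev : ∀ n ∈ Icc n₁ n₂, {x | 0 < 1 - k * x ^ 2 ∧ lcPos k q₀ p₀ x ≠ 0} ∈ 𝓝 n := fun n hnI => by
    have h1 : ContinuousAt (fun n : ℝ => 1 - k * n ^ 2) n := by fun_prop
    exact (h1.eventually (lt_mem_nhds (hn n hnI))).and
      ((hasDerivAt_lcPos (hn n hnI)).continuousAt.eventually_ne (hq n hnI))
  obtain ⟨a, ha, haI⟩ := exists_Ioc_subset_of_mem_nhds (hev n₁ ⟨le_rfl, h12⟩) (exists_lt n₁)
  obtain ⟨d, hd, hdI⟩ := exists_Ico_subset_of_mem_nhds (hev n₂ ⟨h12, le_rfl⟩) (exists_gt n₂)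
  have hall : ∀ n ∈ Ioo a d, 0 < 1 - k * n ^ 2 ∧ lcPos k q₀ p₀ n ≠ 0 := fun n hnI => by
    rcases le_or_gt n n₁ with h3 | h3
    · exact haI ⟨hnI.1, h3⟩
    rcases le_or_gt n₂ n with h4 | h4
    · exact hdI ⟨h4, hnI.2⟩
    · exact ⟨hn n ⟨h3.le, h4.le⟩, hq n ⟨h3.le, h4.le⟩⟩
  exact ⟨a, ha, d, hd, P.isOrbit H hβ hm hm0 (fun n h => (hall n h).1) fun n h => (hall n h).2⟩

/-- In a small cap, the energy constant is small compared to the radius. -/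
theorem abs_energy_le (H : S.IsSpindle b c) {ρ₀ : ℝ} (hρ₀ : 0 < ρ₀) (hh : |h| * ρ₀ ≤ γ / 8)
    (hc : ρ₀ ≤ c / 3) (hle : Complex.normSq q₀ ≤ ρ₀) : |k| * ρ₀ ≤ γ / 8 := by
  have hc0 := H.c_pos
  set ρ := Complex.normSq q₀
  set I := (starRingEnd ℂ q₀ * p₀).im with hI
  have hρ : 0 < ρ := Complex.normSq_pos.2 P.ne_zero
  have hγ0 : 0 ≤ γ := by
    have : 0 ≤ |h| * ρ₀ := by positivity
    linarith
  have h1 : I ^ 2 ≤ ρ * (k * ρ + γ / 2) := by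
    rw [← P.normSq_mom, ← show Complex.normSq (starRingEnd ℂ q₀) = ρ from Complex.normSq_conj q₀,
      ← Complex.normSq_mul, Complex.normSq_apply, hI]
    nlinarith [sq_nonneg (starRingEnd ℂ q₀ * p₀).re]
  have h2 : 2 * k = h - 2 * (I ^ 2 / c ^ 2) := by rw [P.energy]; ring
  have h3 : 0 ≤ I ^ 2 / c ^ 2 := by positivity
  have h4 : h * ρ ≤ γ / 8 := by
    calc h * ρ ≤ |h| * ρ₀ := mul_le_mul (le_abs_self h) hle hρ.le (abs_nonneg h)
      _ ≤ γ / 8 := hh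
  have h5 : I ^ 2 ≤ ρ₀ * (9 / 16 * γ) := by
    have h6 : k * ρ ≤ h / 2 * ρ := mul_le_mul_of_nonneg_right (by linarith) hρ.le
    calc I ^ 2 ≤ ρ * (k * ρ + γ / 2) := h1
      _ ≤ ρ * (9 / 16 * γ) := mul_le_mul_of_nonneg_left (by linarith) hρ.le
      _ ≤ ρ₀ * (9 / 16 * γ) := mul_le_mul_of_nonneg_right hle (by linarith)
  have h7 : I ^ 2 / c ^ 2 * ρ₀ ≤ γ / 16 := by
    rw [div_mul_eq_mul_div, div_le_iff₀ (by positivity)]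
    have h8 : ρ₀ ^ 2 ≤ (c / 3) ^ 2 := by gcongr
    calc I ^ 2 * ρ₀ ≤ ρ₀ * (9 / 16 * γ) * ρ₀ := mul_le_mul_of_nonneg_right h5 hρ₀.le
      _ = 9 / 16 * γ * ρ₀ ^ 2 := by ring
      _ ≤ 9 / 16 * γ * (c / 3) ^ 2 := mul_le_mul_of_nonneg_left h8 (by linarith)
      _ = _ := by ring
  have habs : ∀ x : ℝ, |x| * ρ₀ = |x * ρ₀| := fun x => by rw [abs_mul, abs_of_pos hρ₀]
  rw [habs] at hh ⊢
  have h9 := abs_le.1 hh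
  have h10 : 0 ≤ I ^ 2 / c ^ 2 * ρ₀ := by positivity
  have h11 : k * ρ₀ = h * ρ₀ / 2 - I ^ 2 / c ^ 2 * ρ₀ := by linear_combination ρ₀ / 2 * h2
  rw [h11, abs_le]
  constructor <;> linarith [h9.1, h9.2]

end IsLift

end SphericalSurface

/-! ### The boundary of a small cap -/

namespace SphericalSurface

variable {S : SphericalSurface} {b c β γ h ρ₀ : ℝ} {m : ℕ} {k : ℝ} {q₀ p₀ : ℂ}
  {p : ℝ × ℂ × ℝ × ℝ}

/-- The conditions under which the cap of gnomonic radius `ρ₀` on the spindle with `b = 2 / m` is a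
trivializable isolating block. The two bounds on `ρ₀` make `|k| ρ₀` at most `γ / 8` for the energy
constant `k` of every orbit that meets the cap. -/
structure IsSmallCap (S : SphericalSurface) (b c β γ h : ℝ) (m : ℕ) (ρ₀ : ℝ) : Prop where
  isSpindle : S.IsSpindle b c
  sq_eq : β ^ 2 = b ^ 2
  b_eq : b = 2 / (m : ℝ)
  m_pos : 0 < m
  γ_pos : 0 < γ
  ρ₀_pos : 0 < ρ₀
  h_le : |h| * ρ₀ ≤ γ / 8
  ρ₀_le : ρ₀ ≤ c / 3

namespace IsSmallCap

variable (C : S.IsSmallCap b c β γ h m ρ₀)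
include C

theorem h_bounds : -(γ / 8) ≤ h * ρ₀ ∧ h * ρ₀ ≤ γ / 8 := by
  have := C.h_le
  rw [← abs_of_pos C.ρ₀_pos, ← abs_mul] at this
  exact abs_le.1 this

theorem mem_energyManifold_iff (hp : p.1 = S.param b c ρ₀) :
    p ∈ S.energyManifold β γ h ↔ ‖p.2.1‖ = 1 ∧ p.2.2.1 ^ 2 + p.2.2.2 ^ 2 = 2 * (γ + h * ρ₀) := by
  have H := C.isSpindle
  have h1 := (H.param_mem C.ρ₀_pos).1.le
  rw [H.mem_energyManifold_iff C.sq_eq (hp ▸ H.param_lt_equator ρ₀), hp, H.gnomonic_param]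
  refine and_congr_right fun _ => ?_
  constructor
  · rintro ⟨-, h2⟩
    linarith
  · intro h2
    exact ⟨h1, by linarith⟩

theorem exists_lift (hp : p ∈ S.energyManifold β γ h) (hr : p.1 = S.param b c ρ₀) :
    ∃ k q₀ p₀, S.IsLift b c γ h m k q₀ p₀ p :=
  C.isSpindle.exists_lift C.sq_eq C.m_pos hp (hr ▸ (C.isSpindle.param_mem C.ρ₀_pos).1)
    (hr ▸ C.isSpindle.param_lt_equator ρ₀)

theorem normSq_eq (P : S.IsLift b c γ h m k q₀ p₀ p) (hr : p.1 = S.param b c ρ₀) :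
    Complex.normSq q₀ = ρ₀ := by
  rw [P.normSq_position, hr, C.isSpindle.gnomonic_param]

theorem energy_bounds (P : S.IsLift b c γ h m k q₀ p₀ p) (hle : Complex.normSq q₀ ≤ ρ₀) :
    -(γ / 8) ≤ k * ρ₀ ∧ k * ρ₀ ≤ γ / 8 := by
  have := P.abs_energy_le C.isSpindle C.ρ₀_pos C.h_le C.ρ₀_le hle
  rw [← abs_of_pos C.ρ₀_pos, ← abs_mul] at this
  exact abs_le.1 this

omit C in
/-- The radius along a Levi-Civita solution that starts on the boundary of the cap. -/
theorem normSq_lcPos_le_iff {n : ℝ} (hq : Complex.normSq q₀ = ρ₀)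
    (hp : Complex.normSq p₀ = k * ρ₀ + γ / 2) (hn : 0 < 1 - k * n ^ 2) :
    Complex.normSq (lcPos k q₀ p₀ n) ≤ ρ₀ ↔
      n * ((starRingEnd ℂ q₀ * p₀).re * (1 + k * n ^ 2) + (2 * k * ρ₀ + γ / 2) * n) ≤ 0 := by
  have h1 := normSq_lcPos_mul (q₀ := q₀) (p₀ := p₀) hn
  rw [hq, hp] at h1
  have h2 : 0 < (1 - k * n ^ 2) ^ 2 := by positivity
  rw [← mul_le_mul_iff_left₀ h2, h1]
  constructor <;> intro h3 <;> linarith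

theorem mem_iff (P : S.IsLift b c γ h m k q₀ p₀ p) (hr : p.1 = S.param b c ρ₀) {n : ℝ}
    (hn : 0 < 1 - k * n ^ 2) (hM : S.coverState b c m k q₀ p₀ n ∈ S.energyManifold β γ h) :
    S.coverState b c m k q₀ p₀ n ∈ S.cap b c β γ h ρ₀ ↔
      n * ((starRingEnd ℂ q₀ * p₀).re * (1 + k * n ^ 2) + (2 * k * ρ₀ + γ / 2) * n) ≤ 0 := by
  have h1 := C.normSq_eq P hr
  rw [C.isSpindle.coverState_mem_cap_iff hM]
  exact normSq_lcPos_le_iff h1 (by rw [P.normSq_mom, h1]) hn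

/-- The second derivative of the radius is positive along the boundary. -/
theorem momentum_pos (P : S.IsLift b c γ h m k q₀ p₀ p) (hr : p.1 = S.param b c ρ₀) :
    0 < 2 * k * ρ₀ + γ / 2 := by
  have := (C.energy_bounds P (C.normSq_eq P hr).le).1
  have := C.γ_pos
  linarith

/-- Close to the initial parameter, the Levi-Civita solution describes an orbit. -/
theorem exists_isOrbit (P : S.IsLift b c γ h m k q₀ p₀ p) : ∃ n₁ < 0, ∃ n₂ > 0,
    (∀ n ∈ Ioo n₁ n₂, 0 < 1 - k * n ^ 2 ∧ 0 < 1 + k * n ^ 2) ∧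
    IsOrbit (S.energyManifold β γ h) (S.collisionSet β γ h) (S.keplerField β γ)
      (S.coverState b c m k q₀ p₀) (lcSpeed b c k q₀ p₀) n₁ n₂ := by
  have h1 : ∀ᶠ n in 𝓝 (0 : ℝ), 0 < 1 - k * n ^ 2 := by
    have : ContinuousAt (fun n : ℝ => 1 - k * n ^ 2) 0 := by fun_prop
    exact this.eventually (lt_mem_nhds (by simp))
  have h2 : ∀ᶠ n in 𝓝 (0 : ℝ), 0 < 1 + k * n ^ 2 := by
    have : ContinuousAt (fun n : ℝ => 1 + k * n ^ 2) 0 := by fun_prop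
    exact this.eventually (lt_mem_nhds (by simp))
  have h3 : ∀ᶠ n in 𝓝 (0 : ℝ), lcPos k q₀ p₀ n ≠ 0 := by
    have : ContinuousAt (lcPos k q₀ p₀) 0 := (hasDerivAt_lcPos (by simp)).continuousAt
    exact this.eventually_ne (by rw [lcPos_zero]; exact P.ne_zero)
  obtain ⟨ε, hε, h4⟩ := Metric.eventually_nhds_iff_ball.1 ((h1.and h2).and h3)
  rw [Real.ball_eq_Ioo, zero_sub, zero_add] at h4
  exact ⟨-ε, by linarith, ε, hε, fun n hn => (h4 n hn).1,
    P.isOrbit C.isSpindle C.sq_eq C.b_eq C.m_pos (fun n hn => (h4 n hn).1.1) fun n hn => (h4 n hn).2⟩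

/-- The sides of the boundary on which the orbit of a boundary point runs, before and after. -/
theorem eventually_sides (P : S.IsLift b c γ h m k q₀ p₀ p) (hr : p.1 = S.param b c ρ₀) :
    (0 ≤ p.2.2.2 → ∀ᶠ n in 𝓝[>] 0, S.coverState b c m k q₀ p₀ n ∉ S.cap b c β γ h ρ₀) ∧
    (p.2.2.2 ≤ 0 → ∀ᶠ n in 𝓝[<] 0, S.coverState b c m k q₀ p₀ n ∉ S.cap b c β γ h ρ₀) ∧
    (p.2.2.2 < 0 → ∀ᶠ n in 𝓝[>] 0, S.coverState b c m k q₀ p₀ n ∈ S.cap b c β γ h ρ₀) ∧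
    (0 < p.2.2.2 → ∀ᶠ n in 𝓝[<] 0, S.coverState b c m k q₀ p₀ n ∈ S.cap b c β γ h ρ₀) := by
  obtain ⟨n₁, hn₁, n₂, hn₂, hpos, hX⟩ := C.exists_isOrbit P
  have hD := C.momentum_pos P hr
  have hq : 0 < ‖q₀‖ := norm_pos_iff.2 P.ne_zero
  have hre := P.re_eq
  set y := (starRingEnd ℂ q₀ * p₀).re with hy
  have hcont : ContinuousAt
      (fun n : ℝ => y * (1 + k * n ^ 2) + (2 * k * ρ₀ + γ / 2) * n) 0 := by fun_prop
  refine ⟨fun hv => ?_, fun hv => ?_, fun hv => ?_, fun hv => ?_⟩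
  · filter_upwards [Ioo_mem_nhdsGT hn₂] with n hn
    have hI : n ∈ Ioo n₁ n₂ := ⟨hn₁.trans hn.1, hn.2⟩
    rw [C.mem_iff P hr (hpos n hI).1 (hX.mem n hI).1, not_le, ← hy]
    have h1 : 0 ≤ y := by nlinarith
    have h2 := mul_nonneg h1 (hpos n hI).2.le
    exact mul_pos hn.1 (by nlinarith [hn.1])
  · filter_upwards [Ioo_mem_nhdsLT hn₁] with n hn
    have hI : n ∈ Ioo n₁ n₂ := ⟨hn.1, hn.2.trans hn₂⟩
    rw [C.mem_iff P hr (hpos n hI).1 (hX.mem n hI).1, not_le, ← hy]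
    have h1 : y ≤ 0 := by nlinarith
    have h2 := mul_nonpos_of_nonpos_of_nonneg h1 (hpos n hI).2.le
    exact mul_pos_of_neg_of_neg hn.2 (by nlinarith [hn.2])
  · have h1 : y < 0 := by nlinarith
    have h2 := hcont.eventually (gt_mem_nhds (show _ < (0 : ℝ) by simpa using h1))
    filter_upwards [Ioo_mem_nhdsGT hn₂, nhdsWithin_le_nhds h2] with n hn h3
    have hI : n ∈ Ioo n₁ n₂ := ⟨hn₁.trans hn.1, hn.2⟩
    rw [C.mem_iff P hr (hpos n hI).1 (hX.mem n hI).1, ← hy]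
    exact mul_nonpos_of_nonneg_of_nonpos hn.1.le h3.le
  · have h1 : 0 < y := by nlinarith
    have h2 := hcont.eventually (lt_mem_nhds (show (0 : ℝ) < _ by simpa using h1))
    filter_upwards [Ioo_mem_nhdsLT hn₁, nhdsWithin_le_nhds h2] with n hn h3
    have hI : n ∈ Ioo n₁ n₂ := ⟨hn.1, hn.2.trans hn₂⟩
    rw [C.mem_iff P hr (hpos n hI).1 (hX.mem n hI).1, ← hy]
    exact mul_nonpos_of_nonpos_of_nonneg hn.2.le h3.le

theorem mem_relBoundary_iff :
    p ∈ relBoundary (S.energyManifold β γ h) (S.cap b c β γ h ρ₀) ↔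
      p.1 = S.param b c ρ₀ ∧ ‖p.2.1‖ = 1 ∧ p.2.2.1 ^ 2 + p.2.2.2 ^ 2 = 2 * (γ + h * ρ₀) := by
  have key : p ∈ relBoundary (S.energyManifold β γ h) (S.cap b c β γ h ρ₀) ↔
      p.1 = S.param b c ρ₀ ∧ p ∈ S.energyManifold β γ h := by
    constructor
    · rintro ⟨h1, h2, h3⟩
      refine ⟨le_antisymm ?_ ?_, h1⟩
      · exact ((C.isSpindle.isCompact_cap C.sq_eq ρ₀).isClosed.closure_subset h2).2
      · have h4 : S.energyManifold β γ h \ S.cap b c β γ h ρ₀ ⊆ {q | S.param b c ρ₀ ≤ q.1} :=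
          fun q hq => le_of_not_ge fun h5 => hq.2 ⟨hq.1, h5⟩
        exact closure_minimal h4 (isClosed_le continuous_const continuous_fst) h3
    · rintro ⟨hr, hp⟩
      obtain ⟨k, q₀, p₀, P⟩ := C.exists_lift hp hr
      obtain ⟨n₁, hn₁, n₂, hn₂, hpos, hX⟩ := C.exists_isOrbit P
      have hc : Tendsto (S.coverState b c m k q₀ p₀) (𝓝 0) (𝓝 p) := by
        have := (hX.deriv 0 ⟨hn₁, hn₂⟩).continuousAt.tendsto
        rwa [P.coverState_zero] at this
      refine ⟨hp, subset_closure ⟨hp, hr.le⟩, ?_⟩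
      rcases le_total 0 p.2.2.2 with hv | hv
      · refine mem_closure_of_tendsto (hc.mono_left nhdsWithin_le_nhds)
          ((C.eventually_sides P hr).1 hv |>.and (Ioo_mem_nhdsGT hn₂) |>.mono fun n hn => ?_)
        exact ⟨(hX.mem n ⟨hn₁.trans hn.2.1, hn.2.2⟩).1, hn.1⟩
      · refine mem_closure_of_tendsto (hc.mono_left nhdsWithin_le_nhds)
          ((C.eventually_sides P hr).2.1 hv |>.and (Ioo_mem_nhdsLT hn₁) |>.mono fun n hn => ?_)
        exact ⟨(hX.mem n ⟨hn.2.1, hn.2.2.trans hn₂⟩).1, hn.1⟩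
  rw [key]
  exact and_congr_right fun hr => C.mem_energyManifold_iff hr

theorem mem_ingress_iff : p ∈ ingress (S.energyManifold β γ h) (S.collisionSet β γ h)
    (S.keplerField β γ) (S.cap b c β γ h ρ₀) ↔
      p ∈ relBoundary (S.energyManifold β γ h) (S.cap b c β γ h ρ₀) ∧ p.2.2.2 ≤ 0 := by
  have hF := C.isSpindle.contDiffAt (h := h) C.sq_eq C.γ_pos
  refine ⟨fun hp => ⟨hp.1, ?_⟩, fun ⟨hb, hv⟩ => ?_⟩
  · have hr := (C.mem_relBoundary_iff.1 hp.1).1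
    obtain ⟨k, q₀, p₀, P⟩ := C.exists_lift hp.1.1 hr
    obtain ⟨n₁, hn₁, n₂, hn₂, hpos, hX⟩ := C.exists_isOrbit P
    have hb := hp.1
    rw [← P.coverState_zero] at hp hb
    have h1 := (hX.mem_ingress_iff hF ⟨hn₁, hn₂⟩ hb).1 hp
    by_contra! hv
    obtain ⟨n, h2, h3⟩ := (h1.and ((C.eventually_sides P hr).2.2.2 hv)).exists
    exact h2 h3
  · have hr := (C.mem_relBoundary_iff.1 hb).1
    obtain ⟨k, q₀, p₀, P⟩ := C.exists_lift hb.1 hr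
    obtain ⟨n₁, hn₁, n₂, hn₂, hpos, hX⟩ := C.exists_isOrbit P
    have h1 := (C.eventually_sides P hr).2.1 hv
    rw [← P.coverState_zero] at hb ⊢
    exact (hX.mem_ingress_iff hF ⟨hn₁, hn₂⟩ hb).2 h1

theorem mem_egress_iff : p ∈ egress (S.energyManifold β γ h) (S.collisionSet β γ h)
    (S.keplerField β γ) (S.cap b c β γ h ρ₀) ↔
      p ∈ relBoundary (S.energyManifold β γ h) (S.cap b c β γ h ρ₀) ∧ 0 ≤ p.2.2.2 := by
  have hF := C.isSpindle.contDiffAt (h := h) C.sq_eq C.γ_pos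
  refine ⟨fun hp => ⟨hp.1, ?_⟩, fun ⟨hb, hv⟩ => ?_⟩
  · have hr := (C.mem_relBoundary_iff.1 hp.1).1
    obtain ⟨k, q₀, p₀, P⟩ := C.exists_lift hp.1.1 hr
    obtain ⟨n₁, hn₁, n₂, hn₂, hpos, hX⟩ := C.exists_isOrbit P
    have hb := hp.1
    rw [← P.coverState_zero] at hp hb
    have h1 := (hX.mem_egress_iff hF ⟨hn₁, hn₂⟩ hb).1 hp
    by_contra! hv
    obtain ⟨n, h2, h3⟩ := (h1.and ((C.eventually_sides P hr).2.2.1 hv)).exists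
    exact h2 h3
  · have hr := (C.mem_relBoundary_iff.1 hb).1
    obtain ⟨k, q₀, p₀, P⟩ := C.exists_lift hb.1 hr
    obtain ⟨n₁, hn₁, n₂, hn₂, hpos, hX⟩ := C.exists_isOrbit P
    have h1 := (C.eventually_sides P hr).1 hv
    rw [← P.coverState_zero] at hb ⊢
    exact (hX.mem_egress_iff hF ⟨hn₁, hn₂⟩ hb).2 h1

end IsSmallCap

end SphericalSurface

/-! ### Small caps are isolating blocks -/

namespace SphericalSurface

/-- Functions that define the boundary of a cap, and the set of tangency in it. -/
def boundaryMap (r₀ A : ℝ) : Fin 4 → ℝ × ℂ × ℝ × ℝ → ℝ :=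
  ![fun p => p.1 - r₀, fun p => p.2.1.re ^ 2 + p.2.1.im ^ 2 - 1,
    fun p => p.2.2.1 ^ 2 + p.2.2.2 ^ 2 - A, fun p => p.2.2.2]

theorem contDiff_boundaryMap (r₀ A : ℝ) (i : Fin 4) : ContDiff ℝ ∞ (boundaryMap r₀ A i) := by
  have h1 : ContDiff ℝ ∞ fun p : ℝ × ℂ × ℝ × ℝ => p.2.1.re :=
    Complex.reCLM.contDiff.comp (by fun_prop)
  have h2 : ContDiff ℝ ∞ fun p : ℝ × ℂ × ℝ × ℝ => p.2.1.im :=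
    Complex.imCLM.contDiff.comp (by fun_prop)
  fin_cases i <;> simp [boundaryMap] <;> fun_prop

theorem fderiv_boundaryMap (r₀ A : ℝ) (i : Fin 4) (p w : ℝ × ℂ × ℝ × ℝ) :
    fderiv ℝ (boundaryMap r₀ A i) p w = ![w.1, 2 * (p.2.1.re * w.2.1.re + p.2.1.im * w.2.1.im),
      2 * (p.2.2.1 * w.2.2.1 + p.2.2.2 * w.2.2.2), w.2.2.2] i := by
  have h1 := ((contDiff_boundaryMap r₀ A i).differentiable (by simp) p).hasFDerivAt
  have h2 : HasDerivAt (fun t : ℝ => p + t • w) w 0 := by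
    simpa using ((hasDerivAt_id (0 : ℝ)).smul_const w).const_add p
  have h3 := h1.comp_hasDerivAt_of_eq (0 : ℝ) h2 (by simp)
  refine h3.unique ?_
  have lin : ∀ a b : ℝ, HasDerivAt (fun t : ℝ => a + t * b) b 0 := fun a b => by
    simpa using ((hasDerivAt_id (0 : ℝ)).mul_const b).const_add a
  have sq : ∀ a b a' b' d : ℝ, HasDerivAt (fun t : ℝ => (a + t * b) ^ 2 + (a' + t * b') ^ 2 - d)
      (2 * (a * b + a' * b')) 0 := fun a b a' b' d => by
    refine ((((lin a b).pow 2).add ((lin a' b').pow 2)).sub_const d).congr_deriv ?_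
    simp
    ring
  fin_cases i
  · exact (lin _ _).sub_const _
  · refine (sq p.2.1.re w.2.1.re p.2.1.im w.2.1.im 1).congr_of_eventuallyEq
      (Eventually.of_forall fun t => ?_)
    simp [boundaryMap]
  · exact sq _ _ _ _ _
  · exact lin _ _

theorem fderiv_pi_boundaryMap (r₀ A : ℝ) {n : ℕ} (ι : Fin n → Fin 4) (p w : ℝ × ℂ × ℝ × ℝ)
    (i : Fin n) : fderiv ℝ (fun p i => boundaryMap r₀ A (ι i) p) p w i =
      fderiv ℝ (boundaryMap r₀ A (ι i)) p w := by
  rw [fderiv_pi fun i => (contDiff_boundaryMap r₀ A (ι i)).differentiable (by simp) p]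
  rfl

theorem isSmoothSubmanifold_torus (r₀ : ℝ) {A : ℝ} (hA : 0 < A) : IsSmoothSubmanifold 3
    {p : ℝ × ℂ × ℝ × ℝ | p.1 = r₀ ∧ ‖p.2.1‖ = 1 ∧ p.2.2.1 ^ 2 + p.2.2.2 ^ 2 = A} := by
  rintro p ⟨h1, h2, h3⟩
  refine ⟨{p | p.2.1 ≠ 0 ∧ p.2.2.1 ^ 2 + p.2.2.2 ^ 2 ≠ 0}, ?_, ?_,
    fun p i => boundaryMap r₀ A i.castSucc p,
    (contDiff_pi.2 fun i => contDiff_boundaryMap r₀ A _).contDiffOn, ?_, ?_⟩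
  · exact (isOpen_ne_fun (by fun_prop) (by fun_prop)).inter
      (isOpen_ne_fun (by fun_prop) (by fun_prop))
  · exact ⟨fun h => by simp [h] at h2, by rw [h3]; exact hA.ne'⟩
  · rintro q ⟨hz, hq⟩ t
    have hz' : q.2.1.re ^ 2 + q.2.1.im ^ 2 ≠ 0 := by
      have := (Complex.normSq_pos.2 hz).ne'
      rwa [Complex.normSq_apply, ← sq, ← sq] at this
    refine ⟨(t 0, ⟨t 1 / (2 * (q.2.1.re ^ 2 + q.2.1.im ^ 2)) * q.2.1.re,
      t 1 / (2 * (q.2.1.re ^ 2 + q.2.1.im ^ 2)) * q.2.1.im⟩,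
      t 2 / (2 * (q.2.2.1 ^ 2 + q.2.2.2 ^ 2)) * q.2.2.1,
      t 2 / (2 * (q.2.2.1 ^ 2 + q.2.2.2 ^ 2)) * q.2.2.2), ?_⟩
    ext i
    rw [fderiv_pi_boundaryMap, fderiv_boundaryMap]
    fin_cases i <;> simp <;> field_simp
  · ext q
    simp only [mem_inter_iff, mem_ofPred_eq, funext_iff, Fin.forall_fin_succ]
    have h4 : ‖q.2.1‖ = 1 ↔ q.2.1.re ^ 2 + q.2.1.im ^ 2 = 1 := by
      rw [← pow_eq_one_iff_of_nonneg (norm_nonneg q.2.1) two_ne_zero, ← Complex.normSq_eq_norm_sq,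
        Complex.normSq_apply, sq, sq]
    rw [h4]
    simp [boundaryMap, sub_eq_zero]
    tauto

theorem isSmoothSubmanifold_tangency (r₀ : ℝ) {A : ℝ} (hA : 0 < A) : IsSmoothSubmanifold 4
    {p : ℝ × ℂ × ℝ × ℝ | (p.1 = r₀ ∧ ‖p.2.1‖ = 1 ∧ p.2.2.1 ^ 2 + p.2.2.2 ^ 2 = A) ∧ p.2.2.2 = 0} := by
  rintro p ⟨⟨h1, h2, h3⟩, h0⟩
  refine ⟨{p | p.2.1 ≠ 0 ∧ p.2.2.1 ≠ 0}, ?_, ?_,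
    fun p i => boundaryMap r₀ A i p,
    (contDiff_pi.2 fun i => contDiff_boundaryMap r₀ A _).contDiffOn, ?_, ?_⟩
  · exact (isOpen_ne_fun (by fun_prop) (by fun_prop)).inter
      (isOpen_ne_fun (by fun_prop) (by fun_prop))
  · exact ⟨fun h => by simp [h] at h2, fun h => by simp [h, h0] at h3; exact hA.ne h3⟩
  · rintro q ⟨hz, hq⟩ t
    have hz' : q.2.1.re ^ 2 + q.2.1.im ^ 2 ≠ 0 := by
      have := (Complex.normSq_pos.2 hz).ne'
      rwa [Complex.normSq_apply, ← sq, ← sq] at this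
    refine ⟨(t 0, ⟨t 1 / (2 * (q.2.1.re ^ 2 + q.2.1.im ^ 2)) * q.2.1.re,
      t 1 / (2 * (q.2.1.re ^ 2 + q.2.1.im ^ 2)) * q.2.1.im⟩,
      (t 2 / 2 - q.2.2.2 * t 3) / q.2.2.1, t 3), ?_⟩
    ext i
    have := fderiv_pi_boundaryMap r₀ A (fun i => i) q
    rw [this, fderiv_boundaryMap]
    fin_cases i <;> simp <;> field_simp
    ring
  · ext q
    simp only [mem_inter_iff, mem_ofPred_eq, funext_iff, Fin.forall_fin_succ]
    have h4 : ‖q.2.1‖ = 1 ↔ q.2.1.re ^ 2 + q.2.1.im ^ 2 = 1 := by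
      rw [← pow_eq_one_iff_of_nonneg (norm_nonneg q.2.1) two_ne_zero, ← Complex.normSq_eq_norm_sq,
        Complex.normSq_apply, sq, sq]
    rw [h4]
    simp [boundaryMap, sub_eq_zero]
    tauto

variable {S : SphericalSurface} {b c β γ h ρ₀ : ℝ} {m : ℕ} {k : ℝ} {q₀ p₀ : ℂ}
  {p : ℝ × ℂ × ℝ × ℝ}

namespace IsSmallCap

variable (C : S.IsSmallCap b c β γ h m ρ₀)
include C

theorem energy_pos : 0 < 2 * (γ + h * ρ₀) := by
  have := C.h_bounds.1
  have := C.γ_pos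
  linarith

theorem relBoundary_eq : relBoundary (S.energyManifold β γ h) (S.cap b c β γ h ρ₀) =
    {p | p.1 = S.param b c ρ₀ ∧ ‖p.2.1‖ = 1 ∧ p.2.2.1 ^ 2 + p.2.2.2 ^ 2 = 2 * (γ + h * ρ₀)} :=
  ext fun _ => C.mem_relBoundary_iff

/-- The vector field is tangent to the boundary of the cap where `v = 0`. -/
theorem mem_tangency_iff :
    p ∈ tangency (S.energyManifold β γ h) (S.keplerField β γ) (S.cap b c β γ h ρ₀) ↔
      p ∈ relBoundary (S.energyManifold β γ h) (S.cap b c β γ h ρ₀) ∧ p.2.2.2 = 0 := by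
  refine and_congr_right fun hb => ?_
  obtain ⟨hr, hz, hE⟩ := C.mem_relBoundary_iff.1 hb
  constructor
  · intro ht
    have h1 : HasFDerivAt (fun q : ℝ × ℂ × ℝ × ℝ => q.1) (ContinuousLinearMap.fst ℝ _ _) p :=
      hasFDerivAt_fst
    have h2 := hasFDerivAt_apply_eq_zero_of_mem_tangentConeAt h1
      (Eventually.of_forall fun q hq => (C.mem_relBoundary_iff.1 hq).1.trans hr.symm) ht
    have h3 : S.theta β p.1 < 0 := by
      rw [hr, C.isSpindle.theta_param C.sq_eq C.ρ₀_pos]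
      have := C.ρ₀_pos
      exact neg_neg_of_pos (by positivity)
    simp only [keplerField, ContinuousLinearMap.coe_fst'] at h2
    exact (mul_eq_zero.1 h2).resolve_right (Real.sqrt_pos.2 (abs_pos.2 h3.ne)).ne'
  · intro hv
    have hu : p.2.2.1 ≠ 0 := fun hu => by
      have := C.energy_pos
      simp [hu, hv] at hE
      linarith
    -- A curve in the boundary with the direction of the vector field.
    set F := S.keplerField β γ p with hF
    set a := p.2.2.1 * (√|S.theta β p.1| / S.f p.1) with ha
    have hF1 : F = (0, (a : ℂ) * Complex.I * p.2.1, 0, F.2.2.2) := by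
      rw [hF]
      refine Prod.ext ?_ (Prod.ext rfl (Prod.ext ?_ rfl))
      · simp [keplerField, hv]
      · simp [keplerField, hv]
    set G := F.2.2.2
    let cv : ℝ → ℝ × ℂ × ℝ × ℝ := fun s => (p.1, Complex.exp (((s * a : ℝ) : ℂ) * Complex.I) * p.2.1,
      p.2.2.1 * Real.cos (s * (G / p.2.2.1)), p.2.2.1 * Real.sin (s * (G / p.2.2.1)))
    have hcv0 : cv 0 = p := by
      simp only [cv]
      refine Prod.ext rfl (Prod.ext (by simp) (Prod.ext (by simp) (by simp [hv])))
    have lin : ∀ b : ℝ, HasDerivAt (fun t : ℝ => t * b) b 0 := fun b => by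
      simpa using (hasDerivAt_id (0 : ℝ)).mul_const b
    have hcv : HasDerivAt cv F 0 := by
      have h1 := ((((lin a).ofReal_comp).mul_const Complex.I).cexp).mul_const p.2.1
      have h2 := ((lin (G / p.2.2.1)).cos).const_mul p.2.2.1
      have h3 := ((lin (G / p.2.2.1)).sin).const_mul p.2.2.1
      refine ((hasDerivAt_const (0 : ℝ) p.1).prodMk (h1.prodMk (h2.prodMk h3))).congr_deriv ?_
      rw [hF1]
      refine Prod.ext rfl (Prod.ext ?_ (Prod.ext ?_ ?_))
      · simp
      · simp
      · simp
        field_simp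
    have h4 := mem_tangentConeAt_of_hasDerivAt
      (S := relBoundary (S.energyManifold β γ h) (S.cap b c β γ h ρ₀)) hcv
      (Eventually.of_forall fun s => C.mem_relBoundary_iff.2 ⟨hr, ?_, ?_⟩)
    · rwa [hcv0] at h4
    · simp only [cv, norm_mul, Complex.norm_exp_ofReal_mul_I, hz, one_mul]
    · simp only [cv]
      rw [← hE, hv]
      linear_combination p.2.2.1 ^ 2 * Real.sin_sq_add_cos_sq (s * (G / p.2.2.1))

theorem param_gt : S.rN < S.param b c ρ₀ := (C.isSpindle.param_mem C.ρ₀_pos).1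

theorem collisionSet_subset :
    S.collisionSet β γ h ⊆ relInterior (S.energyManifold β γ h) (S.cap b c β γ h ρ₀) := by
  rintro p ⟨hp, hr⟩
  refine ⟨hp, ?_⟩
  have h1 : {q : ℝ × ℂ × ℝ × ℝ | q.1 < S.param b c ρ₀} ∈ 𝓝 p :=
    (isOpen_lt continuous_fst continuous_const).mem_nhds (show p.1 < _ from hr ▸ C.param_gt)
  filter_upwards [self_mem_nhdsWithin, mem_nhdsWithin_of_mem_nhds h1] with q h2 h3
  exact ⟨h2, le_of_lt h3⟩

theorem isIsolatingBlock : IsIsolatingBlock 2 (S.energyManifold β γ h) (S.collisionSet β γ h)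
    (S.keplerField β γ) (S.cap b c β γ h ρ₀) where
  subset := fun _ hp => hp.1
  isCompact := C.isSpindle.isCompact_cap C.sq_eq ρ₀
  interior_nonempty := by
    have h2 : √(2 * γ) ^ 2 = 2 * γ := Real.sq_sqrt (by have := C.γ_pos; linarith)
    refine ⟨(S.rN, 1, √(2 * γ), 0), C.collisionSet_subset ⟨⟨by simp, Or.inl ⟨rfl, ?_⟩⟩, rfl⟩⟩
    dsimp only
    rw [h2]
    ring
  boundary_disjoint := disjoint_left.2 fun p hp hN =>
    C.param_gt.ne (hN.2.symm.trans (C.mem_relBoundary_iff.1 hp).1)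
  boundary_smooth := by
    rw [C.relBoundary_eq]
    exact isSmoothSubmanifold_torus _ C.energy_pos
  tangency_eq := by
    ext p
    rw [mem_inter_iff, C.mem_ingress_iff, C.mem_egress_iff, C.mem_tangency_iff, ← and_and_left,
      le_antisymm_iff]
  tangency_smooth := by
    have : tangency (S.energyManifold β γ h) (S.keplerField β γ) (S.cap b c β γ h ρ₀) =
        {p | (p.1 = S.param b c ρ₀ ∧ ‖p.2.1‖ = 1 ∧
          p.2.2.1 ^ 2 + p.2.2.2 ^ 2 = 2 * (γ + h * ρ₀)) ∧ p.2.2.2 = 0} :=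
      ext fun p => by rw [C.mem_tangency_iff, C.mem_relBoundary_iff]; rfl
    rw [this]
    exact isSmoothSubmanifold_tangency _ C.energy_pos

/-- Every orbit that meets the cap leaves it, in the future or in the past. -/
theorem isolates : Isolates (S.energyManifold β γ h) (S.collisionSet β γ h)
    (S.keplerField β γ) (S.cap b c β γ h ρ₀) := by
  refine ⟨C.collisionSet_subset, fun p hp => ?_⟩
  have H := C.isSpindle
  have hγ := C.γ_pos
  have hρ₀ := C.ρ₀_pos
  have hrN := (mem_Ioo_of_mem_diff hγ ⟨hp.1.1, hp.2⟩).1.1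
  have heq := hp.1.2.trans_lt (H.param_lt_equator ρ₀)
  obtain ⟨k, q₀, p₀, P⟩ := H.exists_lift C.sq_eq C.m_pos hp.1.1 hrN heq
  have hle : Complex.normSq q₀ ≤ ρ₀ := by
    rw [P.normSq_position, ← H.param_strictMono.le_iff_le, H.param_gnomonic ⟨hrN.le, heq⟩]
    exact hp.1.2
  have hq : 0 < Complex.normSq q₀ := Complex.normSq_pos.2 P.ne_zero
  have hk := C.energy_bounds P hle
  have hkρ : -(γ / 8) ≤ k * Complex.normSq q₀ := by
    rcases le_total 0 k with h1 | h1
    · have := mul_nonneg h1 hq.le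
      linarith
    · nlinarith
  -- At this parameter the orbit is outside of the cap, on the side to which it moves initially.
  obtain ⟨n, hn2, hny⟩ : ∃ n : ℝ, n ^ 2 = 3 * ρ₀ / γ ∧ 0 ≤ n * (starRingEnd ℂ q₀ * p₀).re := by
    have h1 : √(3 * ρ₀ / γ) ^ 2 = 3 * ρ₀ / γ := Real.sq_sqrt (by positivity)
    rcases le_total 0 (starRingEnd ℂ q₀ * p₀).re with h2 | h2
    · exact ⟨_, h1, mul_nonneg (Real.sqrt_nonneg _) h2⟩
    · exact ⟨-√(3 * ρ₀ / γ), by rw [neg_sq, h1], by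
        have := mul_nonneg (Real.sqrt_nonneg (3 * ρ₀ / γ)) (neg_nonneg.2 h2)
        linarith⟩
  have hkn : |k * n ^ 2| ≤ 3 / 8 := by
    have h1 : k * n ^ 2 = 3 / γ * (k * ρ₀) := by rw [hn2]; ring
    rw [h1, abs_mul, abs_of_pos (by positivity : 0 < 3 / γ)]
    calc 3 / γ * |k * ρ₀| ≤ 3 / γ * (γ / 8) := by gcongr; exact abs_le.2 hk
      _ = 3 / 8 := by field_simp
  have hn0 : n ≠ 0 := fun h0 => by
    have : 0 < 3 * ρ₀ / γ := by positivity
    rw [← hn2, h0] at this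
    simp at this
  have hx : ∀ x ∈ Icc (min 0 n) (max 0 n), x ^ 2 ≤ n ^ 2 ∧ 0 ≤ x * (starRingEnd ℂ q₀ * p₀).re := by
    intro x hx
    rcases lt_or_gt_of_ne hn0 with h1 | h1
    · rw [min_eq_right h1.le, max_eq_left h1.le] at hx
      have h2 : (starRingEnd ℂ q₀ * p₀).re ≤ 0 := by by_contra! h3; nlinarith
      exact ⟨by nlinarith [hx.1, hx.2], mul_nonneg_of_nonpos_of_nonpos hx.2 h2⟩
    · rw [min_eq_left h1.le, max_eq_right h1.le] at hx
      have h2 : 0 ≤ (starRingEnd ℂ q₀ * p₀).re := by by_contra! h3; nlinarith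
      exact ⟨by nlinarith [hx.1, hx.2], mul_nonneg hx.1 h2⟩
  have hpos : ∀ x ∈ Icc (min 0 n) (max 0 n), |k * x ^ 2| ≤ 3 / 8 := fun x hxI => by
    refine le_trans ?_ hkn
    rw [abs_mul, abs_mul, abs_of_nonneg (sq_nonneg x), abs_of_nonneg (sq_nonneg n)]
    exact mul_le_mul_of_nonneg_left (hx x hxI).1 (abs_nonneg k)
  have hminus : ∀ x ∈ Icc (min 0 n) (max 0 n), 0 < 1 - k * x ^ 2 := fun x hxI => by
    linarith [(abs_le.1 (hpos x hxI)).2]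
  have hplus : ∀ x ∈ Icc (min 0 n) (max 0 n), 0 < 1 + k * x ^ 2 := fun x hxI => by
    linarith [(abs_le.1 (hpos x hxI)).1]
  have hρ : ∀ x ∈ Icc (min 0 n) (max 0 n), (1 + k * x ^ 2) ^ 2 * Complex.normSq q₀ +
      4 * x ^ 2 * Complex.normSq p₀ ≤
      Complex.normSq (lcPos k q₀ p₀ x) * (1 - k * x ^ 2) ^ 2 := fun x hxI => by
    rw [normSq_lcPos_mul (hminus x hxI)]
    have := mul_nonneg (hplus x hxI).le (hx x hxI).2
    linarith
  obtain ⟨a, ha, d, hd, hX⟩ := P.exists_isOrbit_Icc H C.sq_eq C.b_eq C.m_pos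
    (min_le_max : min 0 n ≤ max 0 n) hminus fun x hxI h0 => by
      have h1 := hρ x hxI
      rw [h0, map_zero, zero_mul] at h1
      have h2 := mul_pos (pow_pos (hplus x hxI) 2) hq
      have h3 := mul_nonneg (sq_nonneg x) (Complex.normSq_nonneg p₀)
      linarith
  have h0I : (0 : ℝ) ∈ Icc (min 0 n) (max 0 n) := ⟨min_le_left _ _, le_max_left _ _⟩
  have hnI : n ∈ Icc (min 0 n) (max 0 n) := ⟨min_le_right _ _, le_max_right _ _⟩
  obtain ⟨G, -, hG⟩ := hX.exists_time ha hd h0I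
  refine ⟨G n, S.coverState b c m k q₀ p₀ n, ?_, ?_⟩
  · have := hG n hnI
    rwa [P.coverState_zero] at this
  · rw [H.coverState_mem_cap_iff (hX.mem n ⟨ha.trans_le hnI.1, hnI.2.trans_lt hd⟩).1, not_le]
    have h1 := hρ n hnI
    have h2 : 0 < (1 - k * n ^ 2) ^ 2 := pow_pos (hminus n hnI) 2
    rw [← mul_lt_mul_iff_left₀ h2]
    refine lt_of_lt_of_le ?_ h1
    have h3 : 4 * n ^ 2 * Complex.normSq p₀ ≥ 4 * n ^ 2 * (3 / 8 * γ) := by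
      rw [P.normSq_mom]
      exact mul_le_mul_of_nonneg_left (by linarith) (by positivity)
    have h4 : 4 * n ^ 2 * (3 / 8 * γ) = 9 / 2 * ρ₀ := by rw [hn2]; field_simp; ring
    have h5 : (1 - k * n ^ 2) ^ 2 ≤ 4 := by
      have := abs_le.1 hkn
      nlinarith [this.1, this.2]
    have h6 := mul_nonneg (sq_nonneg (1 + k * n ^ 2)) hq.le
    nlinarith

end IsSmallCap

end SphericalSurface

/-! ### The map across a small cap -/

namespace SphericalSurface

section CrossMap

variable {γ κ : ℝ} {m : ℕ}

/-- Minus the direction of this number is the factor by which the Levi-Civita position is turned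
when the particle crosses a cap. -/
def turnVector (γ κ : ℝ) (p : ℝ × ℂ × ℝ × ℝ) : ℂ :=
  ((γ - κ ^ 2 * p.2.2.1 ^ 2 : ℝ) : ℂ) + ((κ * p.2.2.1 * p.2.2.2 : ℝ) : ℂ) * Complex.I

/-- The factor by which the Levi-Civita position is turned when the particle crosses a cap. -/
def turnFactor (γ κ : ℝ) (p : ℝ × ℂ × ℝ × ℝ) : ℂ := (-‖turnVector γ κ p‖⁻¹) • turnVector γ κ p

/-- The map across a cap, given by a formula that extends it to the collision orbits. -/
def crossMap (γ κ : ℝ) (m : ℕ) (p : ℝ × ℂ × ℝ × ℝ) : ℝ × ℂ × ℝ × ℝ :=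
  (p.1, turnFactor γ κ p ^ m * p.2.1, p.2.2.1, -p.2.2.2)

theorem contDiff_turnVector : ContDiff ℝ ∞ (turnVector γ κ) := by
  have h1 : ContDiff ℝ ∞ fun p : ℝ × ℂ × ℝ × ℝ => γ - κ ^ 2 * p.2.2.1 ^ 2 := by fun_prop
  have h2 : ContDiff ℝ ∞ fun p : ℝ × ℂ × ℝ × ℝ => κ * p.2.2.1 * p.2.2.2 := by fun_prop
  exact (Complex.ofRealCLM.contDiff.comp h1).add
    ((Complex.ofRealCLM.contDiff.comp h2).mul contDiff_const)

theorem contDiffOn_crossMap : ContDiffOn ℝ ∞ (crossMap γ κ m) {p | turnVector γ κ p ≠ 0} := by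
  intro p hp
  have h1 := (contDiff_turnVector (γ := γ) (κ := κ)).contDiffAt (x := p)
  have h2 : ContDiffAt ℝ ∞ (turnFactor γ κ) p :=
    ((h1.norm ℝ hp).inv (norm_ne_zero_iff.2 hp)).neg.smul h1
  have h3 : ContDiffAt ℝ ∞ (fun p : ℝ × ℂ × ℝ × ℝ => p.2.1) p := by fun_prop
  refine ContDiffAt.contDiffWithinAt ?_
  exact contDiffAt_fst.prodMk (((h2.pow m).mul h3).prodMk (ContDiffAt.prodMk (by fun_prop)
    (by fun_prop)))

theorem turnVector_crossMap (p : ℝ × ℂ × ℝ × ℝ) :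
    turnVector γ κ (crossMap γ κ m p) = starRingEnd ℂ (turnVector γ κ p) := by
  simp [turnVector, crossMap]

theorem norm_turnFactor {p : ℝ × ℂ × ℝ × ℝ} (hp : turnVector γ κ p ≠ 0) :
    ‖turnFactor γ κ p‖ = 1 := by
  have := norm_ne_zero_iff.2 hp
  rw [turnFactor, norm_smul, norm_neg, norm_inv, norm_norm]
  field_simp

/-- Reversing `v` conjugates the turn vector, which makes `crossMap` an involution. -/
theorem crossMap_crossMap {p : ℝ × ℂ × ℝ × ℝ} (hp : turnVector γ κ p ≠ 0) :
    crossMap γ κ m (crossMap γ κ m p) = p := by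
  have h1 : turnFactor γ κ (crossMap γ κ m p) = starRingEnd ℂ (turnFactor γ κ p) := by
    simp [turnFactor, turnVector_crossMap]
  have h2 : starRingEnd ℂ (turnFactor γ κ p) * turnFactor γ κ p = 1 := by
    rw [← Complex.normSq_eq_conj_mul_self, Complex.normSq_eq_norm_sq, norm_turnFactor hp]
    simp
  refine Prod.ext rfl (Prod.ext ?_ (Prod.ext rfl (neg_neg _)))
  change turnFactor γ κ (crossMap γ κ m p) ^ m * (turnFactor γ κ p ^ m * p.2.1) = p.2.1
  rw [h1, ← mul_assoc, ← mul_pow, h2, one_pow, one_mul]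

end CrossMap

variable {S : SphericalSurface} {b c β γ h ρ₀ : ℝ} {m : ℕ} {k : ℝ} {q₀ p₀ : ℂ}
  {p : ℝ × ℂ × ℝ × ℝ}

/-- The ratio `b f / ρ` at the gnomonic radius `ρ`, which is `1` at the pole. -/
def metricFactor (c ρ : ℝ) : ℝ := 1 / √(1 + (ρ / c) ^ 2)

theorem metricFactor_sq : metricFactor c ρ₀ ^ 2 * (1 + (ρ₀ / c) ^ 2) = 1 := by
  rw [metricFactor, div_pow, Real.sq_sqrt (by positivity)]
  field_simp

theorem metricFactor_pos : 0 < metricFactor c ρ₀ := by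
  unfold metricFactor
  positivity

namespace IsSmallCap

variable (C : S.IsSmallCap b c β γ h m ρ₀)
include C

/-- The turn vector vanishes only if `v = 0` and `κ² u² = γ`, but on the boundary of a small cap
`v = 0` forces `u²` to be close to `2γ`. -/
theorem turnVector_ne_zero
    (hp : p ∈ relBoundary (S.energyManifold β γ h) (S.cap b c β γ h ρ₀)) :
    turnVector γ (metricFactor c ρ₀) p ≠ 0 := by
  obtain ⟨-, -, hE⟩ := C.mem_relBoundary_iff.1 hp
  have hκ := metricFactor_sq (c := c) (ρ₀ := ρ₀)
  have hκ0 : 0 < metricFactor c ρ₀ := metricFactor_pos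
  have hc := C.isSpindle.c_pos
  have hγ := C.γ_pos
  set κ := metricFactor c ρ₀
  intro h0
  have hre : γ = κ ^ 2 * p.2.2.1 ^ 2 := by
    have := congrArg Complex.re h0
    simp only [turnVector, Complex.add_re, Complex.ofReal_re, Complex.re_ofReal_mul, Complex.I_re,
      mul_zero, add_zero, Complex.zero_re] at this
    linarith
  have him : κ * p.2.2.1 * p.2.2.2 = 0 := by
    have := congrArg Complex.im h0
    simpa only [turnVector, Complex.add_im, Complex.ofReal_im, Complex.im_ofReal_mul, Complex.I_im,
      mul_one, zero_add, Complex.zero_im] using this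
  have hu : p.2.2.1 ≠ 0 := fun hu => by rw [hu] at hre; simp at hre; exact hγ.ne' hre
  have hv : p.2.2.2 = 0 := (mul_eq_zero.1 him).resolve_left (mul_ne_zero hκ0.ne' hu)
  have h1 : (ρ₀ / c) ^ 2 ≤ 1 / 9 := by
    have h2 : ρ₀ / c ≤ 1 / 3 := by rw [div_le_iff₀ hc]; linarith [C.ρ₀_le]
    have h3 : 0 ≤ ρ₀ / c := by have := C.ρ₀_pos; positivity
    nlinarith
  have h2 : 9 / 10 ≤ κ ^ 2 := by nlinarith [sq_nonneg κ]
  have h3 : 7 / 4 * γ ≤ p.2.2.1 ^ 2 := by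
    rw [hv] at hE
    linarith [C.h_bounds.1]
  nlinarith

theorem crossMap_mem (hp : p ∈ relBoundary (S.energyManifold β γ h) (S.cap b c β γ h ρ₀)) :
    crossMap γ (metricFactor c ρ₀) m p ∈
      relBoundary (S.energyManifold β γ h) (S.cap b c β γ h ρ₀) := by
  obtain ⟨h1, h2, h3⟩ := C.mem_relBoundary_iff.1 hp
  refine C.mem_relBoundary_iff.2 ⟨h1, ?_, ?_⟩
  · simp [crossMap, norm_turnFactor (C.turnVector_ne_zero hp), h2]
  · simpa [crossMap] using h3

/-- The momentum in the plane of the Levi-Civita variable, for a state on the boundary. -/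
theorem mom_eq (P : S.IsLift b c γ h m k q₀ p₀ p) (hr : p.1 = S.param b c ρ₀) :
    (ρ₀ : ℂ) * p₀ = (((starRingEnd ℂ q₀ * p₀).re : ℂ) + (starRingEnd ℂ q₀ * p₀).im * Complex.I) *
      q₀ := by
  rw [Complex.re_add_im, ← C.normSq_eq P hr, Complex.normSq_eq_conj_mul_self]
  ring

/-- A boundary state that enters the cap with non-zero angular momentum is carried across the cap by
`crossMap`. The exit parameter is the root `-2y / (D + W)` of the quadratic equation
`k y n² + D n + y = 0`, where `D` is the initial derivative of `y`. The square root `W` of its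
discriminant is `|ζ| / 2` with the turn vector `ζ`. -/
theorem flowsTo_crossMap (hp : p ∈ relBoundary (S.energyManifold β γ h) (S.cap b c β γ h ρ₀))
    (hv : p.2.2.2 ≤ 0) (hu : p.2.2.1 ≠ 0) :
    p ∉ asymptoticIn (S.energyManifold β γ h) (S.collisionSet β γ h) (S.keplerField β γ)
      (S.cap b c β γ h ρ₀) ∧
    FlowsTo (S.energyManifold β γ h) (S.collisionSet β γ h) (S.keplerField β γ) p
      (exitTime (S.energyManifold β γ h) (S.collisionSet β γ h) (S.keplerField β γ)
        (S.cap b c β γ h ρ₀) p) (crossMap γ (metricFactor c ρ₀) m p) := by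
  obtain ⟨hr, hz, hE⟩ := C.mem_relBoundary_iff.1 hp
  obtain ⟨k, q₀, p₀, P⟩ := C.exists_lift hp.1 hr
  have H := C.isSpindle
  have hF := H.contDiffAt (h := h) C.sq_eq C.γ_pos
  have hρ₀ := C.ρ₀_pos
  have hc := H.c_pos
  have hqq := C.normSq_eq P hr
  have hq0 : 0 < ‖q₀‖ := norm_pos_iff.2 P.ne_zero
  have hqn : ‖q₀‖ ^ 2 = ρ₀ := by rw [← Complex.normSq_eq_norm_sq, hqq]
  have hD := C.momentum_pos P hr
  have hmom := C.mom_eq P hr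
  have hκ := metricFactor_sq (c := c) (ρ₀ := ρ₀)
  have hζ := C.turnVector_ne_zero hp
  have hre := P.re_eq
  have him := P.im_eq
  have hen := P.energy
  have hpp := P.normSq_mom
  rw [hqq] at him hpp
  rw [div_eq_mul_one_div] at him
  change _ = _ * metricFactor c ρ₀ at him
  have hκ0 : 0 < metricFactor c ρ₀ := metricFactor_pos
  set κ := metricFactor c ρ₀
  set y := (starRingEnd ℂ q₀ * p₀).re with hy
  set J := (starRingEnd ℂ q₀ * p₀).im with hJ
  set u := p.2.2.1
  set v := p.2.2.2
  set D := 2 * k * ρ₀ + γ / 2 with hDdef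
  set W := ‖turnVector γ κ p‖ / 2 with hWdef
  have hW : 0 < W := half_pos (norm_pos_iff.2 hζ)
  have hy2 : 4 * y ^ 2 = v ^ 2 * ρ₀ := by
    rw [← hqn]; linear_combination (2 * y + v * ‖q₀‖) * hre
  have hyJ : 4 * (y * J) = u * v * κ * ρ₀ := by
    rw [← hqn]; linear_combination 2 * J * hre + v * ‖q₀‖ * him
  have hJ2 : 4 * J ^ 2 = u ^ 2 * κ ^ 2 * ρ₀ := by
    rw [← hqn]; linear_combination (2 * J + u * ‖q₀‖ * κ) * him
  have hkρ : 4 * (k * ρ₀) = v ^ 2 - 2 * γ + u ^ 2 * κ ^ 2 := by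
    have h1 : 2 * (k * ρ₀) = h * ρ₀ - u ^ 2 * (κ ^ 2 * (ρ₀ / c) ^ 2) / 2 := by
      have h2 : (2 * J) ^ 2 = u ^ 2 * κ ^ 2 * ρ₀ := by rw [← hJ2]; ring
      rw [h2] at hen
      field_simp at hen ⊢
      linear_combination hen
    have h3 : κ ^ 2 * (ρ₀ / c) ^ 2 = 1 - κ ^ 2 := by linarith
    rw [h3] at h1
    linarith
  have hDeq : D = (v ^ 2 + u ^ 2 * κ ^ 2 - γ) / 2 := by rw [hDdef]; linarith
  have hWsq : W ^ 2 = D ^ 2 - 4 * k * y ^ 2 := by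
    have h1 : ‖turnVector γ κ p‖ ^ 2 = (γ - κ ^ 2 * u ^ 2) ^ 2 + (κ * u * v) ^ 2 := by
      rw [← Complex.normSq_eq_norm_sq, turnVector, Complex.normSq_add_mul_I]
    have h2 : 4 * k * y ^ 2 = k * ρ₀ * v ^ 2 := by linear_combination k * hy2
    rw [hWdef, div_pow, h1, h2, hDeq]
    linear_combination v ^ 2 / 4 * hkρ
  have hs : 0 < D + W := by linarith
  set n₁ := -2 * y / (D + W) with hn₁
  have hy0 : y ≤ 0 := by nlinarith
  have hn₁0 : 0 ≤ n₁ := div_nonneg (by linarith) hs.le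
  have hsn : n₁ * (D + W) = -2 * y := div_mul_cancel₀ _ hs.ne'
  have hkn : k * n₁ ^ 2 = (D - W) / (D + W) := by
    rw [eq_div_iff hs.ne']
    refine mul_right_cancel₀ hs.ne' ?_
    linear_combination k * (n₁ * (D + W) - 2 * y) * hsn + hWsq
  have hminus : 1 - k * n₁ ^ 2 = 2 * W / (D + W) := by rw [hkn]; field_simp; ring
  have hplus : 1 + k * n₁ ^ 2 = 2 * D / (D + W) := by rw [hkn]; field_simp; ring
  have hkyn : k * y * n₁ = -(D - W) / 2 := by
    refine mul_right_cancel₀ hs.ne' ?_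
    linear_combination k * y * hsn - hWsq / 2
  have hpos1 : 0 < 1 - k * n₁ ^ 2 := by rw [hminus]; positivity
  have hpos : ∀ n ∈ Icc 0 n₁, 0 < 1 - k * n ^ 2 := fun n hn =>
    (ordConnected_one_sub_pos k).out (show (0 : ℝ) < 1 - k * 0 ^ 2 by simp) hpos1 hn
  have hJ0 : J ≠ 0 := fun h0 => by
    rw [h0] at him
    have := mul_ne_zero (mul_ne_zero hu hq0.ne') hκ0.ne'
    exact this (by linarith)
  obtain ⟨a, ha, d, hd, hX⟩ := P.exists_isOrbit_Icc H C.sq_eq C.b_eq C.m_pos hn₁0 hpos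
    fun n hn h0 => by
      have h1 := im_conj_lcPos_mul_lcMom (q₀ := q₀) (p₀ := p₀) (hpos n hn)
      rw [h0, map_zero, zero_mul, Complex.zero_im] at h1
      exact hJ0 h1.symm
  -- The factorization of the function whose sign tells whether the orbit is in the cap.
  have hfac : ∀ n, y * (1 + k * n ^ 2) + D * n = (n - n₁) * (k * y * (n + n₁) + D) := fun n => by
    have h1 : y * (1 + k * n₁ ^ 2) + D * n₁ = 0 := by rw [hplus, hn₁]; field_simp; ring
    linear_combination h1
  have hin : ∀ n ∈ Icc 0 n₁, S.coverState b c m k q₀ p₀ n ∈ S.cap b c β γ h ρ₀ := fun n hn => by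
    rw [C.mem_iff P hr (hpos n hn) (hX.mem n ⟨ha.trans_le hn.1, hn.2.trans_lt hd⟩).1, ← hy, hfac]
    have h1 : 0 < k * y * (n + n₁) + D := by
      rw [mul_add, hkyn]
      rcases le_total 0 (k * y) with h2 | h2
      · have := mul_nonneg h2 hn.1
        linarith
      · have := mul_le_mul_of_nonpos_left hn.2 h2
        linarith
    refine mul_nonpos_of_nonneg_of_nonpos hn.1 (mul_nonpos_of_nonpos_of_nonneg ?_ h1.le)
    linarith [hn.2]
  have hout : ∀ᶠ n in 𝓝[>] n₁, S.coverState b c m k q₀ p₀ n ∉ S.cap b c β γ h ρ₀ := by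
    have h1 : ∀ᶠ n in 𝓝 n₁, 0 < 1 - k * n ^ 2 :=
      (by fun_prop : ContinuousAt (fun n : ℝ => 1 - k * n ^ 2) n₁).eventually (lt_mem_nhds hpos1)
    have h2 : ∀ᶠ n in 𝓝 n₁, 0 < k * y * (n + n₁) + D :=
      (by fun_prop : ContinuousAt (fun n : ℝ => k * y * (n + n₁) + D) n₁).eventually
        (lt_mem_nhds (by dsimp only; rw [mul_add, hkyn]; linarith))
    filter_upwards [Ioo_mem_nhdsGT hd, nhdsWithin_le_nhds h1, nhdsWithin_le_nhds h2]
      with n h3 h4 h5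
    rw [C.mem_iff P hr h4 (hX.mem n ⟨(ha.trans_le hn₁0).trans h3.1, h3.2⟩).1, ← hy, hfac, not_le]
    exact mul_pos (hn₁0.trans_lt h3.1) (mul_pos (sub_pos.2 h3.1) h5)
  have hfl := hX.flowsTo_exitTime hF ha hn₁0 hd hin hout.frequently
  rw [P.coverState_zero] at hfl
  -- The position and momentum at the exit.
  have hpos_eq : lcPos k q₀ p₀ n₁ = (1 / W) • (D • q₀ - (2 * y) • p₀) := by
    rw [lcPos, hminus, hplus, hn₁]
    match_scalars <;> field_simp
  have hmom_eq : lcMom k q₀ p₀ n₁ = (1 / W) • (D • p₀ - (2 * k * y) • q₀) := by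
    rw [lcMom, hminus, hplus, hn₁]
    match_scalars <;> field_simp
  have hq₁ : lcPos k q₀ p₀ n₁ = turnFactor γ κ p * q₀ := by
    have hWC : (W : ℂ) ≠ 0 := Complex.ofReal_ne_zero.2 hW.ne'
    have hρC : (ρ₀ : ℂ) ≠ 0 := Complex.ofReal_ne_zero.2 hρ₀.ne'
    have h1 : turnFactor γ κ p = -(turnVector γ κ p / (2 * W)) := by
      have : ‖turnVector γ κ p‖ = 2 * W := by rw [hWdef]; ring
      rw [turnFactor, this, Complex.real_smul]
      push_cast
      field_simp
    have h2 : (4 : ℂ) * y ^ 2 = v ^ 2 * ρ₀ := by exact_mod_cast hy2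
    have h3 : (4 : ℂ) * (y * J) = u * v * κ * ρ₀ := by exact_mod_cast hyJ
    have h4 : (D : ℂ) = (v ^ 2 + u ^ 2 * κ ^ 2 - γ) / 2 := by exact_mod_cast hDeq
    have h5 : (D : ℂ) * q₀ - 2 * y * p₀ = -(turnVector γ κ p / 2) * q₀ := by
      refine mul_left_cancel₀ hρC ?_
      rw [h4, turnVector]
      push_cast
      linear_combination (-(2 : ℂ) * y) * hmom - q₀ / 2 * h2 - q₀ * Complex.I / 2 * h3
    rw [hpos_eq, h1]
    simp only [Complex.real_smul]
    push_cast
    rw [h5]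
    field_simp
  have hn1 : ‖lcPos k q₀ p₀ n₁‖ = ‖q₀‖ := by
    rw [hq₁, norm_mul, norm_turnFactor hζ, one_mul]
  have hns : Complex.normSq (lcPos k q₀ p₀ n₁) = ρ₀ := by
    rw [Complex.normSq_eq_norm_sq, hn1, hqn]
  have hY : lcY k q₀ p₀ n₁ = -y := by
    have h1 : lcY k q₀ p₀ n₁ = (1 / W) ^ 2 *
        ((D ^ 2 + 4 * k * y ^ 2) * y - 2 * k * y * D * Complex.normSq q₀ -
          2 * y * D * Complex.normSq p₀) := by
      rw [lcY, hpos_eq, hmom_eq, hy]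
      simp [Complex.normSq_apply, -Complex.real_smul, Complex.smul_re, Complex.smul_im]
      ring
    rw [h1, hqq, hpp]
    have h2 : k * ρ₀ + γ / 2 = D - k * ρ₀ := by rw [hDdef]; ring
    rw [h2]
    field_simp
    linear_combination y * hWsq
  have hend : S.coverState b c m k q₀ p₀ n₁ = crossMap γ κ m p := by
    have h0 := P.coverState_zero
    rw [coverState, lcState, lcPos_zero, hqq] at h0
    have h0z : (q₀ / (‖q₀‖ : ℂ)) ^ m = p.2.1 := by
      have := congrArg (fun p : ℝ × ℂ × ℝ × ℝ => p.2.1) h0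
      simpa [state, lcMeridian] using this
    have h0u := congrArg (fun p : ℝ × ℂ × ℝ × ℝ => p.2.2.1) h0
    have h0v := congrArg (fun p : ℝ × ℂ × ℝ × ℝ => p.2.2.2) h0
    rw [coverState, lcState, hns]
    refine Prod.ext hr.symm (Prod.ext ?_ (Prod.ext h0u ?_))
    · change lcMeridian m k q₀ p₀ n₁ = turnFactor γ κ p ^ m * p.2.1
      rw [← h0z, lcMeridian, hn1, hq₁, mul_div_assoc, mul_pow]
    · change 2 * lcY k q₀ p₀ n₁ / √ρ₀ = -p.2.2.2
      rw [hY, ← h0v]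
      simp only [state, lcY, lcPos_zero, lcMom_zero]
      rw [← hy]
      ring
  rw [← hend]
  exact hfl

end IsSmallCap

end SphericalSurface

/-! ### Small caps are trivializable -/

theorem IsSmoothMap.continuous {E : Type*} [NormedAddCommGroup E] [NormedSpace ℝ E] {A A' : Set E}
    {Ψ : A → A'} (h : IsSmoothMap Ψ) : Continuous fun x => (Ψ x : E) := by
  refine continuous_iff_continuousAt.2 fun x => ?_
  obtain ⟨U, hU, hx, g, hg, hgΨ⟩ := h x
  have h1 : ContinuousAt (fun y : A => g y) x :=
    ContinuousAt.comp (f := fun y : A => (y : E))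
      ((hg.continuousOn _ hx).continuousAt (hU.mem_nhds hx)) continuous_subtype_val.continuousAt
  refine h1.congr ?_
  filter_upwards [continuous_subtype_val.continuousAt (hU.mem_nhds hx)] with y hy
    using (hgΨ y hy).symm

namespace SphericalSurface

variable {S : SphericalSurface} {b c β γ h ρ₀ : ℝ} {m : ℕ} {k : ℝ} {q₀ p₀ : ℂ}
  {p : ℝ × ℂ × ℝ × ℝ}

namespace IsSmallCap

variable (C : S.IsSmallCap b c β γ h m ρ₀)
include C

/-- A boundary state without angular momentum that enters the cap ends in a collision. -/
theorem mem_asymptoticIn (hp : p ∈ relBoundary (S.energyManifold β γ h) (S.cap b c β γ h ρ₀))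
    (hv : p.2.2.2 ≤ 0) (hu : p.2.2.1 = 0) :
    p ∈ asymptoticIn (S.energyManifold β γ h) (S.collisionSet β γ h) (S.keplerField β γ)
      (S.cap b c β γ h ρ₀) := by
  refine ⟨C.mem_ingress_iff.2 ⟨hp, hv⟩, fun t ht x hx => ?_⟩
  obtain ⟨hr, hz, hE⟩ := C.mem_relBoundary_iff.1 hp
  obtain ⟨k, q₀, p₀, P⟩ := C.exists_lift hp.1 hr
  have H := C.isSpindle
  have hF := H.contDiffAt (h := h) C.sq_eq C.γ_pos
  have hρ₀ := C.ρ₀_pos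
  have hγ := C.γ_pos
  have hqq := C.normSq_eq P hr
  have hq0 : 0 < ‖q₀‖ := norm_pos_iff.2 P.ne_zero
  have hmom := C.mom_eq P hr
  have hpp := P.normSq_mom
  have hv0 : p.2.2.2 < 0 := hv.lt_of_ne fun h0 => by
    have := C.energy_pos
    simp [hu, h0] at hE
    linarith
  have hJ : (starRingEnd ℂ q₀ * p₀).im = 0 := by
    have := P.im_eq
    rw [hu, zero_mul, zero_div] at this
    linarith
  have hre := P.re_eq
  rw [hJ] at hmom
  rw [hqq] at hpp
  set y := (starRingEnd ℂ q₀ * p₀).re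
  have hy : y < 0 := by nlinarith
  -- The momentum is `-a q₀`, and `a² - s²` is the energy constant.
  set a := -y / ρ₀ with ha
  have ha0 : 0 < a := div_pos (by linarith) hρ₀
  have hp₀ : p₀ = (-a) • q₀ := by
    have hρC : (ρ₀ : ℂ) ≠ 0 := Complex.ofReal_ne_zero.2 hρ₀.ne'
    refine mul_left_cancel₀ hρC ?_
    rw [hmom, ha, Complex.real_smul]
    push_cast
    field_simp
    ring
  have hak : a ^ 2 * ρ₀ = k * ρ₀ + γ / 2 := by
    rw [← hpp, hp₀, Complex.real_smul, Complex.normSq_mul, Complex.normSq_ofReal, hqq]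
    ring
  set s := √(γ / (2 * ρ₀)) with hs
  have hs0 : 0 < s := Real.sqrt_pos.2 (by positivity)
  have hs2 : s ^ 2 = a ^ 2 - k := by
    rw [hs, Real.sq_sqrt (by positivity)]
    field_simp
    linarith
  have hk : k = (a - s) * (a + s) := by linarith
  have hpos_eq : ∀ n, lcPos k q₀ p₀ n =
      ((1 - k * n ^ 2)⁻¹ * ((1 - (a + s) * n) * (1 - (a - s) * n))) • q₀ := fun n => by
    rw [lcPos, hp₀, smul_smul, ← add_smul, smul_smul]
    congr 2
    rw [hk]
    ring
  set nc := 1 / (a + s) with hnc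
  have has : 0 < a + s := by linarith
  have hnc0 : 0 < nc := by positivity
  have hbd : ∀ n, |n| < nc → |(a + s) * n| < 1 ∧ |(a - s) * n| < 1 := fun n hn => by
    have h1 : |(a + s) * n| < 1 := by
      rw [abs_mul, abs_of_pos has, mul_comm]
      exact (lt_div_iff₀ has).1 hn
    refine ⟨h1, lt_of_le_of_lt ?_ h1⟩
    rw [abs_mul, abs_mul]
    refine mul_le_mul_of_nonneg_right ?_ (abs_nonneg n)
    rw [abs_of_pos has, abs_le]
    constructor <;> linarith
  have hpos : ∀ n, |n| < nc → 0 < 1 - k * n ^ 2 := fun n hn => by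
    obtain ⟨h1, h2⟩ := hbd n hn
    have h3 : k * n ^ 2 = ((a - s) * n) * ((a + s) * n) := by rw [hk]; ring
    have h4 : |k * n ^ 2| < 1 := by
      rw [h3, abs_mul]
      exact mul_lt_one_of_nonneg_of_lt_one_left (abs_nonneg _) h2 h1.le
    linarith [(abs_lt.1 h4).2]
  have hnum : ∀ n, |n| < nc → 0 < 1 - (a + s) * n ∧ 0 < 1 - (a - s) * n := fun n hn => by
    obtain ⟨h1, h2⟩ := hbd n hn
    exact ⟨by linarith [(abs_lt.1 h1).2], by linarith [(abs_lt.1 h2).2]⟩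
  have hX := P.isOrbit H C.sq_eq C.b_eq C.m_pos (n₁ := -nc) (n₂ := nc)
    (fun n hn => hpos n (abs_lt.2 hn)) fun n hn => by
      have hn' := abs_lt.2 hn
      rw [hpos_eq]
      exact smul_ne_zero (mul_pos (inv_pos.2 (hpos n hn'))
        (mul_pos (hnum n hn').1 (hnum n hn').2)).ne' P.ne_zero
  have hin : ∀ n ∈ Ico 0 nc, S.coverState b c m k q₀ p₀ n ∈ S.cap b c β γ h ρ₀ := fun n hn => by
    have hI : n ∈ Ioo (-nc) nc := ⟨by linarith [hn.1], hn.2⟩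
    have hn' := abs_lt.2 hI
    rw [H.coverState_mem_cap_iff (hX.mem n hI).1, hpos_eq, Complex.real_smul, Complex.normSq_mul,
      Complex.normSq_ofReal, hqq]
    refine mul_le_of_le_one_left hρ₀.le ?_
    rw [← sq, sq_le_one_iff_abs_le_one, abs_of_nonneg (mul_pos (inv_pos.2 (hpos n hn'))
        (mul_pos (hnum n hn').1 (hnum n hn').2)).le, inv_mul_le_iff₀ (hpos n hn'), mul_one]
    have h1 : (a - s) * ((a + s) * n) ≤ a := by
      have h2 := (abs_lt.1 (hbd n hn').1).2
      have h3 : 0 ≤ (a + s) * n := mul_nonneg has.le hn.1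
      rcases le_total 0 (a - s) with h4 | h4
      · nlinarith
      · nlinarith
    have h5 := mul_le_mul_of_nonneg_left h1 hn.1
    rw [hk]
    linarith
  have hlim : Tendsto (fun n => Complex.normSq (lcPos k q₀ p₀ n)) (𝓝[<] nc) (𝓝 0) := by
    have h1 : 0 < 1 - k * nc ^ 2 := by
      have : 1 - k * nc ^ 2 = 2 * s / (a + s) := by rw [hk, hnc]; field_simp; ring
      rw [this]
      positivity
    have h2 : lcPos k q₀ p₀ nc = 0 := by
      rw [hpos_eq, hnc, mul_one_div_cancel has.ne']
      simp
    have h3 := (hasDerivAt_normSq_lcPos (q₀ := q₀) (p₀ := p₀) h1).continuousAt.tendsto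
    rw [h2, map_zero] at h3
    exact h3.mono_left nhdsWithin_le_nhds
  refine IsOrbit.mem_of_flowsTo_of_nonneg (X := S.coverState b c m k q₀ p₀)
    (g := lcSpeed b c k q₀ p₀) (n₀ := 0) (l := 𝓝[<] nc) hF ?_
    (H.not_mapClusterPt C.sq_eq coverState_fst (Or.inl hlim)) ht (by rwa [P.coverState_zero])
  filter_upwards [Ioo_mem_nhdsLT hnc0] with n hn
  exact ⟨hn.1.le, ⟨-nc, by linarith, nc, hn.2, hX⟩, fun n' hn' => hin n' ⟨hn'.1, hn'.2.trans_lt hn.2⟩⟩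

/-- The diffeomorphism from the ingress points to the egress points. -/
def crossEquiv : ingress (S.energyManifold β γ h) (S.collisionSet β γ h) (S.keplerField β γ)
    (S.cap b c β γ h ρ₀) ≃ egress (S.energyManifold β γ h) (S.collisionSet β γ h)
    (S.keplerField β γ) (S.cap b c β γ h ρ₀) where
  toFun x := ⟨crossMap γ (metricFactor c ρ₀) m x, by
    have := C.mem_ingress_iff.1 x.2
    exact C.mem_egress_iff.2 ⟨C.crossMap_mem this.1, neg_nonneg.2 this.2⟩⟩
  invFun x := ⟨crossMap γ (metricFactor c ρ₀) m x, by
    have := C.mem_egress_iff.1 x.2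
    exact C.mem_ingress_iff.2 ⟨C.crossMap_mem this.1, neg_nonpos.2 this.2⟩⟩
  left_inv x := Subtype.ext (crossMap_crossMap (C.turnVector_ne_zero (C.mem_ingress_iff.1 x.2).1))
  right_inv x := Subtype.ext (crossMap_crossMap (C.turnVector_ne_zero (C.mem_egress_iff.1 x.2).1))

theorem isDiffeo_crossEquiv : IsDiffeo C.crossEquiv := by
  have hopen : IsOpen {p | turnVector γ (metricFactor c ρ₀) p ≠ 0} :=
    isOpen_ne_fun contDiff_turnVector.continuous continuous_const
  exact ⟨fun x => ⟨_, hopen, C.turnVector_ne_zero (C.mem_ingress_iff.1 x.2).1, _,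
      contDiffOn_crossMap, fun y _ => rfl⟩,
    fun x => ⟨_, hopen, C.turnVector_ne_zero (C.mem_egress_iff.1 x.2).1, _,
      contDiffOn_crossMap, fun y _ => rfl⟩⟩

/-- The map across the cap extends uniquely, as the orbits with non-zero angular momentum are dense. -/
theorem isTrivializable : IsTrivializable (S.energyManifold β γ h) (S.collisionSet β γ h)
    (S.keplerField β γ) (S.cap b c β γ h ρ₀) := by
  have hF := C.isSpindle.contDiffAt (h := h) C.sq_eq C.γ_pos
  have hflow : ∀ x ∈ ingress (S.energyManifold β γ h) (S.collisionSet β γ h) (S.keplerField β γ)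
      (S.cap b c β γ h ρ₀), x.2.2.1 ≠ 0 → _ := fun x hx hu =>
    C.flowsTo_crossMap (C.mem_ingress_iff.1 hx).1 (C.mem_ingress_iff.1 hx).2 hu
  refine ⟨C.crossEquiv, ⟨C.isDiffeo_crossEquiv, fun x hx => ?_⟩, fun Ψ hΨ => Equiv.ext fun x => ?_⟩
  · refine (hflow x x.2 fun hu => hx ?_).2
    exact C.mem_asymptoticIn (C.mem_ingress_iff.1 x.2).1 (C.mem_ingress_iff.1 x.2).2 hu
  · have hagree : ∀ y : ingress (S.energyManifold β γ h) (S.collisionSet β γ h)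
        (S.keplerField β γ) (S.cap b c β γ h ρ₀), (y : ℝ × ℂ × ℝ × ℝ).2.2.1 ≠ 0 →
        (Ψ y : ℝ × ℂ × ℝ × ℝ) = C.crossEquiv y := fun y hu => by
      have h1 := hflow y y.2 hu
      exact (hΨ.2 y h1.1).unique hF h1.2
    by_cases hu : (x : ℝ × ℂ × ℝ × ℝ).2.2.1 = 0
    swap
    · exact Subtype.ext (hagree x hu)
    obtain ⟨hb, hv⟩ := C.mem_ingress_iff.1 x.2
    obtain ⟨hr, hz, hE⟩ := C.mem_relBoundary_iff.1 hb
    -- A curve of ingress points with non-zero angular momentum that tends to `x`.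
    set v := (x : ℝ × ℂ × ℝ × ℝ).2.2.2 with hvdef
    rw [hu] at hE
    have hv0 : v ≠ 0 := fun h0 => by
      have := C.energy_pos
      rw [h0] at hE
      linarith
    let X : ℝ → ℝ × ℂ × ℝ × ℝ := fun α =>
      ((x : ℝ × ℂ × ℝ × ℝ).1, (x : ℝ × ℂ × ℝ × ℝ).2.1, v * Real.sin α, v * |Real.cos α|)
    have hX : ∀ α, X α ∈ ingress (S.energyManifold β γ h) (S.collisionSet β γ h)
        (S.keplerField β γ) (S.cap b c β γ h ρ₀) := fun α => by
      refine C.mem_ingress_iff.2 ⟨C.mem_relBoundary_iff.2 ⟨hr, hz, ?_⟩,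
        mul_nonpos_of_nonpos_of_nonneg hv (abs_nonneg _)⟩
      simp only [X]
      rw [mul_pow, mul_pow, sq_abs]
      linear_combination v ^ 2 * Real.sin_sq_add_cos_sq α + hE
    have hXc : Continuous fun α => (⟨X α, hX α⟩ : ingress (S.energyManifold β γ h)
        (S.collisionSet β γ h) (S.keplerField β γ) (S.cap b c β γ h ρ₀)) :=
      Continuous.subtype_mk (by fun_prop) _
    have hX0 : (⟨X 0, hX 0⟩ : ingress (S.energyManifold β γ h)
        (S.collisionSet β γ h) (S.keplerField β γ) (S.cap b c β γ h ρ₀)) = x := by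
      refine Subtype.ext (Prod.ext rfl (Prod.ext rfl (Prod.ext ?_ ?_)))
      · simp [X, hu]
      · simp [X, ← hvdef]
    have h1 := (hΨ.1.1.continuous.comp hXc).tendsto 0
    have h2 := (C.isDiffeo_crossEquiv.1.continuous.comp hXc).tendsto 0
    simp only [Function.comp_apply, hX0] at h1 h2
    refine Subtype.ext (tendsto_nhds_unique_of_frequently_eq h1 h2 ?_)
    refine Filter.Frequently.filter_mono (Filter.Eventually.frequently (f := 𝓝[>] (0 : ℝ)) ?_)
      nhdsWithin_le_nhds
    filter_upwards [Ioo_mem_nhdsGT Real.pi_pos] with α hα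
    exact hagree ⟨X α, hX α⟩ (mul_ne_zero hv0 (Real.sin_pos_of_pos_of_lt_pi hα.1 hα.2).ne')

end IsSmallCap

/-- On the spindle with `b = 2 / m`, sufficiently small caps are trivializable isolating blocks. -/
theorem IsSpindle.isBlockRegularizable (H : S.IsSpindle b c) (hβ : β ^ 2 = b ^ 2) (hγ : 0 < γ)
    (hm : b = 2 / (m : ℝ)) (hm0 : 0 < m) :
    IsBlockRegularizable 2 (S.energyManifold β γ h) (S.collisionSet β γ h) (S.keplerField β γ) := by
  have hc := H.c_pos
  have C : S.IsSmallCap b c β γ h m (min (γ / (8 * (|h| + 1))) (c / 3)) := by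
    refine ⟨H, hβ, hm, hm0, hγ, by positivity, ?_, min_le_right _ _⟩
    calc |h| * min (γ / (8 * (|h| + 1))) (c / 3) ≤ (|h| + 1) * (γ / (8 * (|h| + 1))) :=
          mul_le_mul (by linarith) (min_le_left _ _) (by positivity) (by positivity)
      _ = γ / 8 := by field_simp
  exact ⟨_, C.isIsolatingBlock, C.isolates, C.isTrivializable⟩

end SphericalSurface

end

theorem theorem5 (S : SphericalSurface) (K β γ h : ℝ) (hK : 0 < K)
    (hcurv : ∀ r ∈ Set.Ioo S.rN S.rS, S.gaussCurvature r = K)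
    (hβ : ∀ r ∈ Set.Ioo S.rN S.rS, -S.f r * deriv (deriv S.f) r + deriv S.f r ^ 2 = β ^ 2)
    (hγ : 0 < γ) :
    IsBlockRegularizable 2 (S.energyManifold β γ h) (S.collisionSet β γ h) (S.keplerField β γ) ↔
      ∃ m : ℕ, 0 < m ∧ |β| = 2 / (m : ℝ) := by
  have H := S.isSpindle_of_curvature hK hcurv hβ
  have hb : β ^ 2 = |β| ^ 2 := (sq_abs β).symm
  exact ⟨H.exists_eq_two_div hb hγ, fun ⟨_, hm0, hm⟩ => H.isBlockRegularizable hb hγ hm hm0⟩
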